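/- **Setting.** Let $\Omega\subset\mathbb R^3$ be a bounded open set, $T>0$, $Q_T=\Omega\times(0,T)$, and let $\nu_1>0$, $\nu_1+\nu_2\ge 0$. For $\varepsilon>0$ and $m>1$ let $\varrho_\varepsilon\ge 0$ and $\mathbf u_\varepsilon$ (measurable on $Q_T$, $\mathbf u_\varepsilon(\cdot,t)$ weakly differentiable in $\Omega$ for a.e. $t$) be a weak solution in $Q_T$ of $$\partial_t(\varrho\mathbf u)+\operatorname{div}(\varrho\,\mathbf u\otimes\mathbf u)+\nabla p(\varrho)=\operatorname{div}\mathbb S+\varrho\,\mathbf f,\qquad \partial_t\varrho+\operatorname{div}(\varrho\mathbf u)=0,\qquad p(\varrho)=\varrho^{3/2}(1+\varepsilon\varrho^m),$$ that is, $$\int_{Q_T}\varrho_\varepsilon\mathbf u_\varepsilon\cdot\partial_t\boldsymbol\xi\,dxdt+\int_{Q_T}\big(\varrho_\varepsilon\mathbf u_\varepsilon\otimes\mathbf u_\varepsilon+p(\varrho_\varepsilon)\mathbb I-\mathbb S\big):\nabla\boldsymbol\xi\,dxdt+\int_{Q_T}\varrho_\varepsilon\mathbf f\cdot\boldsymbol\xi\,dxdt=0,\qquad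 \int_{Q_T}\big(\varrho_\varepsilon\partial_t\psi+\varrho_\varepsilon\mathbf u_\varepsilon\cdot\nabla\psi\big)dxdt=0$$ for all vector fields $\boldsymbol\xi\in C_0^\infty(Q_T)$ and functions $\psi\in C_0^\infty(Q_T)$; no initial or boundary conditions are imposed. Assume that $\|\mathbf f\|_{L^\infty(Q_T)}\le C_f$; that the stress is $\mathbb S=\nu_1(\nabla\mathbf u_\varepsilon+\nabla\mathbf u_\varepsilon^\top)+\nu_2\operatorname{div}\mathbf u_\varepsilon\,\mathbb I$ or, alternatively, an arbitrary measurable matrix field with $\|\mathbb S\|_{L^2(Q_T)}\le C_S$; and that the energy estimate $$\|\varrho_\varepsilon^{3/2}(1+\varepsilon\varrho_\varepsilon^m)\|_{L^\infty(0,T;L^1(\Omega))}+\|\varrho_\varepsilon|\mathbf u_\varepsilon|^2\|_{L^\infty(0,T;L^1(\Omega))}+\|\mathbf u_\varepsilon\|_{L^2(0,T;W^{1,2}(\Omega))}\le E$$ holds. Let $\lambda\in C_0^\infty(\mathbb R^4)$ be a nonnegative cut-off function with $\operatorname{supp}\lambda\subset Q_T$, and let $\rho=\lambda^4\varrho_\varepsilon$,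 extended by zero to $\mathbb R^4$. **Proposition.** For every $\mu\in(0,4/3)$ there is a constant $c>0$, depending only on $\mu,\Omega,T,\nu_1,\nu_2,E,C_f,C_S$ and $\lambda$ (in particular independent of $\varepsilon$, $m$, $\mathbf f$, $\mathbb S$ and of the solution), such that $$\int_{\mathbb R^4}\rho^{3/2}(x,t)\Big\{\int_{\mathbb R^3}\frac{\big|\log|x-y|\big|^{\mu}+1}{|x-y|}\,\rho(y,t)\,dy\Big\}\,dx\,dt\le c .$$ -/

import Mathlib

open MeasureTheory Set
open scoped ENNReal ContDiff

namespace CompressibleNS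

noncomputable section

/-- Physical space `ℝ³` with its Euclidean norm. -/
abbrev R3 := EuclideanSpace ℝ (Fin 3)

/-- Space-time `ℝ⁴ = ℝ³ × ℝ`; a point is written `z = (x, t)`. -/
abbrev R4 := R3 × ℝ

/-- The cylinder `Q_T = Ω × (0, T)`. -/
def cylinder (Ω : Set R3) (T : ℝ) : Set R4 := Ω ×ˢ Ioo 0 T

/-- `φ ∈ C₀^∞(U)`: a smooth function with compact support contained in `U`. -/
def IsTestFunction {V F : Type*} [NormedAddCommGroup V] [NormedSpace ℝ V]
    [NormedAddCommGroup F] [NormedSpace ℝ F] (U : Set V) (φ : V → F) : Prop :=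
  ContDiff ℝ ∞ φ ∧ HasCompactSupport φ ∧ tsupport φ ⊆ U

/-- The time derivative `∂ₜ φ`. -/
def dt {F : Type*} [NormedAddCommGroup F] [NormedSpace ℝ F] (φ : R4 → F) (z : R4) : F :=
  fderiv ℝ φ z (0, 1)

/-- The spatial derivative `∂ⱼ φ = ∂φ/∂xⱼ`. -/
def dx {F : Type*} [NormedAddCommGroup F] [NormedSpace ℝ F] (j : Fin 3) (φ : R4 → F) (z : R4) : F :=
  fderiv ℝ φ z (EuclideanSpace.single j 1, 0)

/-- The spatial gradient of a vector field, `(∇ξ)ᵢⱼ = ∂ⱼ ξᵢ`. -/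
def grad (ξ : R4 → R3) (z : R4) : Matrix (Fin 3) (Fin 3) ℝ :=
  Matrix.of fun i j => dx j ξ z i

/-- The contraction `A : B = ∑ᵢⱼ Aᵢⱼ Bᵢⱼ`. -/
def contract (A B : Matrix (Fin 3) (Fin 3) ℝ) : ℝ := ∑ i, ∑ j, A i j * B i j

/-- The tensor product `a ⊗ b`, with entries `aᵢ bⱼ`. -/
def tensor (a b : R3) : Matrix (Fin 3) (Fin 3) ℝ := Matrix.of fun i j => a i * b j

/-- The artificial pressure `p(s) = s^{3/2} (1 + ε s^m)`. -/
def pressure (ε m s : ℝ) : ℝ := s ^ (3 / 2 : ℝ) * (1 + ε * s ^ m)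

/-- The viscous stress tensor `ν₁ (G + Gᵀ) + ν₂ (tr G) I` of a velocity gradient `G = ∇u`. -/
def newtonianStress (ν₁ ν₂ : ℝ) (G : Matrix (Fin 3) (Fin 3) ℝ) : Matrix (Fin 3) (Fin 3) ℝ :=
  ν₁ • (G + G.transpose) + (ν₂ * G.trace) • (1 : Matrix (Fin 3) (Fin 3) ℝ)

/-- `G` is the weak (distributional) gradient of `w` in `Ω`: `Gᵢⱼ = ∂ⱼ wᵢ`. -/
def IsWeakGradient (Ω : Set R3) (w : R3 → R3) (G : R3 → Matrix (Fin 3) (Fin 3) ℝ) : Prop :=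
  LocallyIntegrableOn w Ω ∧ (∀ i j, LocallyIntegrableOn (fun x => G x i j) Ω) ∧
  ∀ (i j : Fin 3) (φ : R3 → ℝ), IsTestFunction Ω φ →
    ∫ x in Ω, w x i * fderiv ℝ φ x (EuclideanSpace.single j 1) = -∫ x in Ω, G x i j * φ x

/-- The norm of `g` in `L^∞(0, T; L¹(Ω))`. -/
def normLinftyL1 (Ω : Set R3) (T : ℝ) (g : R4 → ℝ) : ℝ≥0∞ :=
  essSup (fun t => ∫⁻ x in Ω, ENNReal.ofReal |g (x, t)|) (volume.restrict (Ioo 0 T))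

/-- The norm of `u` in `L²(0, T; W^{1,2}(Ω))`, where `G` is the weak spatial gradient of `u`. -/
def normL2W12 (Ω : Set R3) (T : ℝ) (u : R4 → R3) (G : R4 → Matrix (Fin 3) (Fin 3) ℝ) : ℝ≥0∞ :=
  (∫⁻ t in Ioo 0 T, ∫⁻ x in Ω,
    ENNReal.ofReal (‖u (x, t)‖ ^ 2 + contract (G (x, t)) (G (x, t)))) ^ (1 / 2 : ℝ)

/-- The norm of a matrix field in `L²(Q_T)`. -/
def normL2 (Ω : Set R3) (T : ℝ) (S : R4 → Matrix (Fin 3) (Fin 3) ℝ) : ℝ≥0∞ :=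
  (∫⁻ z in cylinder Ω T, ENNReal.ofReal (contract (S z) (S z))) ^ (1 / 2 : ℝ)

/-- The energy
`‖ϱ^{3/2}(1 + ε ϱ^m)‖_{L^∞(0,T;L¹)} + ‖ϱ|u|²‖_{L^∞(0,T;L¹)} + ‖u‖_{L²(0,T;W^{1,2})}`. -/
def energy (Ω : Set R3) (T ε m : ℝ) (ϱ : R4 → ℝ) (u : R4 → R3)
    (G : R4 → Matrix (Fin 3) (Fin 3) ℝ) : ℝ≥0∞ :=
  normLinftyL1 Ω T (fun z => pressure ε m (ϱ z))
    + normLinftyL1 Ω T (fun z => ϱ z * ‖u z‖ ^ 2)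
    + normL2W12 Ω T u G

/-- `ϱ ≥ 0` and `u`, with weak spatial gradient `∇u = G`, solve in `Q_T`, in the weak sense,
`∂ₜ(ϱu) + div(ϱ u ⊗ u) + ∇p(ϱ) = div S + ϱf` and `∂ₜϱ + div(ϱu) = 0`,
with `p(ϱ) = ϱ^{3/2}(1 + ε ϱ^m)`. No initial or boundary condition is imposed.
(When the energy is finite, `f` is bounded and `S` is square integrable, every integrand
below is integrable.) -/
structure IsWeakSolution (Ω : Set R3) (T ε m : ℝ) (f : R4 → R3)
    (S : R4 → Matrix (Fin 3) (Fin 3) ℝ) (ϱ : R4 → ℝ) (u : R4 → R3)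
    (G : R4 → Matrix (Fin 3) (Fin 3) ℝ) : Prop where
  meas_f : AEStronglyMeasurable f (volume.restrict (cylinder Ω T))
  meas_S : ∀ i j, AEStronglyMeasurable (fun z => S z i j) (volume.restrict (cylinder Ω T))
  meas_density : AEStronglyMeasurable ϱ (volume.restrict (cylinder Ω T))
  meas_velocity : AEStronglyMeasurable u (volume.restrict (cylinder Ω T))
  meas_grad : ∀ i j, AEStronglyMeasurable (fun z => G z i j) (volume.restrict (cylinder Ω T))
  density_nonneg : ∀ᵐ z ∂(volume.restrict (cylinder Ω T)), 0 ≤ ϱ z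
  weak_grad : ∀ᵐ t ∂(volume.restrict (Ioo 0 T)),
    IsWeakGradient Ω (fun x => u (x, t)) (fun x => G (x, t))
  momentum : ∀ ξ : R4 → R3, IsTestFunction (cylinder Ω T) ξ →
    (∫ z in cylinder Ω T, ϱ z * inner ℝ (u z) (dt ξ z))
      + (∫ z in cylinder Ω T,
          contract (ϱ z • tensor (u z) (u z)
            + pressure ε m (ϱ z) • (1 : Matrix (Fin 3) (Fin 3) ℝ) - S z) (grad ξ z))
      + (∫ z in cylinder Ω T, ϱ z * inner ℝ (f z) (ξ z)) = 0
  mass : ∀ ψ : R4 → ℝ, IsTestFunction (cylinder Ω T) ψ →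
    ∫ z in cylinder Ω T, (ϱ z * dt ψ z + ∑ j, ϱ z * u z j * dx j ψ z) = 0

/-- The localized density `ρ = λ⁴ ϱ`. For a cut-off `λ` supported in `Q_T` it vanishes outside
`Q_T`, whatever the values of `ϱ` there, so this is the extension of `λ⁴ ϱ` by zero. -/
def localized (cutoff : R4 → ℝ) (ϱ : R4 → ℝ) (z : R4) : ℝ := cutoff z ^ 4 * ϱ z

/-- The integral
`∫_{ℝ⁴} ρ(x,t)^{3/2} ( ∫_{ℝ³} (|log|x-y||^μ + 1) / |x-y| · ρ(y,t) dy ) dx dt`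
of a density `ρ ≥ 0`, as a number in `[0, ∞]`. -/
def logPotentialIntegral (μ : ℝ) (ρ : R4 → ℝ) : ℝ≥0∞ :=
  ∫⁻ z : R4, ENNReal.ofReal (ρ z ^ (3 / 2 : ℝ)) *
    ∫⁻ y : R3, ENNReal.ofReal
      ((|Real.log ‖z.1 - y‖| ^ μ + 1) / ‖z.1 - y‖ * ρ (y, z.2))

end

end CompressibleNS

/-! Let `θ = λ⁴` and `g = θϱ`. The momentum equation is tested with `θ W`, where `W` is the
convolution of `g` with the odd field `h(x) = kb(|x|² + δ²) x`. This `h` is a regularised `x/|x|`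
multiplied by the logarithmic factor `ell^{4/3}`, and `kb(|x|²)` grows like `|log|x||^{4/3}/|x|` at
the origin. The pressure produces `∫ θ p (g * div h)`. Since `div h ≥ kb` and `p ≥ ϱ^{3/2}`, this
dominates the potential to be estimated. Nothing else about the pressure is used beyond its energy
bound, so `ε` and `m` leave no trace in the constants.

The time derivative falls on `W`, and the continuity equation of `g` turns it into spatial
derivatives of `h`. Symmetrising in the two space-time points, the convective terms combine into `½
g(z) g(w) ∇h(x-y)[u(z)-u(w), u(z)-u(w)]` (`WeakData.integral_mainTerm`). For `x/|x|` this quadratic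
form is nonnegative. The logarithm spoils this only by `-(8/3) kc`, where `kb = ell · kc`, so one
whole logarithm is gained (`hJac_quadratic`). The result is `∫ θ p (g * kb) ≤ remainder + (16/3) ∫
θϱ|u|² (g * kc)` (`lintegral_pressure_mul_pot_le`).

The last term is absorbed. Put `v = g * kb`. Where `ell ≥ L` one has `kc ≤ kb / L`. Where `ell ≤ L`,
the integral of `kc³` is `O(L²)`, and Hölder against `g ∈ L^{3/2}` costs `L^{2/3}`. Optimising in
`L` gives `g * kc ≲ 1 + v^{2/5}` (`pot_kc_le`). Then `θϱ|u|² v^{2/5}` is a geometric mean, with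
weights `2/5`, `1/5`, `2/5`, of `D ϱ|u|²`, of `(θ|u|²)³ D⁻²` and of `θϱ^{3/2} v`. Here `D(t)` is one
plus a multiple of the squared `W^{1,2}` norm of `u(t)`; it is integrable in time, and by Sobolev `∫
(θ|u|²)³ dx ≤ D³`. The first two factors are therefore integrable and the third goes to the left
with a small coefficient (`lintegral_kinetic_mul_pot_kc_le`). The balance of the powers of `D` fixes
the weight `2/5`, and the power `4/3` of the logarithm is the one that produces exactly `v^{2/5}`;
the argument includes the endpoint `μ = 4/3`.

The remainder is controlled because `W` is bounded: `h` has only logarithmic growth at the origin.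
The stress term uses `kb² ∈ L¹_loc(ℝ³)` (`lintegral_errTerm_le`). A mollification in time makes the
test field smooth; it is removed by Lebesgue differentiation and Fatou, and then `δ → 0` by Fatou
again, all bounds being uniform. -/

open MeasureTheory Set
open scoped ENNReal ContDiff

namespace CompressibleNS

noncomputable section

/-! ### Radial profiles with logarithmic weights -/

/-- The logarithmic weight `3 + log (1 + 1/s)`. -/
def ell (s : ℝ) : ℝ := 3 + Real.log (1 + 1 / s)

/-- The radial profile `s^{-1/2} ell(s)^{4/3}` with `s = |x|² + δ²`. -/
def kb (s : ℝ) : ℝ := s ^ (-(1 / 2) : ℝ) * ell s ^ (4 / 3 : ℝ)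

/-- The radial profile `s^{-1/2} ell(s)^{1/3}`, one logarithm weaker than `kb`. -/
def kc (s : ℝ) : ℝ := s ^ (-(1 / 2) : ℝ) * ell s ^ (1 / 3 : ℝ)

/-- The derivative of `kb`. -/
def kbDeriv (s : ℝ) : ℝ :=
  -(1 / 2) * (kb s / s) - (4 / 3) * (kc s / (s * (1 + s)))

theorem three_le_ell {s : ℝ} (hs : 0 < s) : 3 ≤ ell s := by
  have : 0 ≤ Real.log (1 + 1 / s) := Real.log_nonneg (by have := one_div_pos.2 hs; linarith)
  unfold ell; linarith

theorem ell_pos {s : ℝ} (hs : 0 < s) : 0 < ell s := by linarith [three_le_ell hs]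

theorem ell_anti {s t : ℝ} (hs : 0 < s) (hst : s ≤ t) : ell t ≤ ell s := by
  unfold ell
  have h1 : 1 / t ≤ 1 / s := one_div_le_one_div_of_le hs hst
  have h2 : 0 < 1 / t := one_div_pos.2 (hs.trans_le hst)
  have := Real.log_le_log (by linarith : 0 < 1 + 1 / t) (by linarith : 1 + 1 / t ≤ 1 + 1 / s)
  linarith

theorem kb_pos {s : ℝ} (hs : 0 < s) : 0 < kb s :=
  mul_pos (Real.rpow_pos_of_pos hs _) (Real.rpow_pos_of_pos (ell_pos hs) _)

theorem kc_pos {s : ℝ} (hs : 0 < s) : 0 < kc s :=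
  mul_pos (Real.rpow_pos_of_pos hs _) (Real.rpow_pos_of_pos (ell_pos hs) _)

theorem kb_eq_ell_mul_kc {s : ℝ} (hs : 0 < s) : kb s = ell s * kc s := by
  have h := ell_pos hs
  have : ell s ^ (4 / 3 : ℝ) = ell s * ell s ^ (1 / 3 : ℝ) := by
    rw [← Real.rpow_one_add' h.le (by norm_num)]; norm_num
  unfold kb kc; rw [this]; ring

theorem kb_anti {s t : ℝ} (hs : 0 < s) (hst : s ≤ t) : kb t ≤ kb s := by
  unfold kb
  have ht := hs.trans_le hst
  apply mul_le_mul
  · exact Real.rpow_le_rpow_of_nonpos hs hst (by norm_num)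
  · exact Real.rpow_le_rpow (ell_pos ht).le (ell_anti hs hst) (by norm_num)
  · exact Real.rpow_nonneg (ell_pos ht).le _
  · exact Real.rpow_nonneg hs.le _

theorem hasDerivAt_ell {s : ℝ} (hs : 0 < s) : HasDerivAt ell (-(1 / (s * (1 + s)))) s := by
  have h1 : HasDerivAt (fun s : ℝ => 1 + 1 / s) (-(s ^ 2)⁻¹) s := by
    simpa [one_div] using (hasDerivAt_inv hs.ne').const_add 1
  have h3 : (1 + 1 / s) ≠ 0 := by have := one_div_pos.2 hs; positivity
  have h2 := (h1.log h3).const_add 3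
  refine h2.congr_deriv ?_
  field_simp
  ring

theorem hasDerivAt_kb {s : ℝ} (hs : 0 < s) : HasDerivAt kb (kbDeriv s) s := by
  have h1 : HasDerivAt (fun s : ℝ => s ^ (-(1 / 2) : ℝ)) _ s :=
    Real.hasDerivAt_rpow_const (Or.inl hs.ne')
  have h2 := (hasDerivAt_ell hs).rpow_const (p := 4 / 3) (Or.inl (ell_pos hs).ne')
  have h := h1.mul h2
  refine h.congr_deriv ?_
  have e1 : s ^ (-(1 / 2) - 1 : ℝ) = s ^ (-(1 / 2) : ℝ) / s := by
    rw [Real.rpow_sub_one hs.ne']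
  have e2 : ell s ^ (4 / 3 - 1 : ℝ) = ell s ^ (1 / 3 : ℝ) := by norm_num
  rw [e1, e2]; unfold kbDeriv kb kc
  ring

theorem contDiffOn_kb : ContDiffOn ℝ ∞ kb (Ioi 0) := by
  intro s hs
  have hs : 0 < s := hs
  apply ContDiffAt.contDiffWithinAt
  unfold kb ell
  have h3 : (1 + 1 / s) ≠ 0 := by have := one_div_pos.2 hs; positivity
  have h4 : 3 + Real.log (1 + 1 / s) ≠ 0 := (ell_pos hs).ne'
  have h5 : ContDiffAt ℝ ∞ (fun s : ℝ => 1 + 1 / s) s := by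
    simp only [one_div]
    exact contDiffAt_const.add (contDiffAt_inv ℝ hs.ne')
  exact (contDiffAt_id.rpow_const_of_ne hs.ne').mul
    ((contDiffAt_const.add (h5.log h3)).rpow_const_of_ne h4)

theorem kc_le_kb {s : ℝ} (hs : 0 < s) : kc s ≤ kb s / 3 := by
  rw [kb_eq_ell_mul_kc hs]
  have := mul_le_mul_of_nonneg_right (three_le_ell hs) (kc_pos hs).le
  linarith

theorem kc_le_kb_div {s L : ℝ} (hs : 0 < s) (hL : 0 < L) (h : L ≤ ell s) : kc s ≤ kb s / L := by
  rw [le_div_iff₀ hL, kb_eq_ell_mul_kc hs, mul_comm]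
  exact mul_le_mul_of_nonneg_right h (kc_pos hs).le

theorem kc_cube {s : ℝ} (hs : 0 < s) : kc s ^ 3 = s ^ (-(3 / 2) : ℝ) * ell s := by
  unfold kc
  rw [mul_pow, ← Real.rpow_natCast, ← Real.rpow_natCast, ← Real.rpow_mul hs.le,
    ← Real.rpow_mul (ell_pos hs).le]
  norm_num

theorem kbDeriv_nonpos {s : ℝ} (hs : 0 < s) : kbDeriv s ≤ 0 := by
  unfold kbDeriv
  have h1 := div_pos (kb_pos hs) hs
  have h2 := div_pos (kc_pos hs) (by positivity : 0 < s * (1 + s))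
  linarith

/-- Differentiating `s^{-1/2}` gives exactly `-kb` after multiplication by `2s`; differentiating the
logarithmic factor gives only a multiple of `kc`. Used with `q = |x|²` and `s = |x|² + δ²`, so the
regularisation costs nothing. -/
theorem neg_le_mul_kbDeriv {s q : ℝ} (hs : 0 < s) (hqs : q ≤ s) :
    -(kb s) - (8 / 3) * kc s ≤ 2 * q * kbDeriv s := by
  have h1 : s * kbDeriv s ≤ q * kbDeriv s := mul_le_mul_of_nonpos_right hqs (kbDeriv_nonpos hs)
  have h2 : s * kbDeriv s = -(1 / 2) * kb s - (4 / 3) * (kc s / (1 + s)) := by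
    unfold kbDeriv; field_simp
  have h3 : kc s / (1 + s) ≤ kc s := div_le_self (kc_pos hs).le (by linarith)
  nlinarith

/-- A logarithm is below any small power. This trades logarithms for powers wherever the singularity
is strictly integrable. -/
theorem ell_le_rpow {s ε : ℝ} (hs : 0 < s) (hε : 0 < ε) :
    ell s ≤ (3 + 1 / ε) * ((1 + s) / s) ^ ε := by
  have e : 1 + 1 / s = (1 + s) / s := by field_simp; ring
  have h1 : 1 ≤ (1 + s) / s := by rw [le_div_iff₀ hs]; linarith
  have h2 := Real.log_le_rpow_div (by linarith : 0 ≤ (1 + s) / s) hε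
  have h3 := Real.one_le_rpow h1 hε.le
  unfold ell; rw [e]
  have : (3 + 1 / ε) * ((1 + s) / s) ^ ε = 3 * ((1 + s) / s) ^ ε + ((1 + s) / s) ^ ε / ε := by
    ring
  linarith

theorem ell_sq_le_rpow {r R ε : ℝ} (hr : 0 < r) (hrR : r ≤ R) (hε : 0 < ε) :
    ell (r ^ 2) ≤ (3 + 1 / ε) * (1 + R ^ 2) ^ ε * r ^ (-(2 * ε)) := by
  refine (ell_le_rpow (by positivity) hε).trans ?_
  rw [mul_assoc, div_eq_mul_inv (1 + r ^ 2), Real.mul_rpow (by positivity) (by positivity)]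
  have e : ((r ^ 2)⁻¹ : ℝ) ^ ε = r ^ (-(2 * ε)) := by
    rw [Real.inv_rpow (by positivity), ← Real.rpow_natCast, ← Real.rpow_mul hr.le,
      ← Real.rpow_neg hr.le]; norm_num
  rw [e]
  gcongr

/-! ### Integrals of powers over balls -/

/-- The constant `3 |B₁|` of integration in polar coordinates. -/
def polarConst : ℝ := 3 * (volume : Measure R3).real (Metric.ball 0 1)

theorem polarConst_nonneg : 0 ≤ polarConst := by unfold polarConst; positivity

theorem lintegral_ball_rpow {a R : ℝ} (ha : 0 < a) (hR : 0 < R) :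
    ∫⁻ x in Metric.ball (0 : R3) R, ENNReal.ofReal (‖x‖ ^ (a - 3))
      = ENNReal.ofReal (polarConst * (R ^ a / a)) := by
  have hint : IntegrableOn (fun y : ℝ => y ^ (a - 1)) (Ioo 0 R) := by
    rw [← intervalIntegrable_iff_integrableOn_Ioo_of_le hR.le]
    exact intervalIntegral.intervalIntegrable_rpow' (by linarith)
  have e : ∀ y ∈ Ioo (0 : ℝ) R, y ^ (Module.finrank ℝ R3 - 1) • y ^ (a - 3) = y ^ (a - 1) := by
    intro y hy
    simp only [finrank_euclideanSpace, Fintype.card_fin, smul_eq_mul]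
    rw [← Real.rpow_natCast, ← Real.rpow_add hy.1]; congr 1; norm_num; ring
  have hI : IntegrableOn (fun x : R3 => ‖x‖ ^ (a - 3)) (Metric.ball 0 R) := by
    rw [integrableOn_fun_norm_addHaar volume (f := fun y : ℝ => y ^ (a - 3))]
    exact (integrableOn_congr_fun e measurableSet_Ioo).2 hint
  rw [← ofReal_integral_eq_lintegral_ofReal hI (ae_of_all _ fun x => by positivity)]
  congr 1
  have h1 : ∫ x in Metric.ball (0 : R3) R, ‖x‖ ^ (a - 3)
      = ∫ x : R3, (Iio R).indicator (fun y : ℝ => y ^ (a - 3)) ‖x‖ := by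
    rw [← integral_indicator measurableSet_ball]
    congr 1; ext x; simp [indicator]
  rw [h1, integral_fun_norm_addHaar volume ((Iio R).indicator (fun y : ℝ => y ^ (a - 3)))]
  have h2 : ∫ y in Ioi (0 : ℝ), y ^ (Module.finrank ℝ R3 - 1) •
      (Iio R).indicator (fun y : ℝ => y ^ (a - 3)) y = ∫ y in Ioo 0 R, y ^ (a - 1) := by
    have : ∀ y : ℝ, y ^ (Module.finrank ℝ R3 - 1) •
      (Iio R).indicator (fun y : ℝ => y ^ (a - 3)) y =
      (Iio R).indicator (fun y : ℝ => y ^ (Module.finrank ℝ R3 - 1) • y ^ (a - 3)) y := by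
      intro y; by_cases h : y ∈ Iio R <;> simp [h]
    simp_rw [this]
    rw [setIntegral_indicator measurableSet_Iio]
    exact setIntegral_congr_fun measurableSet_Ioo e
  rw [h2, ← integral_Ioc_eq_integral_Ioo, ← intervalIntegral.integral_of_le hR.le,
    integral_rpow (Or.inl (by linarith))]
  simp [polarConst, Real.zero_rpow ha.ne']
  ring

/-! ### The vector kernel, its Jacobian and size bounds -/

/-- The regularised kernel `h(x) = kb(|x|² + δ²) x`. -/
def hker (δ : ℝ) (x : R3) : R3 := kb (‖x‖ ^ 2 + δ ^ 2) • x

/-- The Jacobian `∂ⱼ hᵢ` of `hker`. -/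
def hJac (δ : ℝ) (x : R3) (i j : Fin 3) : ℝ :=
  (if i = j then kb (‖x‖ ^ 2 + δ ^ 2) else 0) + 2 * kbDeriv (‖x‖ ^ 2 + δ ^ 2) * x i * x j

theorem sq_add_sq_pos {δ : ℝ} (hδ : 0 < δ) (x : R3) : 0 < ‖x‖ ^ 2 + δ ^ 2 := by positivity

theorem contDiff_hker {δ : ℝ} (hδ : 0 < δ) : ContDiff ℝ ∞ (hker δ) := by
  unfold hker
  have h : ContDiff ℝ ∞ (fun x : R3 => ‖x‖ ^ 2 + δ ^ 2) := (contDiff_norm_sq ℝ).add contDiff_const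
  exact (contDiffOn_kb.comp_contDiff h fun x => sq_add_sq_pos hδ x).smul contDiff_id

theorem fderiv_hker {δ : ℝ} (hδ : 0 < δ) (x : R3) (i j : Fin 3) :
    fderiv ℝ (hker δ) x (EuclideanSpace.single j 1) i = hJac δ x i j := by
  have h1 : HasFDerivAt (fun x : R3 => ‖x‖ ^ 2 + δ ^ 2) (2 • innerSL ℝ x) x :=
    (hasStrictFDerivAt_norm_sq x).hasFDerivAt.add_const _
  have h2 := (hasDerivAt_kb (sq_add_sq_pos hδ x)).comp_hasFDerivAt x h1
  have h3 := h2.smul (hasFDerivAt_id x)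
  have h4 : fderiv ℝ (hker δ) x = _ := h3.fderiv
  rw [h4]
  simp [hJac, EuclideanSpace.inner_single_right]
  ring

/-- The divergence is `3 kb + 2|x|² kb' ≥ 2 kb - (8/3) kc`. The additive `3` in `ell` gives `kc ≤
kb/3`, hence a loss of at most `8/9` of one `kb`. -/
theorem sum_hJac_diag {δ : ℝ} (hδ : 0 < δ) (x : R3) :
    kb (‖x‖ ^ 2 + δ ^ 2) ≤ ∑ i, hJac δ x i i := by
  have hs := sq_add_sq_pos hδ x
  have h1 := neg_le_mul_kbDeriv hs (q := ‖x‖ ^ 2) (by nlinarith)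
  have h2 := kc_le_kb hs
  have h3 := kb_pos hs
  have e : ‖x‖ ^ 2 = x 0 ^ 2 + x 1 ^ 2 + x 2 ^ 2 := by
    rw [EuclideanSpace.real_norm_sq_eq, Fin.sum_univ_three]
  simp only [hJac, Fin.sum_univ_three, if_true]
  have : 2 * ‖x‖ ^ 2 * kbDeriv (‖x‖ ^ 2 + δ ^ 2) = 2 * kbDeriv (‖x‖ ^ 2 + δ ^ 2) * x 0 * x 0
      + 2 * kbDeriv (‖x‖ ^ 2 + δ ^ 2) * x 1 * x 1
      + 2 * kbDeriv (‖x‖ ^ 2 + δ ^ 2) * x 2 * x 2 := by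
    generalize kbDeriv (‖x‖ ^ 2 + δ ^ 2) = k
    rw [e]; ring
  linarith

/-- The Jacobian is `kb I + 2 kb' x ⊗ x` with `kb' ≤ 0`. By Cauchy–Schwarz the worst direction is
radial, where the two `kb` contributions cancel and only the derivative of the logarithm survives.
-/
theorem hJac_quadratic {δ : ℝ} (hδ : 0 < δ) (x v : R3) :
    -(8 / 3) * kc (‖x‖ ^ 2 + δ ^ 2) * ‖v‖ ^ 2 ≤ ∑ i, ∑ j, hJac δ x i j * (v i * v j) := by
  have hs := sq_add_sq_pos hδ x
  have h1 := neg_le_mul_kbDeriv hs (q := ‖x‖ ^ 2) (by nlinarith)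
  have e : ‖v‖ ^ 2 = v 0 ^ 2 + v 1 ^ 2 + v 2 ^ 2 := by
    rw [EuclideanSpace.real_norm_sq_eq, Fin.sum_univ_three]
  have e2 : inner ℝ x v = x 0 * v 0 + x 1 * v 1 + x 2 * v 2 := by
    simp [PiLp.inner_apply, Fin.sum_univ_three]; ring
  have hcs : (inner ℝ x v) ^ 2 ≤ ‖x‖ ^ 2 * ‖v‖ ^ 2 := by
    rw [← mul_pow, sq_le_sq, abs_of_nonneg (by positivity : 0 ≤ ‖x‖ * ‖v‖)]
    exact abs_real_inner_le_norm x v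
  have hd := kbDeriv_nonpos hs
  have h3 : ∑ i, ∑ j, hJac δ x i j * (v i * v j)
      = kb (‖x‖ ^ 2 + δ ^ 2) * ‖v‖ ^ 2 + 2 * kbDeriv (‖x‖ ^ 2 + δ ^ 2) * (inner ℝ x v) ^ 2 := by
    unfold hJac
    generalize kbDeriv (‖x‖ ^ 2 + δ ^ 2) = k
    generalize kb (‖x‖ ^ 2 + δ ^ 2) = b
    rw [e, e2]
    simp [Fin.sum_univ_three]; ring
  rw [h3]
  have h4 := mul_le_mul_of_nonpos_left hcs hd
  nlinarith [mul_le_mul_of_nonneg_right h1 (sq_nonneg ‖v‖)]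

theorem abs_hJac_le {δ : ℝ} (hδ : 0 < δ) (x : R3) (i j : Fin 3) :
    |hJac δ x i j| ≤ 3 * kb (‖x‖ ^ 2 + δ ^ 2) := by
  have hs := sq_add_sq_pos hδ x
  have h1 := neg_le_mul_kbDeriv hs (q := ‖x‖ ^ 2) (by nlinarith)
  have h2 := kc_le_kb hs
  have hd := kbDeriv_nonpos hs
  have hb := kb_pos hs
  have h3 : |x i * x j| ≤ ‖x‖ ^ 2 := by
    rw [abs_mul, sq]
    exact mul_le_mul (PiLp.norm_apply_le x i) (PiLp.norm_apply_le x j) (abs_nonneg _)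
      (norm_nonneg _)
  have h4 : |2 * kbDeriv (‖x‖ ^ 2 + δ ^ 2) * x i * x j| ≤ 2 * kb (‖x‖ ^ 2 + δ ^ 2) := by
    rw [show 2 * kbDeriv (‖x‖ ^ 2 + δ ^ 2) * x i * x j
      = kbDeriv (‖x‖ ^ 2 + δ ^ 2) * (2 * (x i * x j)) by ring, abs_mul, abs_of_nonpos hd, abs_mul,
      abs_two]
    nlinarith
  have h5 : |if i = j then kb (‖x‖ ^ 2 + δ ^ 2) else 0| ≤ kb (‖x‖ ^ 2 + δ ^ 2) := by
    split_ifs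
    · rw [abs_of_pos hb]
    · simpa using hb.le
  refine (abs_add_le _ _).trans ?_
  linarith

/-- The factor `x` cancels the `|x|⁻¹` singularity and leaves a pure logarithm, uniformly in `δ`. -/
theorem norm_hker_le {δ : ℝ} (hδ : 0 < δ) {x : R3} (hx : x ≠ 0) :
    ‖hker δ x‖ ≤ ell (‖x‖ ^ 2) ^ (4 / 3 : ℝ) := by
  have hs := sq_add_sq_pos hδ x
  have hx0 : 0 < ‖x‖ := norm_pos_iff.2 hx
  have hq : 0 < ‖x‖ ^ 2 := by positivity
  unfold hker
  rw [norm_smul, Real.norm_of_nonneg (kb_pos hs).le]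
  unfold kb
  have h1 : (‖x‖ ^ 2 + δ ^ 2) ^ (-(1 / 2) : ℝ) * ‖x‖ ≤ 1 := by
    have : (‖x‖ ^ 2 + δ ^ 2) ^ (-(1 / 2) : ℝ) ≤ (‖x‖ ^ 2) ^ (-(1 / 2) : ℝ) :=
      Real.rpow_le_rpow_of_nonpos hq (by nlinarith) (by norm_num)
    refine (mul_le_mul_of_nonneg_right this hx0.le).trans ?_
    rw [← Real.rpow_natCast, ← Real.rpow_mul hx0.le]
    norm_num [Real.rpow_neg_one, hx0.ne']
  have h2 : ell (‖x‖ ^ 2 + δ ^ 2) ^ (4 / 3 : ℝ) ≤ ell (‖x‖ ^ 2) ^ (4 / 3 : ℝ) :=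
    Real.rpow_le_rpow (ell_pos hs).le (ell_anti hq (by nlinarith)) (by norm_num)
  calc _ = ((‖x‖ ^ 2 + δ ^ 2) ^ (-(1 / 2) : ℝ) * ‖x‖) * ell (‖x‖ ^ 2 + δ ^ 2) ^ (4 / 3 : ℝ) := by
        ring
    _ ≤ 1 * ell (‖x‖ ^ 2 + δ ^ 2) ^ (4 / 3 : ℝ) :=
        mul_le_mul_of_nonneg_right h1 (Real.rpow_nonneg (ell_pos hs).le _)
    _ ≤ _ := by rw [one_mul]; exact h2

theorem norm_hker_pow_six_le {δ R : ℝ} (hδ : 0 < δ) {x : R3} (hx : x ≠ 0) (hxR : ‖x‖ ≤ R) :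
    ‖hker δ x‖ ^ 6 ≤ 19 ^ 8 * (1 + R ^ 2) * ‖x‖ ^ ((2 : ℝ) - 3) := by
  have hx0 : 0 < ‖x‖ := norm_pos_iff.2 hx
  have hq : 0 < ‖x‖ ^ 2 := by positivity
  have h1 : ‖hker δ x‖ ^ 6 ≤ ell (‖x‖ ^ 2) ^ 8 := by
    refine (pow_le_pow_left₀ (norm_nonneg _) (norm_hker_le hδ hx) 6).trans (le_of_eq ?_)
    rw [← Real.rpow_natCast, ← Real.rpow_mul (ell_pos hq).le, ← Real.rpow_natCast]; norm_num
  -- The exponent `1/16` makes the eighth power of the logarithm cost exactly `‖x‖⁻¹`; the base is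
  -- `3 + 16 = 19`.
  have h2 := pow_le_pow_left₀ (ell_pos hq).le
    (ell_sq_le_rpow hx0 hxR (by norm_num : (0 : ℝ) < 1 / 16)) 8
  refine h1.trans (h2.trans ?_)
  rw [mul_pow, mul_pow, ← Real.rpow_natCast, ← Real.rpow_natCast ((1 + R ^ 2) ^ (1 / 16 : ℝ)),
    ← Real.rpow_natCast (‖x‖ ^ _),
    ← Real.rpow_mul (by positivity), ← Real.rpow_mul hx0.le]
  have h3 : (1 + R ^ 2) ^ ((1 / 16 : ℝ) * (8 : ℕ)) ≤ 1 + R ^ 2 := by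
    conv_rhs => rw [← Real.rpow_one (1 + R ^ 2)]
    exact Real.rpow_le_rpow_of_exponent_le (by nlinarith [sq_nonneg R]) (by norm_num)
  have e : (-(2 * (1 / 16)) * ((8 : ℕ) : ℝ)) = 2 - 3 := by norm_num
  rw [e]
  have e' : ((3 : ℝ) + 1 / (1 / 16)) ^ ((8 : ℕ) : ℝ) = 19 ^ 8 := by
    rw [Real.rpow_natCast]; norm_num
  rw [e']
  gcongr

/-- Square integrability of the scalar kernel in dimension three, uniformly in `δ`: `|x|⁻²` with
logarithms is still below `|x|^{-5/2}`. This is what pairs with the `L²` stress. -/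
theorem kb_sq_le {δ R : ℝ} {x : R3} (hx : x ≠ 0) (hxR : ‖x‖ ≤ R) :
    kb (‖x‖ ^ 2 + δ ^ 2) ^ 2 ≤ 15 ^ 3 * (1 + R ^ 2) * ‖x‖ ^ ((1 / 2 : ℝ) - 3) := by
  have hx0 : 0 < ‖x‖ := norm_pos_iff.2 hx
  have hq : 0 < ‖x‖ ^ 2 := by positivity
  have h0 : kb (‖x‖ ^ 2 + δ ^ 2) ≤ kb (‖x‖ ^ 2) := kb_anti hq (by nlinarith)
  have h1 : kb (‖x‖ ^ 2 + δ ^ 2) ^ 2 ≤ kb (‖x‖ ^ 2) ^ 2 :=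
    pow_le_pow_left₀ (kb_pos (by positivity)).le h0 2
  have hl := ell_pos hq
  have h2 : kb (‖x‖ ^ 2) ^ 2 ≤ ‖x‖ ^ (-2 : ℝ) * ell (‖x‖ ^ 2) ^ 3 := by
    unfold kb
    rw [mul_pow]
    have e1 : ((‖x‖ ^ 2) ^ (-(1 / 2) : ℝ)) ^ 2 = ‖x‖ ^ (-2 : ℝ) := by
      rw [← Real.rpow_natCast, ← Real.rpow_natCast, ← Real.rpow_mul hx0.le,
        ← Real.rpow_mul hx0.le]; norm_num
    have e2 : (ell (‖x‖ ^ 2) ^ (4 / 3 : ℝ)) ^ 2 ≤ ell (‖x‖ ^ 2) ^ 3 := by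
      rw [← Real.rpow_natCast, ← Real.rpow_mul hl.le, ← Real.rpow_natCast (ell (‖x‖ ^ 2)) 3]
      exact Real.rpow_le_rpow_of_exponent_le (by linarith [three_le_ell hq]) (by norm_num)
    rw [e1]; gcongr
  -- The logarithmic exponent `8/3` has been rounded up to `3`; with `1/12` its cost is
  -- `‖x‖^{-1/2}`, and the base is `3 + 12 = 15`.
  have h3 := pow_le_pow_left₀ hl.le
    (ell_sq_le_rpow hx0 hxR (by norm_num : (0 : ℝ) < 1 / 12)) 3
  refine h1.trans (h2.trans ((mul_le_mul_of_nonneg_left h3 (by positivity)).trans ?_))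
  rw [mul_pow, mul_pow, ← Real.rpow_natCast, ← Real.rpow_natCast ((1 + R ^ 2) ^ (1 / 12 : ℝ)),
    ← Real.rpow_natCast (‖x‖ ^ _),
    ← Real.rpow_mul (by positivity), ← Real.rpow_mul hx0.le]
  have h4 : (1 + R ^ 2) ^ ((1 / 12 : ℝ) * (3 : ℕ)) ≤ 1 + R ^ 2 := by
    conv_rhs => rw [← Real.rpow_one (1 + R ^ 2)]
    exact Real.rpow_le_rpow_of_exponent_le (by nlinarith [sq_nonneg R]) (by norm_num)
  have e : ‖x‖ ^ ((1 / 2 : ℝ) - 3)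
      = ‖x‖ ^ (-2 : ℝ) * ‖x‖ ^ (-(2 * (1 / 12)) * ((3 : ℕ) : ℝ)) := by
    rw [← Real.rpow_add hx0]; norm_num
  have e' : ((3 : ℝ) + 1 / (1 / 12)) ^ ((3 : ℕ) : ℝ) = 15 ^ 3 := by
    rw [Real.rpow_natCast]; norm_num
  rw [e, e']
  calc _ = 15 ^ 3 * (1 + R ^ 2) ^ ((1 / 12 : ℝ) * (3 : ℕ)) *
        (‖x‖ ^ (-2 : ℝ) * ‖x‖ ^ (-(2 * (1 / 12)) * ((3 : ℕ) : ℝ))) := by ring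
    _ ≤ _ := by gcongr

/-- On `{ell ≤ L}` the borderline singularity `|x|⁻³` is replaced by `|x|^{1/L-3}` at the price of a
constant, as `s ≥ e^{-L}` there. The new power is integrable on a ball with integral `O(L)`, so the
cube of `kc` has mass `O(L²)` without truncating any domain. -/
theorem kc_cube_le {δ L : ℝ} {x : R3} (hx : x ≠ 0) (hL : 1 ≤ L)
    (h : ell (‖x‖ ^ 2 + δ ^ 2) ≤ L) :
    kc (‖x‖ ^ 2 + δ ^ 2) ^ 3 ≤ Real.exp (1 / 2) * L * ‖x‖ ^ (1 / L - 3) := by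
  have hx0 : 0 < ‖x‖ := norm_pos_iff.2 hx
  have hq : 0 < ‖x‖ ^ 2 := by positivity
  set s := ‖x‖ ^ 2 + δ ^ 2 with hs_def
  have hs : 0 < s := by positivity
  have hL0 : 0 < L := by linarith
  rw [kc_cube hs]
  have h1 : s⁻¹ ≤ Real.exp L := by
    have h2 : Real.log (1 + 1 / s) ≤ L := by unfold ell at h; linarith
    have := (Real.log_le_iff_le_exp (by positivity)).1 h2
    rw [one_div] at this; linarith
  have h2 : s ^ (-(1 / (2 * L))) ≤ Real.exp (1 / 2) := by
    rw [Real.rpow_neg hs.le, ← Real.inv_rpow hs.le]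
    refine (Real.rpow_le_rpow (by positivity) h1 (by positivity)).trans (le_of_eq ?_)
    rw [← Real.exp_mul]; congr 1; field_simp
  have h3 : s ^ ((1 / L - 3) / 2) ≤ ‖x‖ ^ (1 / L - 3) := by
    have h4 : 1 / L ≤ 1 := by rw [div_le_one hL0]; exact hL
    refine (Real.rpow_le_rpow_of_nonpos hq (by nlinarith : ‖x‖ ^ 2 ≤ s) (by linarith)).trans
      (le_of_eq ?_)
    rw [← Real.rpow_natCast, ← Real.rpow_mul hx0.le]; congr 1; push_cast; ring
  have e : s ^ (-(3 / 2) : ℝ) = s ^ (-(1 / (2 * L))) * s ^ ((1 / L - 3) / 2) := by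
    rw [← Real.rpow_add hs]; congr 1; field_simp; ring
  rw [e]
  calc _ ≤ Real.exp (1 / 2) * ‖x‖ ^ (1 / L - 3) * L := by
        apply mul_le_mul _ h (ell_pos hs).le (by positivity)
        exact mul_le_mul h2 h3 (by positivity) (by positivity)
    _ = _ := by ring

/-! ### Young inequalities and the pointwise splitting of the weak kernel -/

theorem young_three_halves {a b : ℝ} (ha : 0 ≤ a) (hb : 0 ≤ b) :
    a * b ≤ a ^ (3 / 2 : ℝ) + b ^ 3 := by
  have hpq : Real.HolderConjugate (3 / 2) 3 := by
    rw [Real.holderConjugate_iff]; norm_num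
  have h := Real.young_inequality_of_nonneg ha hb hpq
  have h1 : 0 ≤ a ^ (3 / 2 : ℝ) := by positivity
  have h2 : b ^ (3 : ℝ) = b ^ 3 := by exact_mod_cast Real.rpow_natCast b 3
  rw [h2] at h
  have h3 : 0 ≤ b ^ 3 := by positivity
  linarith

/-- Either the extra logarithm exceeds `L` and `kb` wins by that factor, or Young's inequality with
exponents `3/2` and `3` applies. Both are added, so no case distinction survives under the integral.
-/
theorem mul_kc_le {δ L g : ℝ} {x : R3} (hx : x ≠ 0) (hL : 1 ≤ L) (hg : 0 ≤ g) :
    g * kc (‖x‖ ^ 2 + δ ^ 2) ≤ L⁻¹ * (g * kb (‖x‖ ^ 2 + δ ^ 2)) + (L ^ (2 / 3 : ℝ) * g ^ (3 / 2 : ℝ)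
      + L ^ (-(1 / 3) : ℝ) * (Real.exp (1 / 2) * ‖x‖ ^ (1 / L - 3))) := by
  have hx0 : 0 < ‖x‖ := norm_pos_iff.2 hx
  set s := ‖x‖ ^ 2 + δ ^ 2 with hs_def
  have hs : 0 < s := by positivity
  have hL0 : 0 < L := by linarith
  have hc := kc_pos hs
  have hb := kb_pos hs
  rcases le_total L (ell s) with h | h
  · have := mul_le_mul_of_nonneg_left (kc_le_kb_div hs hL0 h) hg
    have e : g * (kb s / L) = L⁻¹ * (g * kb s) := by ring
    have : 0 ≤ L ^ (2 / 3 : ℝ) * g ^ (3 / 2 : ℝ)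
      + L ^ (-(1 / 3) : ℝ) * (Real.exp (1 / 2) * ‖x‖ ^ (1 / L - 3)) := by positivity
    linarith
  -- The scaling `L^{4/9}` balances the two terms: after integration both `L^{2/3} g^{3/2}` and
  -- `L^{-4/3} kc³` are of order `L^{2/3}`.
  · have h1 := young_three_halves (a := L ^ (4 / 9 : ℝ) * g) (b := L ^ (-(4 / 9) : ℝ) * kc s)
      (by positivity) (by positivity)
    have e1 : L ^ (4 / 9 : ℝ) * g * (L ^ (-(4 / 9) : ℝ) * kc s) = g * kc s := by
      rw [Real.rpow_neg hL0.le]; field_simp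
    have e2 : (L ^ (4 / 9 : ℝ) * g) ^ (3 / 2 : ℝ) = L ^ (2 / 3 : ℝ) * g ^ (3 / 2 : ℝ) := by
      rw [Real.mul_rpow (by positivity) hg, ← Real.rpow_mul hL0.le]; norm_num
    have e3 : (L ^ (-(4 / 9) : ℝ) * kc s) ^ 3 = L ^ (-(4 / 3) : ℝ) * kc s ^ 3 := by
      rw [mul_pow, ← Real.rpow_natCast, ← Real.rpow_mul hL0.le]; norm_num
    rw [e1, e2, e3] at h1
    have h2 := mul_le_mul_of_nonneg_left (kc_cube_le hx hL h)
      (by positivity : 0 ≤ L ^ (-(4 / 3) : ℝ))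
    have e4 : L ^ (-(4 / 3) : ℝ) * (Real.exp (1 / 2) * L * ‖x‖ ^ (1 / L - 3))
        = L ^ (-(1 / 3) : ℝ) * (Real.exp (1 / 2) * ‖x‖ ^ (1 / L - 3)) := by
      have : L ^ (-(1 / 3) : ℝ) = L ^ (-(4 / 3) : ℝ) * L := by
        rw [← Real.rpow_add_one hL0.ne']; norm_num
      rw [this]; ring
    have : 0 ≤ L⁻¹ * (g * kb s) := by positivity
    linarith

/-- Young's inequality for three factors with exponents `2/5`, `1/5` and `2/5`. -/
theorem young_two_fifths {a b c e : ℝ} (ha : 0 ≤ a) (hb : 0 ≤ b) (hc : 0 ≤ c) (he : 0 < e) :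
    a ^ (2 / 5 : ℝ) * b ^ (1 / 5 : ℝ) * c ^ (2 / 5 : ℝ) ≤ a / e + b + e * c := by
  have h := Real.geom_mean_le_arith_mean3_weighted (w₁ := 2 / 5) (w₂ := 1 / 5) (w₃ := 2 / 5)
    (p₁ := a / e) (p₂ := b) (p₃ := e * c) (by norm_num) (by norm_num) (by norm_num)
    (by positivity) hb (by positivity) (by norm_num)
  have e1 : (a / e) ^ (2 / 5 : ℝ) * b ^ (1 / 5 : ℝ) * (e * c) ^ (2 / 5 : ℝ)
      = a ^ (2 / 5 : ℝ) * b ^ (1 / 5 : ℝ) * c ^ (2 / 5 : ℝ) := by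
    rw [Real.div_rpow ha he.le, Real.mul_rpow he.le hc]
    have : e ^ (2 / 5 : ℝ) ≠ 0 := by positivity
    field_simp
  rw [e1] at h
  have h1 : 0 ≤ a / e := by positivity
  have h2 : 0 ≤ e * c := by positivity
  linarith

/-! ### Time mollifiers and space-time potentials -/

/-- A smooth, even, compactly supported, nonnegative mollifier in time of mass one. -/
structure IsMollifier (η : ℝ → ℝ) : Prop where
  contDiff : ContDiff ℝ ∞ η
  compact : HasCompactSupport η
  nonneg : ∀ t, 0 ≤ η t
  even : ∀ t, η (-t) = η t
  mass : ∫⁻ t, ENNReal.ofReal (η t) = 1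

theorem restrict_cylinder (Ω : Set R3) (T : ℝ) :
    (volume : Measure R4).restrict (cylinder Ω T)
      = (volume.restrict Ω).prod (volume.restrict (Ioo 0 T)) := by
  rw [Measure.prod_restrict]; rfl

theorem IsMollifier.lintegral_sub {η : ℝ → ℝ} (hη : IsMollifier η) (t : ℝ) :
    ∫⁻ s, ENNReal.ofReal (η (t - s)) = 1 := by
  rw [lintegral_sub_left_eq_self (fun s => ENNReal.ofReal (η s)) t, hη.mass]

/-- Since `η` has mass one, an `L^∞` in time, `L¹` in space bound survives averaging with the same
constant; this is why no estimate below depends on the mollifier. -/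
theorem lintegral_cylinder_mul_le {Ω : Set R3} {T : ℝ} {F : R4 → ℝ≥0∞} (hF : Measurable F)
    {η : ℝ → ℝ} (hη : IsMollifier η) {C : ℝ≥0∞} (t : ℝ)
    (h : ∀ᵐ s ∂(volume.restrict (Ioo 0 T)), ∫⁻ y in Ω, F (y, s) ≤ C) :
    ∫⁻ w in cylinder Ω T, F w * ENNReal.ofReal (η (t - w.2)) ≤ C := by
  have hm : Measurable fun s : ℝ => ENNReal.ofReal (η (t - s)) :=
    (hη.contDiff.continuous.comp (continuous_const.sub continuous_id)).measurable.ennreal_ofReal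
  rw [restrict_cylinder, lintegral_prod_symm _ (show Measurable fun w : R4 => F w * ENNReal.ofReal (η (t - w.2)) from
    hF.mul (hm.comp measurable_snd)).aemeasurable]
  calc _ ≤ ∫⁻ s in Ioo 0 T, C * ENNReal.ofReal (η (t - s)) := by
        apply lintegral_mono_ae
        filter_upwards [h] with s hs
        rw [lintegral_mul_const _ (show Measurable fun y => F (y, s) from
          hF.comp measurable_prodMk_right)]
        gcongr
    _ = C * ∫⁻ s in Ioo 0 T, ENNReal.ofReal (η (t - s)) := lintegral_const_mul _ hm
    _ ≤ C * 1 := by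
        gcongr
        exact (setLIntegral_le_lintegral _ _).trans_eq (hη.lintegral_sub t)
    _ = C := mul_one C

theorem lintegral_sub_le_ball {Ω : Set R3} {R : ℝ} {f : R3 → ℝ≥0∞} {x : R3}
    (hR : ∀ y ∈ Ω, ‖x - y‖ < R) (hΩ : MeasurableSet Ω) :
    ∫⁻ y in Ω, f (x - y) ≤ ∫⁻ y in Metric.ball (0 : R3) R, f y := by
  rw [← lintegral_indicator hΩ, ← lintegral_indicator measurableSet_ball,
    ← lintegral_sub_left_eq_self ((Metric.ball (0 : R3) R).indicator fun y => f y) x]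
  apply lintegral_mono
  intro y
  by_cases hy : y ∈ Ω
  · have : x - y ∈ Metric.ball (0 : R3) R := by simpa using hR y hy
    simp [hy, this]
  · simp [hy]

theorem lintegral_cylinder_kernel_le {Ω : Set R3} (hΩ : MeasurableSet Ω) {T R : ℝ}
    {f : R3 → ℝ≥0∞} (hf : Measurable f) {η : ℝ → ℝ} (hη : IsMollifier η) {x : R3} (t : ℝ)
    (hR : ∀ y ∈ Ω, ‖x - y‖ < R) :
    ∫⁻ w in cylinder Ω T, f (x - w.1) * ENNReal.ofReal (η (t - w.2))
      ≤ ∫⁻ y in Metric.ball (0 : R3) R, f y :=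
  lintegral_cylinder_mul_le (F := fun w => f (x - w.1))
    (hf.comp (measurable_const.sub measurable_fst)) hη t
    (ae_of_all _ fun _ => lintegral_sub_le_ball hR hΩ)

theorem ae_fst_sub_ne_zero (Ω : Set R3) (T : ℝ) (x : R3) :
    ∀ᵐ w ∂(volume.restrict (cylinder Ω T)), x - w.1 ≠ 0 := by
  have h : ∀ᵐ y ∂(volume.restrict Ω), x - y ≠ 0 := by
    apply ae_restrict_of_ae
    have : ∀ᵐ y : R3, y ≠ x := by simp [ae_iff, measure_singleton]
    filter_upwards [this] with y hy hxy
    exact hy (sub_eq_zero.1 hxy).symm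
  rw [restrict_cylinder]
  exact Measure.quasiMeasurePreserving_fst.ae h

/-- The space-time potential of `g` with spatial kernel `K`, averaged in time by `η`. -/
def pot (Ω : Set R3) (T : ℝ) (η : ℝ → ℝ) (K : R3 → ℝ) (g : R4 → ℝ) (z : R4) : ℝ≥0∞ :=
  ∫⁻ w in cylinder Ω T, ENNReal.ofReal (g w * K (z.1 - w.1)) * ENNReal.ofReal (η (z.2 - w.2))

/-- The kernel `kb(|x|² + δ²)`. -/
def kbKer (δ : ℝ) (x : R3) : ℝ := kb (‖x‖ ^ 2 + δ ^ 2)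

/-- The kernel `kc(|x|² + δ²)`. -/
def kcKer (δ : ℝ) (x : R3) : ℝ := kc (‖x‖ ^ 2 + δ ^ 2)

theorem measurable_ell : Measurable ell := by
  unfold ell; fun_prop

theorem measurable_kb : Measurable kb := by
  unfold kb; have := measurable_ell; fun_prop

theorem measurable_kbKer (δ : ℝ) : Measurable (kbKer δ) :=
  measurable_kb.comp (by fun_prop)

theorem kbKer_pos {δ : ℝ} (hδ : 0 < δ) (x : R3) : 0 < kbKer δ x := kb_pos (sq_add_sq_pos hδ x)

theorem kcKer_pos {δ : ℝ} (hδ : 0 < δ) (x : R3) : 0 < kcKer δ x := kc_pos (sq_add_sq_pos hδ x)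

theorem kbKer_le {δ : ℝ} (hδ : 0 < δ) (x : R3) : kbKer δ x ≤ kb (δ ^ 2) :=
  kb_anti (by positivity) (by nlinarith [sq_nonneg ‖x‖])

theorem kcKer_le {δ : ℝ} (hδ : 0 < δ) (x : R3) : kcKer δ x ≤ kb (δ ^ 2) := by
  have h1 := kc_le_kb (sq_add_sq_pos hδ x)
  have h2 := kbKer_le hδ x
  have h3 := kbKer_pos hδ x
  unfold kcKer; unfold kbKer at *; linarith

theorem IsMollifier.measurable {η : ℝ → ℝ} (hη : IsMollifier η) : Measurable η :=
  hη.contDiff.continuous.measurable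

theorem measurable_pot_integrand {η : ℝ → ℝ} (hη : IsMollifier η) {K : R3 → ℝ} (hK : Measurable K)
    {g : R4 → ℝ} (hg : Measurable g) :
    Measurable fun p : R4 × R4 => ENNReal.ofReal (g p.2 * K (p.1.1 - p.2.1)) *
      ENNReal.ofReal (η (p.1.2 - p.2.2)) := by
  have := hη.measurable
  fun_prop

theorem measurable_pot (Ω : Set R3) (T : ℝ) {η : ℝ → ℝ} (hη : IsMollifier η) {K : R3 → ℝ}
    (hK : Measurable K) {g : R4 → ℝ} (hg : Measurable g) : Measurable (pot Ω T η K g) :=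
  (measurable_pot_integrand hη hK hg).lintegral_prod_right'

/-- Used only qualitatively: for `δ > 0` the kernel is bounded, so the potentials are finite. The
bound blows up as `δ → 0` and never enters the final constant. -/
theorem pot_le_of_bounded {Ω : Set R3} {T : ℝ} {η : ℝ → ℝ} (hη : IsMollifier η) {K : R3 → ℝ}
    {B : ℝ} (hK : ∀ x, K x ≤ B) {g : R4 → ℝ} (hg : Measurable g)
    (hg0 : ∀ w, 0 ≤ g w) {C : ℝ≥0∞}
    (h : ∀ᵐ s ∂(volume.restrict (Ioo 0 T)), ∫⁻ y in Ω, ENNReal.ofReal (g (y, s)) ≤ C) (z : R4) :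
    pot Ω T η K g z ≤ C * ENNReal.ofReal B := by
  unfold pot
  refine le_trans ?_ (lintegral_cylinder_mul_le (Ω := Ω) (T := T)
    (F := fun w => ENNReal.ofReal (g w) * ENNReal.ofReal B) (by fun_prop) hη z.2 ?_)
  · apply lintegral_mono
    intro w
    dsimp only
    gcongr
    rw [← ENNReal.ofReal_mul (hg0 w)]
    exact ENNReal.ofReal_le_ofReal (mul_le_mul_of_nonneg_left (hK _) (hg0 w))
  · filter_upwards [h] with s hs
    rw [lintegral_mul_const _ (by fun_prop)]
    gcongr

/-- Splitting the weaker potential at the level `ell = L`. -/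
theorem pot_kc_le_split {Ω : Set R3} (hΩ : MeasurableSet Ω) {T R : ℝ} (hR1 : 1 ≤ R)
    {η : ℝ → ℝ} (hη : IsMollifier η) {δ : ℝ} (hδ : 0 < δ) {g : R4 → ℝ} (hg : Measurable g)
    (hg0 : ∀ w, 0 ≤ g w) {C : ℝ} (hC : 0 ≤ C)
    (h : ∀ᵐ s ∂(volume.restrict (Ioo 0 T)),
      ∫⁻ y in Ω, ENNReal.ofReal (g (y, s) ^ (3 / 2 : ℝ)) ≤ ENNReal.ofReal C)
    {z : R4} (hR : ∀ y ∈ Ω, ‖z.1 - y‖ < R) {L : ℝ} (hL : 1 ≤ L) :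
    pot Ω T η (kcKer δ) g z ≤ ENNReal.ofReal L⁻¹ * pot Ω T η (kbKer δ) g z
      + ENNReal.ofReal (L ^ (2 / 3 : ℝ) * (C + Real.exp (1 / 2) * polarConst * R)) := by
  have hηm := hη.measurable
  have hL0 : 0 < L := by linarith
  have hkb := measurable_kbKer δ
  set F1 : R4 → ℝ≥0∞ := fun w => ENNReal.ofReal L⁻¹ *
    (ENNReal.ofReal (g w * kbKer δ (z.1 - w.1)) * ENNReal.ofReal (η (z.2 - w.2))) with hF1
  set F2 : R4 → ℝ≥0∞ := fun w => ENNReal.ofReal (L ^ (2 / 3 : ℝ)) *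
    (ENNReal.ofReal (g w ^ (3 / 2 : ℝ)) * ENNReal.ofReal (η (z.2 - w.2))) with hF2
  set F3 : R4 → ℝ≥0∞ := fun w => ENNReal.ofReal (L ^ (-(1 / 3) : ℝ) * Real.exp (1 / 2)) *
    (ENNReal.ofReal (‖z.1 - w.1‖ ^ (1 / L - 3)) * ENNReal.ofReal (η (z.2 - w.2))) with hF3
  have m1 : Measurable F1 := by fun_prop
  have m2 : Measurable F2 := by fun_prop
  have hpt : ∀ᵐ w ∂(volume.restrict (cylinder Ω T)),
      ENNReal.ofReal (g w * kcKer δ (z.1 - w.1)) * ENNReal.ofReal (η (z.2 - w.2))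
        ≤ F1 w + (F2 w + F3 w) := by
    filter_upwards [ae_fst_sub_ne_zero Ω T z.1] with w hw
    have h1 := mul_kc_le (δ := δ) hw hL (hg0 w)
    have hk := (kbKer_pos hδ (z.1 - w.1)).le
    have h0 := hg0 w
    simp only [hF1, hF2, hF3, ← mul_assoc]
    rw [← add_mul, ← add_mul]
    gcongr
    rw [← ENNReal.ofReal_mul (by positivity), ← ENNReal.ofReal_mul (by positivity),
      ← ENNReal.ofReal_mul (by positivity),
      ← ENNReal.ofReal_add (by positivity) (by positivity),
      ← ENNReal.ofReal_add (by positivity) (by positivity)]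
    apply ENNReal.ofReal_le_ofReal
    refine h1.trans (le_of_eq ?_)
    unfold kbKer; ring
  refine (lintegral_mono_ae hpt).trans ?_
  rw [lintegral_add_left m1, lintegral_add_left m2, lintegral_const_mul _ (by fun_prop),
    lintegral_const_mul _ (by fun_prop), lintegral_const_mul _ (by fun_prop)]
  have i2 := lintegral_cylinder_mul_le (Ω := Ω) (T := T)
    (F := fun w => ENNReal.ofReal (g w ^ (3 / 2 : ℝ))) (by fun_prop) hη z.2 h
  have i3 := lintegral_cylinder_kernel_le (T := T) hΩ
    (f := fun y => ENNReal.ofReal (‖y‖ ^ (1 / L - 3))) (by fun_prop) hη z.2 hR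
  rw [lintegral_ball_rpow (by positivity) (by linarith)] at i3
  unfold pot
  gcongr
  refine (add_le_add (mul_le_mul_right i2 _) (mul_le_mul_right i3 _)).trans ?_
  have hp := polarConst_nonneg
  rw [← ENNReal.ofReal_mul (by positivity), ← ENNReal.ofReal_mul (by positivity),
    ← ENNReal.ofReal_add (by positivity) (by positivity)]
  apply ENNReal.ofReal_le_ofReal
  rw [mul_add]
  refine add_le_add le_rfl ?_
  have h1 : R ^ (1 / L) ≤ R := by
    conv_rhs => rw [← Real.rpow_one R]
    exact Real.rpow_le_rpow_of_exponent_le hR1 ((div_le_one hL0).2 hL)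
  have e : L ^ (2 / 3 : ℝ) = L ^ (-(1 / 3) : ℝ) * L := by
    rw [← Real.rpow_add_one hL0.ne']; norm_num
  rw [e, one_div L, div_inv_eq_mul]
  calc _ = L ^ (-(1 / 3) : ℝ) * L * (Real.exp (1 / 2) * polarConst * R ^ L⁻¹) := by ring
    _ ≤ L ^ (-(1 / 3) : ℝ) * L * (Real.exp (1 / 2) * polarConst * R) := by
        rw [one_div] at h1; gcongr

/-- Optimisation of the splitting level, separately at every point `z`. -/
theorem pot_kc_le {Ω : Set R3} (hΩ : MeasurableSet Ω) {T R : ℝ} (hR1 : 1 ≤ R)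
    {η : ℝ → ℝ} (hη : IsMollifier η) {δ : ℝ} (hδ : 0 < δ) {g : R4 → ℝ} (hg : Measurable g)
    (hg0 : ∀ w, 0 ≤ g w) {C : ℝ} (hC : 0 ≤ C)
    (h : ∀ᵐ s ∂(volume.restrict (Ioo 0 T)),
      ∫⁻ y in Ω, ENNReal.ofReal (g (y, s) ^ (3 / 2 : ℝ)) ≤ ENNReal.ofReal C)
    {z : R4} (hR : ∀ y ∈ Ω, ‖z.1 - y‖ < R) (hfin : pot Ω T η (kbKer δ) g z ≠ ⊤) :
    pot Ω T η (kcKer δ) g z ≤ ENNReal.ofReal ((1 + (C + Real.exp (1 / 2) * polarConst * R)) *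
      (1 + (pot Ω T η (kbKer δ) g z).toReal ^ (2 / 5 : ℝ))) := by
  set v := (pot Ω T η (kbKer δ) g z).toReal with hv
  have hv0 : 0 ≤ v := ENNReal.toReal_nonneg
  set B := C + Real.exp (1 / 2) * polarConst * R with hB
  have hB0 : 0 ≤ B := by have := polarConst_nonneg; positivity
  have hvp : 0 ≤ v ^ (3 / 5 : ℝ) := Real.rpow_nonneg hv0 _
  -- The level solves `v / L = L^{2/3}`, each side then being `v^{2/5}`; the maximum enforces `1 ≤
  -- L`.
  set L := max 1 (v ^ (3 / 5 : ℝ)) with hL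
  have hL1 : 1 ≤ L := le_max_left _ _
  have h1 := pot_kc_le_split hΩ hR1 hη hδ hg hg0 hC h hR hL1
  refine h1.trans ?_
  rw [← ENNReal.ofReal_toReal hfin, ← hv, ← ENNReal.ofReal_mul (by positivity),
    ← ENNReal.ofReal_add (by positivity) (by positivity)]
  apply ENNReal.ofReal_le_ofReal
  have hvq : 0 ≤ v ^ (2 / 5 : ℝ) := Real.rpow_nonneg hv0 _
  have a1 : L⁻¹ * v ≤ v ^ (2 / 5 : ℝ) := by
    rcases hv0.eq_or_lt with h0 | h0
    · rw [← h0]; simp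
    · rw [inv_mul_le_iff₀ (by linarith)]
      calc v = v ^ (3 / 5 : ℝ) * v ^ (2 / 5 : ℝ) := by
            rw [← Real.rpow_add h0]; norm_num
        _ ≤ _ := by gcongr; exact le_max_right _ _
  have a2 : L ^ (2 / 3 : ℝ) ≤ 1 + v ^ (2 / 5 : ℝ) := by
    rcases le_total (v ^ (3 / 5 : ℝ)) 1 with h0 | h0
    · rw [hL, max_eq_left h0]; simp [hvq]
    · rw [hL, max_eq_right h0, ← Real.rpow_mul hv0]; norm_num
  calc L⁻¹ * v + L ^ (2 / 3 : ℝ) * B ≤ v ^ (2 / 5 : ℝ) + (1 + v ^ (2 / 5 : ℝ)) * B := by gcongr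
    _ ≤ _ := by nlinarith

/-! ### Potential estimates from the energy bounds -/

/-- Uniform-in-time energy bounds of a density `ϱ`, a pressure `p` and a velocity `u`. -/
structure EnergyBounds (Ω : Set R3) (T E : ℝ) (ϱ p : R4 → ℝ) (u : R4 → R3) : Prop where
  nonneg : 0 ≤ E
  meas_density : Measurable ϱ
  meas_pressure : Measurable p
  meas_velocity : Measurable u
  density_nonneg : ∀ z, 0 ≤ ϱ z
  rpow_le_pressure : ∀ z, ϱ z ^ (3 / 2 : ℝ) ≤ p z
  pressure_le : ∀ᵐ s ∂(volume.restrict (Ioo 0 T)),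
    ∫⁻ y in Ω, ENNReal.ofReal (p (y, s)) ≤ ENNReal.ofReal E
  kinetic_le : ∀ᵐ s ∂(volume.restrict (Ioo 0 T)),
    ∫⁻ y in Ω, ENNReal.ofReal (ϱ (y, s) * ‖u (y, s)‖ ^ 2) ≤ ENNReal.ofReal E

theorem EnergyBounds.pressure_nonneg {Ω : Set R3} {T E : ℝ} {ϱ p : R4 → ℝ} {u : R4 → R3}
    (h : EnergyBounds Ω T E ϱ p u) (z : R4) : 0 ≤ p z :=
  (Real.rpow_nonneg (h.density_nonneg z) _).trans (h.rpow_le_pressure z)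

theorem lintegral_cylinder_le {Ω : Set R3} {T : ℝ} {F : R4 → ℝ≥0∞} (hF : Measurable F)
    {B : ℝ → ℝ≥0∞} (h : ∀ᵐ s ∂(volume.restrict (Ioo 0 T)), ∫⁻ y in Ω, F (y, s) ≤ B s) :
    ∫⁻ w in cylinder Ω T, F w ≤ ∫⁻ s in Ioo 0 T, B s := by
  rw [restrict_cylinder, lintegral_prod_symm _ hF.aemeasurable]
  exact lintegral_mono_ae h

theorem lintegral_cylinder_le_const {Ω : Set R3} {T : ℝ} {F : R4 → ℝ≥0∞} (hF : Measurable F)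
    {C : ℝ≥0∞} (h : ∀ᵐ s ∂(volume.restrict (Ioo 0 T)), ∫⁻ y in Ω, F (y, s) ≤ C) :
    ∫⁻ w in cylinder Ω T, F w ≤ C * ENNReal.ofReal T := by
  refine (lintegral_cylinder_le hF h).trans ?_
  simp

theorem density_le {a : ℝ} (ha : 0 ≤ a) : a ≤ 1 + a ^ (3 / 2 : ℝ) := by
  have := young_three_halves ha zero_le_one
  norm_num at this ⊢; linarith

/-- The constant bounding the fields generated by `hker`. -/
def fieldConst (V E R : ℝ) : ℝ := V + 3 * E + 19 ^ 8 * (1 + R ^ 2) * (polarConst * (R ^ 2 / 2))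

/-- Fields generated by `hker` from densities of size `ϱ(1 + |u|)` are bounded. By Young, `ϱ(1+|u|)k
≤ ϱ + ϱ|u|² + ϱk²` and `ϱk² ≤ ϱ^{3/2} + k⁶`; the energy controls everything but `k⁶`, and the kernel
lies in `L⁶` of a ball. -/
theorem lintegral_hker_le {Ω : Set R3} (hΩ : MeasurableSet Ω) {T E R : ℝ} (hR0 : 0 < R)
    (hV : volume Ω ≠ ⊤)
    {ϱ p : R4 → ℝ} {u : R4 → R3} (hE : EnergyBounds Ω T E ϱ p u)
    {η : ℝ → ℝ} (hη : IsMollifier η) {δ : ℝ} (hδ : 0 < δ)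
    {z : R4} (hR : ∀ y ∈ Ω, ‖z.1 - y‖ < R) :
    ∫⁻ w in cylinder Ω T, ENNReal.ofReal (ϱ w * (1 + ‖u w‖) * ‖hker δ (z.1 - w.1)‖)
        * ENNReal.ofReal (η (z.2 - w.2))
      ≤ ENNReal.ofReal (fieldConst (volume Ω).toReal E R) := by
  have hηm := hη.measurable
  have hm1 := hE.meas_density
  have hm2 := hE.meas_pressure
  have hm3 := hE.meas_velocity
  set F : R4 → ℝ≥0∞ := fun w => 1 + 2 * ENNReal.ofReal (p w) + ENNReal.ofReal (ϱ w * ‖u w‖ ^ 2)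
    with hF
  have mF : Measurable F := by fun_prop
  set f : R3 → ℝ≥0∞ := fun x => ENNReal.ofReal (‖hker δ x‖ ^ 6) with hf
  have mf : Measurable f := by have := (contDiff_hker hδ).continuous; fun_prop
  have hpt : ∀ w, ENNReal.ofReal (ϱ w * (1 + ‖u w‖) * ‖hker δ (z.1 - w.1)‖) ≤
      F w + f (z.1 - w.1) := by
    intro w
    have h0 := hE.density_nonneg w
    have hp := hE.pressure_nonneg w
    set k := ‖hker δ (z.1 - w.1)‖
    have hk : 0 ≤ k := norm_nonneg _
    have e : F w + f (z.1 - w.1) = ENNReal.ofReal (1 + 2 * p w + ϱ w * ‖u w‖ ^ 2 + k ^ 6) := by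
      rw [ENNReal.ofReal_add (by positivity) (by positivity),
        ENNReal.ofReal_add (by positivity) (by positivity),
        ENNReal.ofReal_add (by positivity) (by positivity),
        ENNReal.ofReal_mul (by norm_num)]
      simp [hF, hf, k]
    rw [e]
    apply ENNReal.ofReal_le_ofReal
    have h1 := density_le h0
    have h2 := young_three_halves h0 (sq_nonneg k)
    have h3 := hE.rpow_le_pressure w
    have h4 : (k ^ 2) ^ 3 = k ^ 6 := by ring
    have h5 : (1 + ‖u w‖) * k ≤ 1 + ‖u w‖ ^ 2 + k ^ 2 := by
      nlinarith [sq_nonneg (1 - ‖u w‖), sq_nonneg (1 + ‖u w‖ - k), sq_nonneg k]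
    have h6 := mul_le_mul_of_nonneg_left h5 h0
    rw [h4] at h2
    nlinarith
  calc _ ≤ ∫⁻ w in cylinder Ω T, (F w * ENNReal.ofReal (η (z.2 - w.2))
        + f (z.1 - w.1) * ENNReal.ofReal (η (z.2 - w.2))) := by
        apply lintegral_mono
        intro w
        dsimp only
        rw [← add_mul]
        gcongr
        exact hpt w
    _ ≤ (volume Ω + 2 * ENNReal.ofReal E + ENNReal.ofReal E)
        + ENNReal.ofReal (19 ^ 8 * (1 + R ^ 2) * (polarConst * (R ^ 2 / 2))) := by
        rw [lintegral_add_left (by fun_prop)]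
        apply add_le_add
        · apply lintegral_cylinder_mul_le mF hη
          filter_upwards [hE.pressure_le, hE.kinetic_le] with s h1 h2
          simp only [hF]
          rw [lintegral_add_left (by fun_prop), lintegral_add_left (by fun_prop),
            lintegral_const_mul _ (by fun_prop)]
          simp only [lintegral_const, one_mul, Measure.restrict_apply MeasurableSet.univ,
            univ_inter]
          gcongr
        · refine (lintegral_cylinder_kernel_le hΩ mf hη z.2 hR).trans ?_
          have h0 : ∀ᵐ x ∂((volume : Measure R3).restrict (Metric.ball 0 R)),
              f x ≤ ENNReal.ofReal (19 ^ 8 * (1 + R ^ 2)) *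
                ENNReal.ofReal (‖x‖ ^ ((2 : ℝ) - 3)) := by
            have : ∀ᵐ x : R3, x ≠ 0 := by simp [ae_iff, measure_singleton]
            filter_upwards [ae_restrict_of_ae this, ae_restrict_mem measurableSet_ball] with x hx hb
            rw [← ENNReal.ofReal_mul (by positivity)]
            apply ENNReal.ofReal_le_ofReal
            exact norm_hker_pow_six_le hδ hx (by simpa using (mem_ball_zero_iff.1 hb).le)
          refine (lintegral_mono_ae h0).trans ?_
          rw [lintegral_const_mul _ (by fun_prop), lintegral_ball_rpow (by norm_num) hR0,
            ← ENNReal.ofReal_mul (by positivity), Real.rpow_two]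
    _ = _ := by
        have := hE.nonneg
        have hp := polarConst_nonneg
        rw [← ENNReal.ofReal_toReal hV, fieldConst,
          ENNReal.ofReal_add (by positivity) (by positivity),
          ENNReal.ofReal_add (by positivity) (by positivity)]
        congr 1
        rw [add_assoc, ENNReal.toReal_ofReal (by positivity)]
        congr 1
        rw [show (3 : ℝ) * E = 2 * E + E by ring, ENNReal.ofReal_add (by positivity) (by positivity),
          ENNReal.ofReal_mul (by norm_num)]
        simp

/-- The constant bounding the square integral of the kernel `kbKer`. -/
def kbSqConst (R : ℝ) : ℝ := 15 ^ 3 * (1 + R ^ 2) * (polarConst * (R ^ (1 / 2 : ℝ) / (1 / 2)))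

theorem lintegral_kbKer_sq_le {R : ℝ} (hR0 : 0 < R) (δ : ℝ) :
    ∫⁻ x in Metric.ball (0 : R3) R, ENNReal.ofReal (kbKer δ x ^ 2)
      ≤ ENNReal.ofReal (kbSqConst R) := by
  have h0 : ∀ᵐ x ∂((volume : Measure R3).restrict (Metric.ball 0 R)),
      ENNReal.ofReal (kbKer δ x ^ 2) ≤ ENNReal.ofReal (15 ^ 3 * (1 + R ^ 2)) *
        ENNReal.ofReal (‖x‖ ^ ((1 / 2 : ℝ) - 3)) := by
    have : ∀ᵐ x : R3, x ≠ 0 := by simp [ae_iff, measure_singleton]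
    filter_upwards [ae_restrict_of_ae this, ae_restrict_mem measurableSet_ball] with x hx hb
    rw [← ENNReal.ofReal_mul (by positivity)]
    apply ENNReal.ofReal_le_ofReal
    exact kb_sq_le hx (by simpa using (mem_ball_zero_iff.1 hb).le)
  refine (lintegral_mono_ae h0).trans ?_
  rw [lintegral_const_mul _ (by fun_prop), lintegral_ball_rpow (by norm_num) hR0,
    ← ENNReal.ofReal_mul (by positivity), kbSqConst]

/-- From `σ · kb ≤ σ² + kb²` inside the double integral: the first part needs only the mass of `g`,
the second only the local square integrability of the kernel. Applied with `σ` an entry of the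
stress. -/
theorem lintegral_mul_pot_le {Ω : Set R3} (hΩ : MeasurableSet Ω) {T R : ℝ} (hR0 : 0 < R)
    (hR : ∀ x ∈ Ω, ∀ y ∈ Ω, ‖x - y‖ < R) {η : ℝ → ℝ} (hη : IsMollifier η) {δ : ℝ}
    {g : R4 → ℝ} (hg : Measurable g) (hg0 : ∀ w, 0 ≤ g w) {C : ℝ≥0∞}
    (h : ∀ᵐ s ∂(volume.restrict (Ioo 0 T)), ∫⁻ y in Ω, ENNReal.ofReal (g (y, s)) ≤ C)
    (hδ : 0 < δ)
    {σ : R4 → ℝ} (hσ : Measurable σ) (hσ0 : ∀ z, 0 ≤ σ z) :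
    ∫⁻ z in cylinder Ω T, ENNReal.ofReal (σ z) * pot Ω T η (kbKer δ) g z
      ≤ C * (∫⁻ z in cylinder Ω T, ENNReal.ofReal (σ z ^ 2))
        + C * ENNReal.ofReal T * ENNReal.ofReal (kbSqConst R) := by
  have hηm := hη.measurable
  have hk := measurable_kbKer δ
  set A : R4 → R4 → ℝ≥0∞ := fun z w => ENNReal.ofReal (σ z ^ 2) *
    (ENNReal.ofReal (g w) * ENNReal.ofReal (η (z.2 - w.2))) with hA
  set B : R4 → R4 → ℝ≥0∞ := fun z w => ENNReal.ofReal (g w) *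
    (ENNReal.ofReal (kbKer δ (z.1 - w.1) ^ 2) * ENNReal.ofReal (η (z.2 - w.2))) with hB
  have mA : Measurable (Function.uncurry A) := by simp only [hA, Function.uncurry_def]; fun_prop
  have mB : Measurable (Function.uncurry B) := by simp only [hB, Function.uncurry_def]; fun_prop
  calc _ ≤ ∫⁻ z in cylinder Ω T, ∫⁻ w in cylinder Ω T, (A z w + B z w) := by
        apply lintegral_mono
        intro z
        dsimp only
        unfold pot
        rw [← lintegral_const_mul _ (by fun_prop)]
        apply lintegral_mono
        intro w
        have h0 := hg0 w
        have h1 := hσ0 z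
        have h2 := (kbKer_pos hδ (z.1 - w.1)).le
        have h3 := hη.nonneg (z.2 - w.2)
        simp only [hA, hB]
        rw [← ENNReal.ofReal_mul (by positivity), ← ENNReal.ofReal_mul (by positivity),
          ← ENNReal.ofReal_mul (by positivity), ← ENNReal.ofReal_mul (by positivity),
          ← ENNReal.ofReal_mul (by positivity), ← ENNReal.ofReal_mul (by positivity),
          ← ENNReal.ofReal_add (by positivity) (by positivity)]
        apply ENNReal.ofReal_le_ofReal
        have h4 : σ z * kbKer δ (z.1 - w.1) ≤ σ z ^ 2 + kbKer δ (z.1 - w.1) ^ 2 := by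
          nlinarith [sq_nonneg (σ z - kbKer δ (z.1 - w.1)), sq_nonneg (σ z),
            sq_nonneg (kbKer δ (z.1 - w.1))]
        nlinarith [mul_le_mul_of_nonneg_left h4 (mul_nonneg h0 h3)]
    _ = (∫⁻ z in cylinder Ω T, ∫⁻ w in cylinder Ω T, A z w)
        + ∫⁻ z in cylinder Ω T, ∫⁻ w in cylinder Ω T, B z w := by
        have : ∀ z, ∫⁻ w in cylinder Ω T, (A z w + B z w)
            = (∫⁻ w in cylinder Ω T, A z w) + ∫⁻ w in cylinder Ω T, B z w := fun z =>
          lintegral_add_left (mA.of_uncurry_left) _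
        simp_rw [this]
        exact lintegral_add_left mA.lintegral_prod_right' _
    _ ≤ _ := by
        apply add_le_add
        · rw [← lintegral_const_mul _ (by fun_prop)]
          apply lintegral_mono
          intro z
          simp only [hA]
          rw [lintegral_const_mul _ (by fun_prop), mul_comm]
          gcongr
          exact lintegral_cylinder_mul_le (F := fun w => ENNReal.ofReal (g w)) (by fun_prop) hη z.2 h
        · rw [lintegral_lintegral_swap mB.aemeasurable]
          calc _ ≤ ∫⁻ w in cylinder Ω T, ENNReal.ofReal (g w) * ENNReal.ofReal (kbSqConst R) := by
                refine lintegral_mono_ae ?_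
                have hmem : ∀ᵐ w ∂(volume.restrict (cylinder Ω T)), w ∈ cylinder Ω T :=
                  ae_restrict_mem (hΩ.prod measurableSet_Ioo)
                filter_upwards [hmem] with w hw
                simp only [hB]
                rw [lintegral_const_mul _ (by fun_prop)]
                gcongr
                refine le_trans (le_of_eq ?_) ((lintegral_cylinder_kernel_le (T := T) hΩ
                  (f := fun x => ENNReal.ofReal (kbKer δ x ^ 2)) (by fun_prop) hη (x := w.1) w.2
                  (fun y hy => hR _ hw.1 y hy)).trans (lintegral_kbKer_sq_le hR0 δ))
                congr 1; ext z
                -- After exchanging the two points the time difference has the wrong sign; evenness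
                -- of `η` repairs it.
                rw [← hη.even, neg_sub]
                simp only [kbKer, norm_sub_rev]
            _ ≤ _ := by
                rw [lintegral_mul_const _ (by fun_prop)]
                gcongr
                exact lintegral_cylinder_le_const (F := fun w => ENNReal.ofReal (g w))
                  (by fun_prop) h

/-- The absorption estimate for the term of lower logarithmic order. -/
theorem lintegral_kinetic_mul_pot_kc_le {Ω : Set R3} (hΩ : MeasurableSet Ω) {T E R : ℝ}
    (hT : 0 < T) (hR1 : 1 ≤ R) (hR : ∀ x ∈ Ω, ∀ y ∈ Ω, ‖x - y‖ < R)
    {ϱ p : R4 → ℝ} {u : R4 → R3} (hE : EnergyBounds Ω T E ϱ p u)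
    {η : ℝ → ℝ} (hη : IsMollifier η) {δ : ℝ} (hδ : 0 < δ)
    {θ : R4 → ℝ} (hθ : Measurable θ) (hθ0 : ∀ z, 0 ≤ θ z) {M : ℝ} (hM0 : 0 ≤ M)
    (hM : ∀ z, θ z ≤ M) {D : ℝ → ℝ} (hD : Measurable D) (hD1 : ∀ t, 1 ≤ D t)
    {F : ℝ} (hF : 0 ≤ F) (hDF : ∫⁻ t in Ioo 0 T, ENNReal.ofReal (D t) ≤ ENNReal.ofReal F)
    (hsob : ∀ᵐ t ∂(volume.restrict (Ioo 0 T)),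
      ∫⁻ x in Ω, ENNReal.ofReal ((θ (x, t) * ‖u (x, t)‖ ^ 2) ^ 3) ≤ ENNReal.ofReal (D t ^ 3))
    {C : ℝ} (hC : 0 ≤ C)
    (h : ∀ᵐ s ∂(volume.restrict (Ioo 0 T)),
      ∫⁻ y in Ω, ENNReal.ofReal ((θ (y, s) * ϱ (y, s)) ^ (3 / 2 : ℝ)) ≤ ENNReal.ofReal C)
    (hfin : ∀ z, pot Ω T η (kbKer δ) (fun z => θ z * ϱ z) z ≠ ⊤)
    {e : ℝ} (he : 0 < e) :
    ∫⁻ z in cylinder Ω T, ENNReal.ofReal (θ z * ϱ z * ‖u z‖ ^ 2)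
        * pot Ω T η (kcKer δ) (fun z => θ z * ϱ z) z
      ≤ ENNReal.ofReal ((1 + (C + Real.exp (1 / 2) * polarConst * R)) *
          (M * (E * T) + (F * E / e + F)))
        + ENNReal.ofReal ((1 + (C + Real.exp (1 / 2) * polarConst * R)) * e) *
          ∫⁻ z in cylinder Ω T, ENNReal.ofReal (θ z * ϱ z ^ (3 / 2 : ℝ))
            * pot Ω T η (kbKer δ) (fun z => θ z * ϱ z) z := by
  have hm1 := hE.meas_density
  have hm3 := hE.meas_velocity
  have hp0 := polarConst_nonneg
  have hE0 := hE.nonneg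
  set C1 := 1 + (C + Real.exp (1 / 2) * polarConst * R) with hC1
  have hC1p : 0 < C1 := by positivity
  set g : R4 → ℝ := fun z => θ z * ϱ z with hg
  have mg : Measurable g := by fun_prop
  have hg0 : ∀ z, 0 ≤ g z := fun z => mul_nonneg (hθ0 z) (hE.density_nonneg z)
  have mpot := measurable_pot Ω T hη (measurable_kbKer δ) mg
  set F1 : R4 → ℝ≥0∞ := fun z => ENNReal.ofReal (M * (ϱ z * ‖u z‖ ^ 2))
  set F2 : R4 → ℝ≥0∞ := fun z => ENNReal.ofReal (ϱ z * ‖u z‖ ^ 2) * ENNReal.ofReal (D z.2 / e)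
  set F3 : R4 → ℝ≥0∞ := fun z => ENNReal.ofReal ((θ z * ‖u z‖ ^ 2) ^ 3) *
    ENNReal.ofReal ((D z.2 ^ 2)⁻¹)
  set F4 : R4 → ℝ≥0∞ := fun z => ENNReal.ofReal (θ z * ϱ z ^ (3 / 2 : ℝ)) * pot Ω T η (kbKer δ) g z
  have hpt : ∀ᵐ z ∂(volume.restrict (cylinder Ω T)), ENNReal.ofReal (θ z * ϱ z * ‖u z‖ ^ 2)
      * pot Ω T η (kcKer δ) g z ≤ ENNReal.ofReal C1 * (F1 z + (F2 z + (F3 z +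
        ENNReal.ofReal e * F4 z))) := by
    have hmem : ∀ᵐ w ∂(volume.restrict (cylinder Ω T)), w ∈ cylinder Ω T :=
      ae_restrict_mem (hΩ.prod measurableSet_Ioo)
    filter_upwards [hmem] with z hz
    have h1 := pot_kc_le hΩ hR1 hη hδ mg hg0 hC h (fun y hy => hR _ hz.1 y hy) (hfin z)
    set v := (pot Ω T η (kbKer δ) g z).toReal with hv
    have hv0 : 0 ≤ v := ENNReal.toReal_nonneg
    have hθz := hθ0 z
    have hϱz := hE.density_nonneg z
    have hDz : 0 < D z.2 := by linarith [hD1 z.2]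
    refine (mul_le_mul_right h1 _).trans ?_
    simp only [F1, F2, F3, F4]
    rw [← ENNReal.ofReal_toReal (hfin z), ← hv]
    rw [← ENNReal.ofReal_mul (by positivity), ← ENNReal.ofReal_mul (by positivity),
      ← ENNReal.ofReal_mul (by positivity), ← ENNReal.ofReal_mul (by positivity),
      ← ENNReal.ofReal_mul (by positivity),
      ← ENNReal.ofReal_add (by positivity) (by positivity),
      ← ENNReal.ofReal_add (by positivity) (by positivity),
      ← ENNReal.ofReal_add (by positivity) (by positivity),
      ← ENNReal.ofReal_mul (by positivity)]
    apply ENNReal.ofReal_le_ofReal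
    have h2 : θ z * ϱ z * ‖u z‖ ^ 2 ≤ M * (ϱ z * ‖u z‖ ^ 2) := by
      rw [mul_assoc]; exact mul_le_mul_of_nonneg_right (hM z) (by positivity)
    have h3 := young_two_fifths (a := D z.2 * (ϱ z * ‖u z‖ ^ 2))
      (b := (θ z * ‖u z‖ ^ 2) ^ 3 * (D z.2 ^ 2)⁻¹) (c := θ z * ϱ z ^ (3 / 2 : ℝ) * v)
      (by positivity) (by positivity) (by positivity) he
    -- Bookkeeping of exponents: `θ`, `ϱ` and `|u|²` each collect `2/5 + 3/5`, the powers of `D`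
    -- cancel as `2/5 - 2/5`, and `v` keeps `2/5`.
    have h4 : (D z.2 * (ϱ z * ‖u z‖ ^ 2)) ^ (2 / 5 : ℝ) *
        ((θ z * ‖u z‖ ^ 2) ^ 3 * (D z.2 ^ 2)⁻¹) ^ (1 / 5 : ℝ) *
        (θ z * ϱ z ^ (3 / 2 : ℝ) * v) ^ (2 / 5 : ℝ)
        = θ z * ϱ z * ‖u z‖ ^ 2 * v ^ (2 / 5 : ℝ) := by
      have key : ∀ x : ℝ, 0 ≤ x → x ^ (2 / 5 : ℝ) * x ^ (3 / 5 : ℝ) = x := fun x hx => by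
        rw [← Real.rpow_add_of_nonneg hx (by norm_num) (by norm_num)]; norm_num
      set U := ‖u z‖ ^ 2
      have hU : 0 ≤ U := by positivity
      rw [Real.mul_rpow (by positivity) (by positivity), Real.mul_rpow (by positivity) (by positivity),
        Real.mul_rpow (by positivity) (by positivity), Real.mul_rpow (by positivity) (by positivity),
        Real.mul_rpow (by positivity) (by positivity), Real.inv_rpow (by positivity),
        ← Real.rpow_natCast, ← Real.rpow_natCast, ← Real.rpow_mul (by positivity),
        ← Real.rpow_mul (by positivity), ← Real.rpow_mul (by positivity),
        Real.mul_rpow (by positivity) (by positivity)]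
      have e1 : (((3 : ℕ) : ℝ) * (1 / 5)) = 3 / 5 := by norm_num
      have e2 : (((2 : ℕ) : ℝ) * (1 / 5)) = 2 / 5 := by norm_num
      have e3 : ((3 / 2 : ℝ) * (2 / 5)) = 3 / 5 := by norm_num
      rw [e1, e2, e3]
      have hDne : D z.2 ^ (2 / 5 : ℝ) ≠ 0 := by positivity
      calc _ = (D z.2 ^ (2 / 5 : ℝ) * (D z.2 ^ (2 / 5 : ℝ))⁻¹) *
            (θ z ^ (2 / 5 : ℝ) * θ z ^ (3 / 5 : ℝ)) *
            (ϱ z ^ (2 / 5 : ℝ) * ϱ z ^ (3 / 5 : ℝ)) * (U ^ (2 / 5 : ℝ) * U ^ (3 / 5 : ℝ)) *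
            v ^ (2 / 5 : ℝ) := by ring
        _ = _ := by rw [key _ hθz, key _ hϱz, key _ hU, mul_inv_cancel₀ hDne, one_mul]
    rw [h4] at h3
    have e5 : D z.2 * (ϱ z * ‖u z‖ ^ 2) / e = ϱ z * ‖u z‖ ^ 2 * (D z.2 / e) := by ring
    rw [e5] at h3
    calc _ = C1 * (θ z * ϱ z * ‖u z‖ ^ 2 + θ z * ϱ z * ‖u z‖ ^ 2 * v ^ (2 / 5 : ℝ)) := by ring
      _ ≤ _ := by
        apply mul_le_mul_of_nonneg_left _ hC1p.le
        linarith
  have m1 : Measurable F1 := by fun_prop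
  have m2 : Measurable F2 := by fun_prop
  have m3 : Measurable F3 := by fun_prop
  have m4 : Measurable F4 := by fun_prop
  refine (lintegral_mono_ae hpt).trans ?_
  rw [lintegral_const_mul _ (by fun_prop), lintegral_add_left m1, lintegral_add_left m2,
    lintegral_add_left m3, lintegral_const_mul _ m4]
  have i1 : ∫⁻ z in cylinder Ω T, F1 z ≤ ENNReal.ofReal (M * (E * T)) := by
    refine (lintegral_cylinder_le_const (C := ENNReal.ofReal (M * E)) m1 ?_).trans (le_of_eq ?_)
    · filter_upwards [hE.kinetic_le] with s hs
      simp only [F1, ENNReal.ofReal_mul hM0]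
      rw [lintegral_const_mul _ (by fun_prop)]
      gcongr
    · rw [← ENNReal.ofReal_mul (by positivity)]; congr 1; ring
  -- The kinetic energy is bounded uniformly in time, so the weight `D` need only be integrable in
  -- time.
  have i2 : ∫⁻ z in cylinder Ω T, F2 z ≤ ENNReal.ofReal (F * E / e) := by
    refine (lintegral_cylinder_le (B := fun s => ENNReal.ofReal (E / e) * ENNReal.ofReal (D s)) m2
      ?_).trans ?_
    · filter_upwards [hE.kinetic_le] with s hs
      simp only [F2]
      have := hD1 s
      rw [lintegral_mul_const _ (by fun_prop), ← ENNReal.ofReal_mul (by positivity),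
        show E / e * D s = E * (D s / e) by ring, ENNReal.ofReal_mul (by positivity)]
      gcongr
    · rw [lintegral_const_mul _ (by fun_prop), show F * E / e = E / e * F by ring,
        ENNReal.ofReal_mul (by positivity)]
      gcongr
  -- The Sobolev bound `D³` times the weight `D⁻²` leaves one integrable power of `D`.
  have i3 : ∫⁻ z in cylinder Ω T, F3 z ≤ ENNReal.ofReal F := by
    refine (lintegral_cylinder_le (B := fun s => ENNReal.ofReal (D s)) m3 ?_).trans hDF
    filter_upwards [hsob] with s hs
    simp only [F3]
    have := hD1 s
    rw [lintegral_mul_const _ (by fun_prop)]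
    refine (mul_le_mul_left hs _).trans (le_of_eq ?_)
    rw [← ENNReal.ofReal_mul (by positivity)]
    congr 1; field_simp
  clear_value C1
  calc _ ≤ ENNReal.ofReal C1 * (ENNReal.ofReal (M * (E * T)) + (ENNReal.ofReal (F * E / e) +
        (ENNReal.ofReal F + ENNReal.ofReal e * ∫⁻ z in cylinder Ω T, F4 z))) := by gcongr
    _ = _ := by
      rw [ENNReal.ofReal_mul hC1p.le, ENNReal.ofReal_mul hC1p.le,
        ENNReal.ofReal_add (by positivity) (by positivity),
        ENNReal.ofReal_add (by positivity) (by positivity)]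
      ring

end

end CompressibleNS

/-! ### Smooth convolutions and a local Sobolev inequality for weak gradients -/

open MeasureTheory Set
open scoped ENNReal ContDiff

namespace CompressibleNS

noncomputable section

open scoped Convolution Topology
open Filter

theorem contDiff_conv {V F : Type*} [NormedAddCommGroup V] [NormedSpace ℝ V] [MeasurableSpace V]
    [BorelSpace V] [NormedAddCommGroup F] [NormedSpace ℝ F] [CompleteSpace F]
    {m : Measure V} [SFinite m]
    [m.IsAddLeftInvariant] {f : V → ℝ} (hf : LocallyIntegrable f m) {H : V → F}
    (hH : ContDiff ℝ ∞ H) (hHc : HasCompactSupport H) :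
    ContDiff ℝ ∞ (fun x => ∫ y, f y • H (x - y) ∂m) :=
  hHc.contDiff_convolution_right (n := ⊤) (ContinuousLinearMap.lsmul ℝ ℝ) hf hH

theorem fderiv_conv_apply {V F : Type*} [NormedAddCommGroup V] [NormedSpace ℝ V]
    [MeasurableSpace V]
    [BorelSpace V] [NormedAddCommGroup F] [NormedSpace ℝ F] [CompleteSpace F]
    {m : Measure V} [SFinite m]
    [m.IsAddLeftInvariant] {f : V → ℝ} (hf : LocallyIntegrable f m) {H : V → F}
    (hH : ContDiff ℝ ∞ H) (hHc : HasCompactSupport H) (x v : V) :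
    fderiv ℝ (fun x => ∫ y, f y • H (x - y) ∂m) x v = ∫ y, f y • fderiv ℝ H (x - y) v ∂m := by
  have h := (hHc.hasFDerivAt_convolution_right (ContinuousLinearMap.lsmul ℝ ℝ) hf
    (hH.of_le (by simp)) x).fderiv
  have e : (f ⋆[ContinuousLinearMap.lsmul ℝ ℝ, m] H) = fun x => ∫ y, f y • H (x - y) ∂m := rfl
  rw [e] at h
  have hint : Integrable (fun y => f y • fderiv ℝ H (x - y)) m :=
    (hHc.fderiv ℝ).convolutionExists_right
      (ContinuousLinearMap.lsmul ℝ ℝ) hf (hH.continuous_fderiv (by simp)) x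
  have e2 : ((f ⋆[(ContinuousLinearMap.lsmul ℝ ℝ).precompR V, m] fderiv ℝ H) x : V →L[ℝ] F)
      = ∫ y, f y • fderiv ℝ H (x - y) ∂m := by
    rw [convolution_def]
    congr 1
  rw [h, e2, ContinuousLinearMap.integral_apply hint]
  rfl

theorem sq_norm_clm_le (A : R3 →L[ℝ] ℝ) :
    ‖A‖ ^ 2 ≤ ∑ j, A (EuclideanSpace.single j 1) ^ 2 := by
  set b := ∑ j, A (EuclideanSpace.single j 1) ^ 2 with hb
  have hb0 : 0 ≤ b := Finset.sum_nonneg fun _ _ => sq_nonneg _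
  have h : ‖A‖ ≤ Real.sqrt b := by
    apply A.opNorm_le_bound (Real.sqrt_nonneg _)
    intro v
    have e : A v = ∑ j, v j * A (EuclideanSpace.single j 1) := by
      conv_lhs => rw [← (EuclideanSpace.basisFun (Fin 3) ℝ).sum_repr v]
      simp
    rw [e]
    apply Real.abs_le_sqrt (x := ∑ j, v j * A (EuclideanSpace.single j 1)) (y := b * ‖v‖ ^ 2) ?_ |>.trans
    · rw [Real.sqrt_mul hb0, Real.sqrt_sq (norm_nonneg _)]
    · rw [EuclideanSpace.real_norm_sq_eq, mul_comm b]
      exact Finset.sum_mul_sq_le_sq_mul_sq _ _ _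
  calc ‖A‖ ^ 2 ≤ Real.sqrt b ^ 2 := pow_le_pow_left₀ (norm_nonneg _) h 2
    _ = b := Real.sq_sqrt hb0

/-- Jensen's inequality for averages against a kernel of mass one. -/
theorem enorm_integral_sq_le {α : Type*} [MeasurableSpace α] {m : Measure α} {k g : α → ℝ}
    (hk : AEMeasurable k m) (hg : AEMeasurable g m) (hk1 : ∫⁻ y, ENNReal.ofReal (k y) ∂m ≤ 1)
    (hk0 : ∀ y, 0 ≤ k y) :
    ‖∫ y, g y * k y ∂m‖ₑ ^ 2 ≤ ∫⁻ y, ENNReal.ofReal (k y) * ‖g y‖ₑ ^ 2 ∂m := by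
  have h1 : ‖∫ y, g y * k y ∂m‖ₑ ≤ ∫⁻ y, (ENNReal.ofReal (k y) ^ (1 / 2 : ℝ)) *
      (ENNReal.ofReal (k y) ^ (1 / 2 : ℝ) * ‖g y‖ₑ) ∂m := by
    refine (enorm_integral_le_lintegral_enorm _).trans (le_of_eq ?_)
    congr 1; ext y
    rw [← mul_assoc, ← ENNReal.rpow_add_of_nonneg _ _ (by norm_num) (by norm_num), enorm_mul,
      mul_comm]
    norm_num [Real.enorm_of_nonneg (hk0 y)]
  have h2 := ENNReal.lintegral_mul_le_Lp_mul_Lq m (p := 2) (q := 2)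
    (Real.holderConjugate_iff.2 (by norm_num))
    (f := fun y => ENNReal.ofReal (k y) ^ (1 / 2 : ℝ))
    (g := fun y => ENNReal.ofReal (k y) ^ (1 / 2 : ℝ) * ‖g y‖ₑ) (by fun_prop) (by fun_prop)
  have h3 := h1.trans h2
  have e1 : ∀ y, (ENNReal.ofReal (k y) ^ (1 / 2 : ℝ)) ^ (2 : ℝ) = ENNReal.ofReal (k y) := by
    intro y; rw [← ENNReal.rpow_mul]; norm_num
  have e2 : ∀ y, (ENNReal.ofReal (k y) ^ (1 / 2 : ℝ) * ‖g y‖ₑ) ^ (2 : ℝ)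
      = ENNReal.ofReal (k y) * ‖g y‖ₑ ^ 2 := by
    intro y; rw [ENNReal.mul_rpow_of_nonneg _ _ (by norm_num), e1, ENNReal.rpow_two]
  simp only [e1, e2] at h3
  have h4 : ‖∫ y, g y * k y ∂m‖ₑ ≤ (∫⁻ y, ENNReal.ofReal (k y) * ‖g y‖ₑ ^ 2 ∂m) ^ (1 / 2 : ℝ) := by
    refine h3.trans ?_
    calc _ ≤ 1 ^ (1 / 2 : ℝ) * (∫⁻ y, ENNReal.ofReal (k y) * ‖g y‖ₑ ^ 2 ∂m) ^ (1 / 2 : ℝ) := by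
          gcongr
      _ = _ := by simp
  calc _ ≤ ((∫⁻ y, ENNReal.ofReal (k y) * ‖g y‖ₑ ^ 2 ∂m) ^ (1 / 2 : ℝ)) ^ 2 := by gcongr
    _ = _ := by rw [← ENNReal.rpow_natCast, ← ENNReal.rpow_mul]; norm_num

/-- The constant of the Sobolev inequality `W^{1,2} ⊂ L⁶`. -/
def sobolevConst : ℝ≥0∞ :=
  (eLpNormLESNormFDerivOfEqInnerConst (volume : Measure R3) 2 : ℝ≥0∞) ^ 6

theorem sobolev_smooth {v : R3 → ℝ} (hv : ContDiff ℝ 1 v) (hvc : HasCompactSupport v) :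
    ∫⁻ x, ‖v x‖ₑ ^ 6 ≤ sobolevConst * (∫⁻ x, ‖fderiv ℝ v x‖ₑ ^ 2) ^ 3 := by
  have h := eLpNorm_le_eLpNorm_fderiv_of_eq_inner (volume : Measure R3) hv hvc (p := 2) (p' := 6)
    (by norm_num) (by simp) (by simp; norm_num)
  have h6 := eLpNorm_nnreal_pow_eq_lintegral (f := v) (μ := (volume : Measure R3)) (p := 6)
    (by norm_num)
  have h2 := eLpNorm_nnreal_pow_eq_lintegral (f := fderiv ℝ v) (μ := (volume : Measure R3)) (p := 2)
    (by norm_num)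
  have c6 : ((6 : NNReal) : ℝ) = ((6 : ℕ) : ℝ) := by norm_num
  have c2 : ((2 : NNReal) : ℝ) = ((2 : ℕ) : ℝ) := by norm_num
  simp only [c6, c2, ENNReal.rpow_natCast] at h6 h2
  rw [← h6, ← h2, sobolevConst]
  calc _ ≤ ((eLpNormLESNormFDerivOfEqInnerConst (volume : Measure R3) 2 : ℝ≥0∞) *
        eLpNorm (fderiv ℝ v) (2 : NNReal) volume) ^ 6 := by gcongr; exact h
    _ = _ := by rw [mul_pow, ← pow_mul]

theorem sobolevConst_ne_top : sobolevConst ≠ ⊤ := by simp [sobolevConst]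

/-- Sobolev's inequality for a compactly supported function with a weak gradient. -/
theorem sobolev_weak {v : R3 → ℝ} {g : Fin 3 → R3 → ℝ} (hv : Integrable v)
    (hvc : HasCompactSupport v) (hg : ∀ j, Integrable (g j))
    (hw : ∀ (j : Fin 3) (ψ : R3 → ℝ), ContDiff ℝ ∞ ψ → HasCompactSupport ψ →
      ∫ x, v x * fderiv ℝ ψ x (EuclideanSpace.single j 1) = -∫ x, g j x * ψ x) :
    ∫⁻ x, ‖v x‖ₑ ^ 6 ≤ sobolevConst * (∑ j, ∫⁻ x, ‖g j x‖ₑ ^ 2) ^ 3 := by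
  -- The ratio of outer to inner radius is kept equal to `2`, as almost everywhere convergence of
  -- the mollifications requires a bounded ratio.
  let φ : ℕ → ContDiffBump (0 : R3) := fun n =>
    { rIn := 1 / (n + 1), rOut := 2 / (n + 1), rIn_pos := by positivity,
      rIn_lt_rOut := by gcongr; norm_num }
  set k : ℕ → R3 → ℝ := fun n => (φ n).normed volume with hk
  have hkc : ∀ n, HasCompactSupport (k n) := fun n => (φ n).hasCompactSupport_normed
  have hks : ∀ n, ContDiff ℝ ∞ (k n) := fun n => (φ n).contDiff_normed
  have hk0 : ∀ n x, 0 ≤ k n x := fun n => (φ n).nonneg_normed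
  have hkint : ∀ n, ∫⁻ x, ENNReal.ofReal (k n x) = 1 := by
    intro n
    rw [← ofReal_integral_eq_lintegral_ofReal (φ n).integrable_normed (ae_of_all _ (hk0 n)),
      (φ n).integral_normed]; simp
  set V : ℕ → R3 → ℝ := fun n x => ∫ y, v y • k n (x - y) with hV
  have hVs : ∀ n, ContDiff ℝ ∞ (V n) := fun n => contDiff_conv hv.locallyIntegrable (hks n) (hkc n)
  have hVc : ∀ n, HasCompactSupport (V n) := fun n =>
    HasCompactSupport.convolution (ContinuousLinearMap.lsmul ℝ ℝ) hvc (hkc n)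
  -- The weak derivative passes through the mollifier by taking `k n (x - ·)` as the test function.
  have hVd : ∀ n x j, fderiv ℝ (V n) x (EuclideanSpace.single j 1) = ∫ y, g j y * k n (x - y) := by
    intro n x j
    rw [hV, fderiv_conv_apply hv.locallyIntegrable (hks n) (hkc n)]
    have hψ : ContDiff ℝ ∞ fun y => k n (x - y) := (hks n).comp (contDiff_const.sub contDiff_id)
    have hψc : HasCompactSupport fun y => k n (x - y) :=
      (hkc n).comp_homeomorph (Homeomorph.subLeft x)
    have h := hw j _ hψ hψc
    have e : ∀ y, fderiv ℝ (fun y => k n (x - y)) y (EuclideanSpace.single j 1)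
        = -fderiv ℝ (k n) (x - y) (EuclideanSpace.single j 1) := by
      intro y
      have h1 := ((hks n).differentiable (by simp) (x - y)).hasFDerivAt.comp y
        ((hasFDerivAt_const x y).sub (hasFDerivAt_id y))
      have h2 : fderiv ℝ (fun y => k n (x - y)) y = _ := h1.fderiv
      rw [h2]; simp
    simp only [e, mul_neg, integral_neg, neg_inj] at h
    simpa [smul_eq_mul] using h
  -- Mollification does not increase the `L²` norm of the gradient: Jensen at each point, then
  -- Tonelli. The bound is uniform in `n`, so Fatou concludes.
  have hVg : ∀ n, ∫⁻ x, ‖fderiv ℝ (V n) x‖ₑ ^ 2 ≤ ∑ j, ∫⁻ x, ‖g j x‖ₑ ^ 2 := by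
    intro n
    have h1 : ∀ x, ‖fderiv ℝ (V n) x‖ₑ ^ 2 ≤
        ∑ j, ∫⁻ y, ENNReal.ofReal (k n (x - y)) * ‖g j y‖ₑ ^ 2 := by
      intro x
      have h2 : ‖fderiv ℝ (V n) x‖ₑ ^ 2 ≤
          ∑ j, ‖fderiv ℝ (V n) x (EuclideanSpace.single j 1)‖ₑ ^ 2 := by
        have := ENNReal.ofReal_le_ofReal (sq_norm_clm_le (fderiv ℝ (V n) x))
        rw [ENNReal.ofReal_sum_of_nonneg (fun _ _ => sq_nonneg _)] at this
        rw [← ofReal_norm, ← ENNReal.ofReal_pow (norm_nonneg _)]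
        refine this.trans (le_of_eq (Finset.sum_congr rfl fun j _ => ?_))
        rw [← ofReal_norm, ← ENNReal.ofReal_pow (norm_nonneg _), Real.norm_eq_abs, sq_abs]
      refine h2.trans (Finset.sum_le_sum fun j _ => ?_)
      rw [hVd]
      apply enorm_integral_sq_le
      · exact ((hks n).continuous.comp (continuous_const.sub continuous_id)).measurable.aemeasurable
      · exact (hg j).aemeasurable
      · rw [lintegral_sub_left_eq_self (fun y => ENNReal.ofReal (k n y)) x, hkint]
      · intro y; exact hk0 _ _
    have hkm := (hks n).continuous.measurable
    have hA : ∀ j, AEMeasurable (fun p : R3 × R3 => ENNReal.ofReal (k n (p.1 - p.2)) *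
        ‖g j p.2‖ₑ ^ 2) (volume.prod volume) := by
      intro j
      have := (hg j).aemeasurable.comp_snd (μ := (volume : Measure R3))
      fun_prop
    calc _ ≤ ∫⁻ x, ∑ j, ∫⁻ y, ENNReal.ofReal (k n (x - y)) * ‖g j y‖ₑ ^ 2 := lintegral_mono h1
      _ = ∑ j, ∫⁻ x, ∫⁻ y, ENNReal.ofReal (k n (x - y)) * ‖g j y‖ₑ ^ 2 :=
          lintegral_finsetSum' _ fun j _ => (hA j).lintegral_prod_right'
      _ ≤ _ := by
          refine Finset.sum_le_sum fun j _ => ?_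
          rw [lintegral_lintegral_swap (hA j)]
          apply lintegral_mono
          intro y
          dsimp only
          rw [lintegral_mul_const _ (by fun_prop),
            lintegral_sub_right_eq_self (fun x => ENNReal.ofReal (k n x)) y, hkint, one_mul]
  have hlim : ∀ᵐ x, Tendsto (fun n => V n x) atTop (𝓝 (v x)) := by
    have h1 : Tendsto (fun n => (φ n).rOut) atTop (𝓝 0) := by
      have := (tendsto_one_div_add_atTop_nhds_zero_nat (𝕜 := ℝ)).const_mul 2
      simpa [φ, div_eq_mul_inv] using this
    have h2 : ∀ᶠ n in atTop, (φ n).rOut ≤ 2 * (φ n).rIn := by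
      refine Eventually.of_forall fun n => le_of_eq ?_
      simp only [φ]; ring
    have := ContDiffBump.ae_convolution_tendsto_right_of_locallyIntegrable (μ := volume) h1 h2
      hv.locallyIntegrable
    filter_upwards [this] with x hx
    refine hx.congr fun n => ?_
    rw [convolution_eq_swap]
    simp [hV, hk, mul_comm]
  have hfat : ∫⁻ x, ‖v x‖ₑ ^ 6 ≤ liminf (fun n => ∫⁻ x, ‖V n x‖ₑ ^ 6) atTop := by
    calc _ = ∫⁻ x, liminf (fun n => ‖V n x‖ₑ ^ 6) atTop := by
          apply lintegral_congr_ae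
          filter_upwards [hlim] with x hx
          exact ((ENNReal.continuous_pow 6).tendsto _ |>.comp
            (continuous_enorm.tendsto _ |>.comp hx)).liminf_eq.symm
      _ ≤ _ := lintegral_liminf_le fun n => by
          have := (hVs n).continuous.measurable
          fun_prop
  refine hfat.trans (liminf_le_of_le (by isBoundedDefault) ?_)
  intro b hb
  obtain ⟨n, hn⟩ := hb.exists
  refine hn.trans ((sobolev_smooth ((hVs n).of_le (by simp)) (hVc n)).trans ?_)
  gcongr
  exact hVg n

theorem integrable_mul_of_locallyIntegrableOn {Ω : Set R3} {a f : R3 → ℝ}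
    (ha : Continuous a) (hac : HasCompactSupport a) (hs : tsupport a ⊆ Ω)
    (hf : LocallyIntegrableOn f Ω) : Integrable fun x => a x * f x := by
  have h1 : IntegrableOn f (tsupport a) := hf.integrableOn_compact_subset hs hac
  have h2 : IntegrableOn (fun x => a x * f x) (tsupport a) :=
    h1.continuousOn_mul ha.continuousOn hac
  rwa [integrableOn_iff_integrable_of_support_subset] at h2
  intro x hx
  apply subset_tsupport
  intro h0
  exact hx (by simp [h0])

theorem setIntegral_eq_of_tsupport {Ω : Set R3} {a f : R3 → ℝ} (hs : tsupport a ⊆ Ω)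
    (h : ∀ x, a x = 0 → f x = 0) : ∫ x in Ω, f x = ∫ x, f x := by
  apply setIntegral_eq_integral_of_forall_compl_eq_zero
  intro x hx
  apply h
  by_contra h0
  exact hx (hs (subset_tsupport a h0))

/-- The product `φ wᵢ`, extended by zero, has a weak gradient on all of space given by the Leibniz
rule; this follows by testing the weak gradient of `w` with `φψ`. No regularity of `Ω` is needed. -/
theorem sobolev_cutoff_component {Ω : Set R3} {φ : R3 → ℝ}
    (hφ : IsTestFunction Ω φ) {w : R3 → R3} {G : R3 → Matrix (Fin 3) (Fin 3) ℝ}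
    (hG : IsWeakGradient Ω w G) (i : Fin 3) :
    ∫⁻ x, ‖φ x * w x i‖ₑ ^ 6 ≤ sobolevConst * (∑ j, ∫⁻ x, ‖φ x * G x i j
      + fderiv ℝ φ x (EuclideanSpace.single j 1) * w x i‖ₑ ^ 2) ^ 3 := by
  obtain ⟨hφs, hφc, hφΩ⟩ := hφ
  obtain ⟨hw, hGi, hweak⟩ := hG
  have hwi : LocallyIntegrableOn (fun x => w x i) Ω := by
    intro x hx
    obtain ⟨s, hs, hi⟩ := hw x hx
    exact ⟨s, hs, (EuclideanSpace.proj (𝕜 := ℝ) i).integrable_comp hi⟩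
  have hd : ∀ j, Continuous fun x => fderiv ℝ φ x (EuclideanSpace.single j 1) := fun j =>
    (hφs.continuous_fderiv (by simp)).clm_apply continuous_const
  have hdc : ∀ j, HasCompactSupport fun x => fderiv ℝ φ x (EuclideanSpace.single j 1) :=
    fun j => hφc.fderiv_apply ℝ _
  have hdΩ : ∀ j, tsupport (fun x => fderiv ℝ φ x (EuclideanSpace.single j 1)) ⊆ Ω :=
    fun j => (tsupport_fderiv_apply_subset ℝ _).trans hφΩ
  have i1 := integrable_mul_of_locallyIntegrableOn hφs.continuous hφc hφΩ hwi
  have i2 := fun j => integrable_mul_of_locallyIntegrableOn hφs.continuous hφc hφΩ (hGi i j)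
  have i3 := fun j => integrable_mul_of_locallyIntegrableOn (hd j) (hdc j) (hdΩ j) hwi
  refine sobolev_weak i1 hφc.mul_right (fun j => (i2 j).add (i3 j)) ?_
  intro j ψ hψ hψc
  have hψd : Continuous fun x => fderiv ℝ ψ x (EuclideanSpace.single j 1) :=
    (hψ.continuous_fderiv (by simp)).clm_apply continuous_const
  have hψdc : HasCompactSupport fun x => fderiv ℝ ψ x (EuclideanSpace.single j 1) :=
    hψc.fderiv_apply ℝ _
  have htest : IsTestFunction Ω fun x => φ x * ψ x :=
    ⟨hφs.mul hψ, hφc.mul_right, (tsupport_mul_subset_left).trans hφΩ⟩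
  have h := hweak i j _ htest
  have e1 : ∀ x, fderiv ℝ (fun x => φ x * ψ x) x (EuclideanSpace.single j 1)
      = φ x * fderiv ℝ ψ x (EuclideanSpace.single j 1)
        + ψ x * fderiv ℝ φ x (EuclideanSpace.single j 1) := by
    intro x
    rw [fderiv_fun_mul (hφs.differentiable (by simp) x) (hψ.differentiable (by simp) x)]
    simp
  simp only [e1] at h
  have s1 : ∫ x in Ω, w x i * (φ x * fderiv ℝ ψ x (EuclideanSpace.single j 1)
        + ψ x * fderiv ℝ φ x (EuclideanSpace.single j 1))
      = ∫ x, w x i * (φ x * fderiv ℝ ψ x (EuclideanSpace.single j 1)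
        + ψ x * fderiv ℝ φ x (EuclideanSpace.single j 1)) := by
    apply setIntegral_eq_integral_of_forall_compl_eq_zero
    intro x hx
    have h1 : φ x = 0 := by
      by_contra h0; exact hx (hφΩ (subset_tsupport _ h0))
    have h2 : fderiv ℝ φ x (EuclideanSpace.single j 1) = 0 := by
      by_contra h0; exact hx (hdΩ j (subset_tsupport _ h0))
    simp [h1, h2]
  have s2 : ∫ x in Ω, G x i j * (φ x * ψ x) = ∫ x, G x i j * (φ x * ψ x) :=
    setIntegral_eq_of_tsupport hφΩ fun x h0 => by simp [h0]
  rw [s1, s2] at h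
  have bdd : ∀ {a : R3 → ℝ}, Continuous a → HasCompactSupport a → ∀ {f : R3 → ℝ}, Integrable f →
      Integrable fun x => f x * a x := by
    intro a ha hac f hf
    obtain ⟨C, hC⟩ := hac.exists_bound_of_continuous ha
    exact hf.mul_bdd ha.aestronglyMeasurable (ae_of_all _ hC)
  have j1 := bdd hψd hψdc i1
  have j2 := bdd hψ.continuous hψc (i2 j)
  have j3 := bdd hψ.continuous hψc (i3 j)
  have e2 : ∫ x, w x i * (φ x * fderiv ℝ ψ x (EuclideanSpace.single j 1)
        + ψ x * fderiv ℝ φ x (EuclideanSpace.single j 1))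
      = (∫ x, φ x * w x i * fderiv ℝ ψ x (EuclideanSpace.single j 1))
        + ∫ x, fderiv ℝ φ x (EuclideanSpace.single j 1) * w x i * ψ x := by
    rw [← integral_add j1 j3]
    congr 1; ext x; ring
  have e3 : ∫ x, (φ x * G x i j + fderiv ℝ φ x (EuclideanSpace.single j 1) * w x i) * ψ x
      = (∫ x, φ x * G x i j * ψ x)
        + ∫ x, fderiv ℝ φ x (EuclideanSpace.single j 1) * w x i * ψ x := by
    rw [← integral_add j2 j3]
    congr 1; ext x; ring
  have e4 : ∫ x, G x i j * (φ x * ψ x) = ∫ x, φ x * G x i j * ψ x := by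
    congr 1; ext x; ring
  rw [e2, e4] at h
  simp only
  rw [e3]
  linarith

/-- Local Sobolev inequality for a vector field with a weak gradient in `Ω`. -/
theorem sobolev_cutoff {Ω : Set R3} {φ : R3 → ℝ}
    (hφ : IsTestFunction Ω φ) {w : R3 → R3} {G : R3 → Matrix (Fin 3) (Fin 3) ℝ}
    (hG : IsWeakGradient Ω w G) {M : ℝ} (hM : ∀ x, |φ x| ≤ M)
    (hM' : ∀ x j, |fderiv ℝ φ x (EuclideanSpace.single j 1)| ≤ M) :
    ∫⁻ x in Ω, ENNReal.ofReal ((φ x ^ 2 * ‖w x‖ ^ 2) ^ 3)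
      ≤ 27 * sobolevConst * (ENNReal.ofReal (6 * M ^ 2) *
        ∫⁻ x in Ω, ENNReal.ofReal (‖w x‖ ^ 2 + contract (G x) (G x))) ^ 3 := by
  set I := ∫⁻ x in Ω, ENNReal.ofReal (‖w x‖ ^ 2 + contract (G x) (G x)) with hI
  have hφ' := hφ
  obtain ⟨hφs, hφc, hφΩ⟩ := hφ
  have hwm : AEStronglyMeasurable w (volume.restrict Ω) := hG.1.aestronglyMeasurable
  have hwim : ∀ i, AEMeasurable (fun x => w x i) (volume.restrict Ω) := fun i =>
    ((EuclideanSpace.proj (𝕜 := ℝ) i).continuous.comp_aestronglyMeasurable hwm).aemeasurable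
  have hGm : ∀ i j, AEMeasurable (fun x => G x i j) (volume.restrict Ω) := fun i j =>
    (hG.2.1 i j).aestronglyMeasurable.aemeasurable
  have hd : ∀ j, Continuous fun x => fderiv ℝ φ x (EuclideanSpace.single j 1) := fun j =>
    (hφs.continuous_fderiv (by simp)).clm_apply continuous_const
  have hdm := fun j => (hd j).measurable
  have hφm := hφs.continuous.measurable
  have hsum : ∀ i, ∑ j, ∫⁻ x, ‖φ x * G x i j
      + fderiv ℝ φ x (EuclideanSpace.single j 1) * w x i‖ₑ ^ 2
      ≤ ENNReal.ofReal (6 * M ^ 2) * I := by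
    intro i
    have h1 : ∀ j, ∫⁻ x, ‖φ x * G x i j
        + fderiv ℝ φ x (EuclideanSpace.single j 1) * w x i‖ₑ ^ 2
        = ∫⁻ x in Ω, ‖φ x * G x i j
          + fderiv ℝ φ x (EuclideanSpace.single j 1) * w x i‖ₑ ^ 2 := by
      intro j
      symm
      apply setLIntegral_eq_of_support_subset
      intro x hx
      by_contra hxΩ
      have h1 : φ x = 0 := by
        by_contra h0; exact hxΩ (hφΩ (subset_tsupport _ h0))
      have h2 : fderiv ℝ φ x (EuclideanSpace.single j 1) = 0 := by
        by_contra h0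
        exact hxΩ (hφΩ (tsupport_fderiv_apply_subset ℝ _ (subset_tsupport _ h0)))
      exact hx (by simp [h1, h2])
    simp only [h1]
    rw [← lintegral_finsetSum' _ fun j _ => by fun_prop (disch := assumption), hI,
      ← lintegral_const_mul' _ _ ENNReal.ofReal_ne_top]
    apply lintegral_mono
    intro x
    have h2 : ∀ j, ‖φ x * G x i j + fderiv ℝ φ x (EuclideanSpace.single j 1) * w x i‖ₑ ^ 2
        = ENNReal.ofReal ((φ x * G x i j
          + fderiv ℝ φ x (EuclideanSpace.single j 1) * w x i) ^ 2) := by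
      intro j
      rw [← ofReal_norm, ← ENNReal.ofReal_pow (norm_nonneg _), Real.norm_eq_abs, sq_abs]
    simp only [h2]
    rw [← ENNReal.ofReal_sum_of_nonneg (fun _ _ => sq_nonneg _),
      ← ENNReal.ofReal_mul (by positivity)]
    apply ENNReal.ofReal_le_ofReal
    have h3 : ∀ j, (φ x * G x i j + fderiv ℝ φ x (EuclideanSpace.single j 1) * w x i) ^ 2
        ≤ 2 * M ^ 2 * (G x i j ^ 2 + w x i ^ 2) := by
      intro j
      have a1 : φ x ^ 2 ≤ M ^ 2 := sq_le_sq' (abs_le.1 (hM x)).1 (abs_le.1 (hM x)).2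
      have a2 : fderiv ℝ φ x (EuclideanSpace.single j 1) ^ 2 ≤ M ^ 2 :=
        sq_le_sq' (abs_le.1 (hM' x j)).1 (abs_le.1 (hM' x j)).2
      have a3 := mul_le_mul_of_nonneg_right a1 (sq_nonneg (G x i j))
      have a4 := mul_le_mul_of_nonneg_right a2 (sq_nonneg (w x i))
      nlinarith [sq_nonneg (φ x * G x i j - fderiv ℝ φ x (EuclideanSpace.single j 1) * w x i)]
    refine (Finset.sum_le_sum fun j _ => h3 j).trans ?_
    rw [← Finset.mul_sum, Finset.sum_add_distrib]
    have a5 : ∑ j, G x i j ^ 2 ≤ contract (G x) (G x) := by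
      unfold contract
      simp only [← sq]
      exact Finset.single_le_sum (f := fun i => ∑ j, G x i j ^ 2)
        (fun i _ => Finset.sum_nonneg fun _ _ => sq_nonneg _) (Finset.mem_univ i)
    have a6 : w x i ^ 2 ≤ ‖w x‖ ^ 2 := by
      rw [EuclideanSpace.real_norm_sq_eq]
      exact Finset.single_le_sum (f := fun i => w x i ^ 2) (fun i _ => sq_nonneg _)
        (Finset.mem_univ i)
    have a7 : 0 ≤ contract (G x) (G x) := by
      unfold contract
      exact Finset.sum_nonneg fun i _ => Finset.sum_nonneg fun j _ => mul_self_nonneg _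
    have a8 : ∑ j : Fin 3, w x i ^ 2 = 3 * w x i ^ 2 := by simp
    rw [a8]
    nlinarith [sq_nonneg M]
  have hi : ∀ i, ∫⁻ x, ‖φ x * w x i‖ₑ ^ 6 ≤ sobolevConst * (ENNReal.ofReal (6 * M ^ 2) * I) ^ 3 :=
    fun i => (sobolev_cutoff_component hφ' hG i).trans (by gcongr; exact hsum i)
  have hpt : ∀ x, ENNReal.ofReal ((φ x ^ 2 * ‖w x‖ ^ 2) ^ 3) ≤ 9 * ∑ i, ‖φ x * w x i‖ₑ ^ 6 := by
    intro x
    have h2 : ∀ i, ‖φ x * w x i‖ₑ ^ 6 = ENNReal.ofReal ((φ x ^ 2 * w x i ^ 2) ^ 3) := by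
      intro i
      rw [← ofReal_norm, ← ENNReal.ofReal_pow (norm_nonneg _), Real.norm_eq_abs, ← mul_pow, ← pow_mul,
        show 6 = 2 * 3 by norm_num, pow_mul, sq_abs, ← pow_mul]
    simp only [h2]
    rw [← ENNReal.ofReal_sum_of_nonneg (fun _ _ => by positivity),
      show (9 : ℝ≥0∞) = ENNReal.ofReal 9 by simp, ← ENNReal.ofReal_mul (by norm_num)]
    apply ENNReal.ofReal_le_ofReal
    rw [EuclideanSpace.real_norm_sq_eq, Finset.mul_sum]
    -- Convexity of the cube. Summing three equal component bounds afterwards gives the factor `27`.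
    have key : ∀ a b c : ℝ, 0 ≤ a → 0 ≤ b → 0 ≤ c →
        (a + b + c) ^ 3 ≤ 9 * (a ^ 3 + b ^ 3 + c ^ 3) := by
      intro a b c ha hb hc
      nlinarith [mul_nonneg ha (sq_nonneg (a - b)), mul_nonneg hb (sq_nonneg (a - b)),
        mul_nonneg ha (sq_nonneg (a - c)), mul_nonneg hc (sq_nonneg (a - c)),
        mul_nonneg hb (sq_nonneg (b - c)), mul_nonneg hc (sq_nonneg (b - c)),
        mul_nonneg ha (sq_nonneg (b - c)), mul_nonneg hb (sq_nonneg (a - c)),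
        mul_nonneg hc (sq_nonneg (a - b))]
    rw [Fin.sum_univ_three, Fin.sum_univ_three]
    exact key _ _ _ (by positivity) (by positivity) (by positivity)
  calc _ ≤ ∫⁻ x in Ω, 9 * ∑ i, ‖φ x * w x i‖ₑ ^ 6 := lintegral_mono hpt
    _ = 9 * ∑ i, ∫⁻ x in Ω, ‖φ x * w x i‖ₑ ^ 6 := by
        rw [lintegral_const_mul' _ _ (by simp), lintegral_finsetSum']
        intro i _
        have := hwim i
        fun_prop
    _ ≤ 9 * ∑ i : Fin 3, sobolevConst * (ENNReal.ofReal (6 * M ^ 2) * I) ^ 3 := by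
        gcongr with i
        exact (setLIntegral_le_lintegral _ _).trans (hi i)
    _ = _ := by
        simp only [Finset.sum_const, Finset.card_univ, Fintype.card_fin, nsmul_eq_mul]
        push_cast; ring

end

end CompressibleNS

/-! ### The momentum equation tested with a localised convolution -/

open MeasureTheory Set
open scoped ENNReal ContDiff

namespace CompressibleNS

noncomputable section

/-- Fields satisfying the weak momentum and continuity equations, all of whose
products occurring in the equations are integrable. -/
structure WeakData (Ω : Set R3) (T : ℝ) (ϱ p : R4 → ℝ) (u f : R4 → R3)
    (S : R4 → Matrix (Fin 3) (Fin 3) ℝ) : Prop where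
  int_density : IntegrableOn ϱ (cylinder Ω T)
  int_momentum : ∀ i, IntegrableOn (fun z => ϱ z * u z i) (cylinder Ω T)
  int_convection : ∀ i j, IntegrableOn (fun z => ϱ z * (u z i * u z j)) (cylinder Ω T)
  int_pressure : IntegrableOn p (cylinder Ω T)
  int_stress : ∀ i j, IntegrableOn (fun z => S z i j) (cylinder Ω T)
  int_force : ∀ i, IntegrableOn (fun z => ϱ z * f z i) (cylinder Ω T)
  momentum : ∀ ξ : R4 → R3, IsTestFunction (cylinder Ω T) ξ →
    (∫ z in cylinder Ω T, ϱ z * inner ℝ (u z) (dt ξ z))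
      + (∫ z in cylinder Ω T,
          contract (ϱ z • tensor (u z) (u z)
            + p z • (1 : Matrix (Fin 3) (Fin 3) ℝ) - S z) (grad ξ z))
      + (∫ z in cylinder Ω T, ϱ z * inner ℝ (f z) (ξ z)) = 0
  mass : ∀ ψ : R4 → ℝ, IsTestFunction (cylinder Ω T) ψ →
    ∫ z in cylinder Ω T, (ϱ z * dt ψ z + ∑ j, ϱ z * u z j * dx j ψ z) = 0

/-- The convolution of `a`, restricted to the cylinder, with `K`. -/
def convOn (Ω : Set R3) (T : ℝ) (a K : R4 → ℝ) (z : R4) : ℝ :=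
  ∫ w in cylinder Ω T, a w * K (z - w)

/-- Bounded continuous functions. -/
def IsBddCont {V : Type*} [TopologicalSpace V] (K : V → ℝ) : Prop :=
  Continuous K ∧ ∃ C, ∀ z, |K z| ≤ C

theorem IsBddCont.of_compact {V : Type*} [TopologicalSpace V] {K : V → ℝ} (h : Continuous K)
    (hc : HasCompactSupport K) : IsBddCont K :=
  ⟨h, hc.exists_bound_of_continuous h⟩

theorem IsBddCont.integrable_mul {K b : R4 → ℝ} (hK : IsBddCont K) {m : Measure R4}
    (hb : Integrable b m) : Integrable (fun z => K z * b z) m := by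
  obtain ⟨hc, C, hC⟩ := hK
  exact hb.bdd_mul hc.aestronglyMeasurable (ae_of_all _ hC)

theorem integrable_prod_kernel {m : Measure R4} [SFinite m] {a b K : R4 → ℝ}
    (ha : Integrable a m) (hb : Integrable b m) (hK : IsBddCont K) :
    Integrable (fun q : R4 × R4 => b q.1 * a q.2 * K (q.1 - q.2)) (m.prod m) := by
  obtain ⟨hc, C, hC⟩ := hK
  exact (hb.mul_prod ha).mul_bdd
    (hc.comp (continuous_fst.sub continuous_snd)).aestronglyMeasurable
    (ae_of_all _ fun q => hC _)

theorem integrable_mul_convOn {Ω : Set R3} {T : ℝ} {a b K : R4 → ℝ}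
    (ha : IntegrableOn a (cylinder Ω T)) (hb : IntegrableOn b (cylinder Ω T)) (hK : IsBddCont K) :
    IntegrableOn (fun z => b z * convOn Ω T a K z) (cylinder Ω T) := by
  have h := (integrable_prod_kernel ha hb hK).integral_prod_left
  refine h.congr (ae_of_all _ fun z => ?_)
  simp only [convOn, mul_assoc, integral_const_mul]

theorem integral_mul_convOn {Ω : Set R3} {T : ℝ} {a b K : R4 → ℝ}
    (ha : IntegrableOn a (cylinder Ω T)) (hb : IntegrableOn b (cylinder Ω T)) (hK : IsBddCont K) :
    ∫ z in cylinder Ω T, b z * convOn Ω T a K z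
      = ∫ q : R4 × R4, b q.1 * a q.2 * K (q.1 - q.2)
        ∂((volume.restrict (cylinder Ω T)).prod (volume.restrict (cylinder Ω T))) := by
  rw [integral_prod _ (integrable_prod_kernel ha hb hK)]
  congr 1; ext z
  simp only [convOn, mul_assoc, integral_const_mul]

section Kernel

variable {H : R4 → R3}

theorem isBddCont_apply (hH : ContDiff ℝ ∞ H) (hHc : HasCompactSupport H) (i : Fin 3) :
    IsBddCont fun v => H v i := by
  apply IsBddCont.of_compact
  · have := hH.continuous; fun_prop
  · exact hHc.comp_left (g := fun x : R3 => x i) rfl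

theorem isBddCont_dx (hH : ContDiff ℝ ∞ H) (hHc : HasCompactSupport H) (i j : Fin 3) :
    IsBddCont fun v => dx j H v i := by
  have h1 : Continuous (dx j H) := (hH.continuous_fderiv (by simp)).clm_apply continuous_const
  apply IsBddCont.of_compact
  · fun_prop
  · exact (hHc.fderiv_apply ℝ _).comp_left (g := fun x : R3 => x i) rfl

end Kernel

theorem isBddCont_of_test {U : Set R4} {θ : R4 → ℝ} (hθ : IsTestFunction U θ) : IsBddCont θ :=
  IsBddCont.of_compact hθ.1.continuous hθ.2.1

theorem isBddCont_fderiv {U : Set R4} {θ : R4 → ℝ} (hθ : IsTestFunction U θ) (v : R4) :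
    IsBddCont fun z => fderiv ℝ θ z v :=
  IsBddCont.of_compact ((hθ.1.continuous_fderiv (by simp)).clm_apply continuous_const)
    (hθ.2.1.fderiv_apply ℝ v)

/-- The source of the continuity equation of `θϱ`. -/
def massSource (θ ϱ : R4 → ℝ) (u : R4 → R3) (w : R4) : ℝ :=
  dt θ w * ϱ w + ∑ j, dx j θ w * (ϱ w * u w j)

section Identity

variable {Ω : Set R3} {T : ℝ} {ϱ p : R4 → ℝ} {u f : R4 → R3}
  {S : R4 → Matrix (Fin 3) (Fin 3) ℝ}

theorem WeakData.integrable_massSource (hw : WeakData Ω T ϱ p u f S) {θ : R4 → ℝ}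
    (hθ : IsTestFunction (cylinder Ω T) θ) :
    IntegrableOn (massSource θ ϱ u) (cylinder Ω T) :=
  ((isBddCont_fderiv hθ _).integrable_mul hw.int_density).add
    (integrable_finsetSum _ fun j _ => (isBddCont_fderiv hθ _).integrable_mul (hw.int_momentum j))

/-- The continuity equation turns the time derivative of the kernel into spatial ones. -/
theorem WeakData.convOn_dt (hw : WeakData Ω T ϱ p u f S) {θ : R4 → ℝ}
    (hθ : IsTestFunction (cylinder Ω T) θ) {H : R4 → R3} (hH : ContDiff ℝ ∞ H)
    (hHc : HasCompactSupport H) (i : Fin 3) (z : R4) :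
    convOn Ω T (fun w => θ w * ϱ w) (fun v => dt H v i) z
      = convOn Ω T (massSource θ ϱ u) (fun v => H v i) z
        - ∑ j, convOn Ω T (fun w => θ w * (ϱ w * u w j)) (fun v => dx j H v i) z := by
  have hHi : ContDiff ℝ ∞ fun v => H v i := by fun_prop
  have hHd : ∀ w v, fderiv ℝ (fun w => H (z - w) i) w v = -(fderiv ℝ H (z - w) v) i := by
    intro w v
    have h1 := (hH.differentiable (by simp) (z - w)).hasFDerivAt.comp w
        ((hasFDerivAt_const z w).sub (hasFDerivAt_id w))
    have h2 := ((EuclideanSpace.proj (𝕜 := ℝ) i).hasFDerivAt).comp w h1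
    have h3 : fderiv ℝ (fun w => H (z - w) i) w = _ := h2.fderiv
    rw [h3]; simp
  have hψs : ContDiff ℝ ∞ fun w => H (z - w) i := hHi.comp (contDiff_const.sub contDiff_id)
  -- With `z` frozen, the kernel seen from `z` is multiplied by the cut-off; this is the test
  -- function in the continuity equation. The derivatives of `θ` become the source term.
  have htest : IsTestFunction (cylinder Ω T) fun w => θ w * H (z - w) i :=
    ⟨hθ.1.mul hψs, hθ.2.1.mul_right, (tsupport_mul_subset_left).trans hθ.2.2⟩
  have hm := hw.mass _ htest
  have hd : ∀ w v, fderiv ℝ (fun w => θ w * H (z - w) i) w v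
      = fderiv ℝ θ w v * H (z - w) i - θ w * (fderiv ℝ H (z - w) v) i := by
    intro w v
    rw [fderiv_fun_mul (hθ.1.differentiable (by simp) w) (hψs.differentiable (by simp) w)]
    simp [hHd]; ring
  have bT : IsBddCont fun v => dt H v i := by
    have h1 : Continuous (dt H) := (hH.continuous_fderiv (by simp)).clm_apply continuous_const
    exact IsBddCont.of_compact (by fun_prop)
      ((hHc.fderiv_apply ℝ _).comp_left (g := fun x : R3 => x i) rfl)
  have shift : ∀ {K : R4 → ℝ}, IsBddCont K → IsBddCont fun w => K (z - w) := fun hK =>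
    ⟨hK.1.comp (continuous_const.sub continuous_id), hK.2.imp fun C hC w => hC _⟩
  have mulr : ∀ {K b : R4 → ℝ}, IsBddCont K → IntegrableOn b (cylinder Ω T) →
      IntegrableOn (fun w => b w * K (z - w)) (cylinder Ω T) := fun hK hb =>
    ((shift hK).integrable_mul hb).congr (ae_of_all _ fun w => mul_comm _ _)
  have i1 := mulr (isBddCont_apply hH hHc i) (hw.integrable_massSource hθ)
  have i2 := fun j => mulr (isBddCont_dx hH hHc i j)
    ((isBddCont_of_test hθ).integrable_mul (hw.int_momentum j))
  have i3 := mulr bT ((isBddCont_of_test hθ).integrable_mul hw.int_density)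
  have e : ∀ w, ϱ w * dt (fun w => θ w * H (z - w) i) w
      + ∑ j, ϱ w * u w j * dx j (fun w => θ w * H (z - w) i) w
      = massSource θ ϱ u w * H (z - w) i - θ w * ϱ w * dt H (z - w) i
        - ∑ j, θ w * (ϱ w * u w j) * dx j H (z - w) i := by
    intro w
    simp only [dt, dx, hd, massSource, Fin.sum_univ_three]
    ring
  simp only [e] at hm
  rw [integral_sub (f := fun w => massSource θ ϱ u w * H (z - w) i - θ w * ϱ w * dt H (z - w) i)
    (i1.sub i3) (integrable_finsetSum _ fun j _ => i2 j), integral_sub i1 i3,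
    integral_finsetSum _ fun j _ => i2 j] at hm
  simp only [convOn]
  linarith

/-- The principal part of the tested momentum equation. -/
def mainTerm (Ω : Set R3) (T : ℝ) (θ ϱ p : R4 → ℝ) (u : R4 → R3) (K : Fin 3 → Fin 3 → R4 → ℝ)
    (z : R4) : ℝ :=
  (∑ i, ∑ j, (θ z * (ϱ z * (u z i * u z j)) * convOn Ω T (fun w => θ w * ϱ w) (K i j) z
    - θ z * (ϱ z * u z i) * convOn Ω T (fun w => θ w * (ϱ w * u w j)) (K i j) z))
    + ∑ i, θ z * p z * convOn Ω T (fun w => θ w * ϱ w) (K i i) z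

/-- The total flux `ϱ u ⊗ u + p I - S`. -/
def flux (ϱ p : R4 → ℝ) (u : R4 → R3) (S : R4 → Matrix (Fin 3) (Fin 3) ℝ) (i j : Fin 3)
    (z : R4) : ℝ :=
  ϱ z * (u z i * u z j) + (if i = j then p z else 0) - S z i j

/-- The lower order part of the tested momentum equation. -/
def errTerm (Ω : Set R3) (T : ℝ) (θ ϱ p : R4 → ℝ) (u f : R4 → R3)
    (S : R4 → Matrix (Fin 3) (Fin 3) ℝ) (H : R4 → R3) (z : R4) : ℝ :=
  (∑ i, (dt θ z * (ϱ z * u z i) + θ z * (ϱ z * f z i)) *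
      convOn Ω T (fun w => θ w * ϱ w) (fun v => H v i) z)
  + (∑ i, θ z * (ϱ z * u z i) * convOn Ω T (massSource θ ϱ u) (fun v => H v i) z)
  + (∑ i, ∑ j, dx j θ z * flux ϱ p u S i j z *
      convOn Ω T (fun w => θ w * ϱ w) (fun v => H v i) z)
  - ∑ i, ∑ j, θ z * S z i j * convOn Ω T (fun w => θ w * ϱ w) (fun v => dx j H v i) z

theorem WeakData.integrable_flux (hw : WeakData Ω T ϱ p u f S) (i j : Fin 3) :
    IntegrableOn (flux ϱ p u S i j) (cylinder Ω T) := by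
  refine ((hw.int_convection i j).add ?_).sub (hw.int_stress i j)
  by_cases h : i = j
  · simpa [h] using hw.int_pressure
  · simp [h]

theorem WeakData.integrable_errTerm (hw : WeakData Ω T ϱ p u f S) {θ : R4 → ℝ}
    (hθ : IsTestFunction (cylinder Ω T) θ) {H : R4 → R3} (hH : ContDiff ℝ ∞ H)
    (hHc : HasCompactSupport H) : IntegrableOn (errTerm Ω T θ ϱ p u f S H) (cylinder Ω T) := by
  have bθ := isBddCont_of_test hθ
  have ig := bθ.integrable_mul hw.int_density
  have iR := hw.integrable_massSource hθ
  have bH := fun i => isBddCont_apply hH hHc i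
  have bK := fun i j => isBddCont_dx hH hHc i j
  refine (((integrable_finsetSum _ fun i _ => integrable_mul_convOn ig ?_ (bH i)).add
    (integrable_finsetSum _ fun i _ => integrable_mul_convOn iR ?_ (bH i))).add
    (integrable_finsetSum _ fun i _ => integrable_finsetSum _ fun j _ =>
      integrable_mul_convOn ig ?_ (bH i))).sub
    (integrable_finsetSum _ fun i _ => integrable_finsetSum _ fun j _ =>
      integrable_mul_convOn ig ?_ (bK i j))
  · exact ((isBddCont_fderiv hθ _).integrable_mul (hw.int_momentum i)).add
      (bθ.integrable_mul (hw.int_force i))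
  · exact bθ.integrable_mul (hw.int_momentum i)
  · exact (isBddCont_fderiv hθ _).integrable_mul (hw.integrable_flux i j)
  · exact bθ.integrable_mul (hw.int_stress i j)

/-- The test field is `θ W` with `W` the convolution of `θϱ` with `H`. Derivatives that hit the
outer `θ`, the force, the stress and the source of the continuity equation go into `errTerm`; what
remains contains first derivatives of `H` against convection and pressure. -/
theorem WeakData.tested_momentum (hw : WeakData Ω T ϱ p u f S) (hΩ : MeasurableSet Ω) {θ : R4 → ℝ}
    (hθ : IsTestFunction (cylinder Ω T) θ) {H : R4 → R3} (hH : ContDiff ℝ ∞ H)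
    (hHc : HasCompactSupport H) :
    ∫ z in cylinder Ω T, (mainTerm Ω T θ ϱ p u (fun i j v => dx j H v i) z
      + errTerm Ω T θ ϱ p u f S H z) = 0 := by
  have hQ : MeasurableSet (cylinder Ω T) := hΩ.prod measurableSet_Ioo
  have hθ0 : ∀ z, z ∉ cylinder Ω T → θ z = 0 := fun z hz => by
    by_contra h0; exact hz (hθ.2.2 (subset_tsupport _ h0))
  set g : R4 → ℝ := fun w => θ w * ϱ w with hg
  have ig : IntegrableOn g (cylinder Ω T) := (isBddCont_of_test hθ).integrable_mul hw.int_density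
  have ig' : Integrable g := by
    have := ig
    rwa [integrableOn_iff_integrable_of_support_subset] at this
    intro z hz
    by_contra h0
    exact hz (by simp [hg, hθ0 z h0])
  set W : R4 → R3 := fun z => ∫ w, g w • H (z - w) with hW
  have : (volume : Measure R4).IsAddLeftInvariant :=
    inferInstanceAs ((volume : Measure R3).prod (volume : Measure ℝ)).IsAddLeftInvariant
  have hWs : ContDiff ℝ ∞ W := contDiff_conv ig'.locallyIntegrable hH hHc
  have iH : ∀ (v z : R4), Integrable fun w => g w • fderiv ℝ H (z - w) v := by
    intro v z
    have hc : Continuous fun w => fderiv ℝ H (z - w) v :=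
      ((hH.continuous_fderiv (by simp)).clm_apply continuous_const).comp
        (continuous_const.sub continuous_id)
    obtain ⟨C, hC⟩ := (hHc.fderiv_apply ℝ v).exists_bound_of_continuous
      ((hH.continuous_fderiv (by simp)).clm_apply continuous_const)
    exact ig'.smul_bdd C hc.aestronglyMeasurable (ae_of_all _ fun w => hC _)
  have iH0 : ∀ z : R4, Integrable fun w => g w • H (z - w) := by
    intro z
    have hc : Continuous fun w => H (z - w) := hH.continuous.comp (continuous_const.sub continuous_id)
    obtain ⟨C, hC⟩ := hHc.exists_bound_of_continuous hH.continuous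
    exact ig'.smul_bdd C hc.aestronglyMeasurable (ae_of_all _ fun w => hC _)
  have hset : ∀ F : R4 → ℝ, (∀ w, w ∉ cylinder Ω T → F w = 0) →
      ∫ w in cylinder Ω T, F w = ∫ w, F w := fun F hF =>
    setIntegral_eq_integral_of_forall_compl_eq_zero hF
  have hg0 : ∀ z, z ∉ cylinder Ω T → g z = 0 := fun z hz => by simp [hg, hθ0 z hz]
  have hWi : ∀ z i, W z i = convOn Ω T g (fun v => H v i) z := by
    intro z i
    have := (EuclideanSpace.proj (𝕜 := ℝ) i).integral_comp_comm (iH0 z)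
    simp only [PiLp.proj_apply, PiLp.smul_apply, smul_eq_mul] at this
    rw [convOn, hset _ fun w hw0 => by rw [hg0 w hw0, zero_mul], this]
  have hDW : ∀ z v i, (fderiv ℝ W z v) i = convOn Ω T g (fun y => (fderiv ℝ H y v) i) z := by
    intro z v i
    have := (EuclideanSpace.proj (𝕜 := ℝ) i).integral_comp_comm (iH v z)
    simp only [PiLp.proj_apply, PiLp.smul_apply, smul_eq_mul] at this
    rw [convOn, hset _ fun w hw0 => by rw [hg0 w hw0, zero_mul], this, hW,
      fderiv_conv_apply ig'.locallyIntegrable hH hHc]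
  have htest : IsTestFunction (cylinder Ω T) fun z => θ z • W z :=
    ⟨hθ.1.smul hWs, hθ.2.1.smul_right, (tsupport_smul_subset_left _ _).trans hθ.2.2⟩
  have hd : ∀ z v i, (fderiv ℝ (fun z => θ z • W z) z v) i
      = fderiv ℝ θ z v * W z i + θ z * (fderiv ℝ W z v) i := by
    intro z v i
    rw [fderiv_fun_smul (hθ.1.differentiable (by simp) z) (hWs.differentiable (by simp) z)]
    simp; ring
  have hm := hw.momentum _ htest
  have bθ := isBddCont_of_test hθ
  have iR := hw.integrable_massSource hθ
  have iN := fun j => bθ.integrable_mul (hw.int_momentum j)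
  have bH := fun i => isBddCont_apply hH hHc i
  have bK := fun i j => isBddCont_dx hH hHc i j
  set A1 : R4 → ℝ := fun z => ∑ i, ((dt θ z * (ϱ z * u z i)) * convOn Ω T g (fun v => H v i) z
    + (θ z * (ϱ z * u z i) * convOn Ω T (massSource θ ϱ u) (fun v => H v i) z
      - ∑ j, θ z * (ϱ z * u z i) * convOn Ω T (fun w => θ w * (ϱ w * u w j))
          (fun v => dx j H v i) z)) with hA1
  set A2 : R4 → ℝ := fun z => ∑ i, ∑ j, (dx j θ z * flux ϱ p u S i j z *
      convOn Ω T g (fun v => H v i) z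
      + θ z * flux ϱ p u S i j z * convOn Ω T g (fun v => dx j H v i) z) with hA2
  set A3 : R4 → ℝ := fun z => ∑ i, θ z * (ϱ z * f z i) * convOn Ω T g (fun v => H v i) z with hA3
  have j1 : IntegrableOn A1 (cylinder Ω T) := by
    refine integrable_finsetSum _ fun i _ => ?_
    refine (integrable_mul_convOn ig ?_ (bH i)).add
      ((integrable_mul_convOn iR (iN i) (bH i)).sub
        (integrable_finsetSum _ fun j _ => integrable_mul_convOn (iN j) (iN i) (bK i j)))
    exact (isBddCont_fderiv hθ _).integrable_mul (hw.int_momentum i)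
  have j2 : IntegrableOn A2 (cylinder Ω T) := by
    refine integrable_finsetSum _ fun i _ => integrable_finsetSum _ fun j _ => ?_
    refine (integrable_mul_convOn ig ?_ (bH i)).add (integrable_mul_convOn ig ?_ (bK i j))
    · exact (isBddCont_fderiv hθ _).integrable_mul (hw.integrable_flux i j)
    · exact bθ.integrable_mul (hw.integrable_flux i j)
  have j3 : IntegrableOn A3 (cylinder Ω T) :=
    integrable_finsetSum _ fun i _ => integrable_mul_convOn ig
      (bθ.integrable_mul (hw.int_force i)) (bH i)
  have e1 : ∀ z, ϱ z * inner ℝ (u z) (dt (fun z => θ z • W z) z) = A1 z := by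
    intro z
    have hdt : ∀ i, (fderiv ℝ W z (0, 1)) i
        = convOn Ω T (massSource θ ϱ u) (fun v => H v i) z
        - ∑ j, convOn Ω T (fun w => θ w * (ϱ w * u w j)) (fun v => dx j H v i) z := fun i => by
      rw [hDW]; exact hw.convOn_dt hθ hH hHc i z
    simp only [hA1, dt, PiLp.inner_apply, hd, hdt, hWi, Fin.sum_univ_three]
    simp
    ring
  have e2 : ∀ z, contract (ϱ z • tensor (u z) (u z)
            + p z • (1 : Matrix (Fin 3) (Fin 3) ℝ) - S z) (grad (fun z => θ z • W z) z) = A2 z := by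
    intro z
    simp only [hA2, contract, grad, dx, Matrix.of_apply, hd, hWi, hDW, tensor, flux]
    refine Finset.sum_congr rfl fun i _ => Finset.sum_congr rfl fun j _ => ?_
    simp only [Matrix.sub_apply, Matrix.add_apply, Matrix.smul_apply, Matrix.of_apply,
      Matrix.one_apply, smul_eq_mul, mul_ite, mul_one, mul_zero]
    ring
  have e3 : ∀ z, ϱ z * inner ℝ (f z) (θ z • W z) = A3 z := by
    intro z
    simp only [hA3, PiLp.inner_apply, PiLp.smul_apply, hWi, Fin.sum_univ_three]
    simp
    ring
  simp only [e1, e2, e3] at hm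
  rw [← integral_add j1 j2, ← integral_add (f := fun z => A1 z + A2 z) (j1.add j2) j3] at hm
  rw [← hm]
  congr 1; ext z
  simp only [hA1, hA2, hA3, mainTerm, errTerm, flux]
  simp only [Fin.sum_univ_three]
  simp
  ring

theorem WeakData.integrable_mainTerm (hw : WeakData Ω T ϱ p u f S) {θ : R4 → ℝ}
    (hθ : IsTestFunction (cylinder Ω T) θ) {K : Fin 3 → Fin 3 → R4 → ℝ}
    (hK : ∀ i j, IsBddCont (K i j)) : IntegrableOn (mainTerm Ω T θ ϱ p u K) (cylinder Ω T) := by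
  have bθ := isBddCont_of_test hθ
  have ig := bθ.integrable_mul hw.int_density
  have iN := fun j => bθ.integrable_mul (hw.int_momentum j)
  refine (integrable_finsetSum _ fun i _ => integrable_finsetSum _ fun j _ => ?_).add
    (integrable_finsetSum _ fun i _ => ?_)
  · exact (integrable_mul_convOn ig (bθ.integrable_mul (hw.int_convection i j)) (hK i j)).sub
      (integrable_mul_convOn (iN j) (iN i) (hK i j))
  · exact integrable_mul_convOn ig (bθ.integrable_mul hw.int_pressure) (hK i i)

/-- The symmetrised density of the principal part. -/
def symDensity (θ ϱ p : R4 → ℝ) (u : R4 → R3) (K : Fin 3 → Fin 3 → R4 → ℝ) (q : R4 × R4) : ℝ :=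
  1 / 2 * (θ q.1 * ϱ q.1 * (θ q.2 * ϱ q.2) *
    ∑ i, ∑ j, K i j (q.1 - q.2) * ((u q.1 i - u q.2 i) * (u q.1 j - u q.2 j)))
    + θ q.1 * p q.1 * (θ q.2 * ϱ q.2) * ∑ i, K i i (q.1 - q.2)

/-- Averaging the double integral with its image under exchange of the two points completes the
square in the velocities: the four products `uᵢuⱼ`, `-uᵢu'ⱼ`, `-u'ᵢuⱼ`, `u'ᵢu'ⱼ` combine into `(u -
u')ᵢ(u - u')ⱼ`. Only evenness of `K` is needed, not its symmetry in `i`, `j`. -/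
theorem WeakData.integral_mainTerm (hw : WeakData Ω T ϱ p u f S) {θ : R4 → ℝ}
    (hθ : IsTestFunction (cylinder Ω T) θ) {K : Fin 3 → Fin 3 → R4 → ℝ}
    (hK : ∀ i j, IsBddCont (K i j)) (hKe : ∀ i j z, K i j (-z) = K i j z) :
    Integrable (symDensity θ ϱ p u K)
      ((volume.restrict (cylinder Ω T)).prod (volume.restrict (cylinder Ω T))) ∧
    ∫ z in cylinder Ω T, mainTerm Ω T θ ϱ p u K z
      = ∫ q, symDensity θ ϱ p u K q
        ∂((volume.restrict (cylinder Ω T)).prod (volume.restrict (cylinder Ω T))) := by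
  have bθ := isBddCont_of_test hθ
  have ig := bθ.integrable_mul hw.int_density
  have iN := fun j => bθ.integrable_mul (hw.int_momentum j)
  have iC := fun i j => bθ.integrable_mul (hw.int_convection i j)
  have iP := bθ.integrable_mul hw.int_pressure
  set m := volume.restrict (cylinder Ω T)
  set M1 : R4 × R4 → ℝ := fun q => ∑ i, ∑ j,
    (θ q.1 * (ϱ q.1 * (u q.1 i * u q.1 j)) * (θ q.2 * ϱ q.2) * K i j (q.1 - q.2)
      - θ q.1 * (ϱ q.1 * u q.1 i) * (θ q.2 * (ϱ q.2 * u q.2 j)) * K i j (q.1 - q.2)) with hM1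
  set M2 : R4 × R4 → ℝ := fun q => ∑ i, θ q.1 * p q.1 * (θ q.2 * ϱ q.2) * K i i (q.1 - q.2)
    with hM2
  have a1 := fun i j => integrable_prod_kernel ig (iC i j) (hK i j)
  have a2 := fun i j => integrable_prod_kernel (iN j) (iN i) (hK i j)
  have a3 := fun i => integrable_prod_kernel ig iP (hK i i)
  have j1 : Integrable M1 (m.prod m) := integrable_finsetSum _ fun i _ =>
    integrable_finsetSum _ fun j _ => (a1 i j).sub (a2 i j)
  have j2 : Integrable M2 (m.prod m) := integrable_finsetSum _ fun i _ => a3 i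
  have hsym : ∀ q, symDensity θ ϱ p u K q = 1 / 2 * (M1 q + M1 q.swap) + M2 q := by
    intro q
    have : ∀ i j, K i j (q.2 - q.1) = K i j (q.1 - q.2) := fun i j => by
      rw [← hKe, neg_sub]
    simp only [symDensity, hM1, hM2, Prod.fst_swap, Prod.snd_swap, this, Fin.sum_univ_three]
    ring
  have hswap : Integrable (fun q => M1 q.swap) (m.prod m) := j1.swap
  have hint : Integrable (symDensity θ ϱ p u K) (m.prod m) := by
    rw [funext hsym]
    exact ((j1.add hswap).const_mul _).add j2
  refine ⟨hint, ?_⟩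
  have h1 : ∫ q, symDensity θ ϱ p u K q ∂(m.prod m)
      = (∫ q, M1 q ∂(m.prod m)) + ∫ q, M2 q ∂(m.prod m) := by
    simp only [hsym]
    rw [integral_add (f := fun q => 1 / 2 * (M1 q + M1 q.swap)) ((j1.add hswap).const_mul _) j2,
      integral_const_mul, integral_add j1 hswap,
      integral_prod_swap M1]
    ring
  rw [h1]
  simp only [mainTerm, hM1, hM2]
  rw [integral_add, integral_finsetSum, integral_finsetSum, integral_finsetSum,
    integral_finsetSum]
  · congr 1
    · refine Finset.sum_congr rfl fun i _ => ?_
      rw [integral_finsetSum, integral_finsetSum]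
      · refine Finset.sum_congr rfl fun j _ => ?_
        rw [integral_sub (a1 i j) (a2 i j), integral_sub, integral_mul_convOn ig (iC i j) (hK i j),
          integral_mul_convOn (iN j) (iN i) (hK i j)]
        · exact integrable_mul_convOn ig (iC i j) (hK i j)
        · exact integrable_mul_convOn (iN j) (iN i) (hK i j)
      · exact fun j _ => (a1 i j).sub (a2 i j)
      · exact fun j _ => (integrable_mul_convOn ig (iC i j) (hK i j)).sub
          (integrable_mul_convOn (iN j) (iN i) (hK i j))
    · exact Finset.sum_congr rfl fun i _ => integral_mul_convOn ig iP (hK i i)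
  · exact fun i _ => a3 i
  · exact fun i _ => integrable_finsetSum _ fun j _ => (a1 i j).sub (a2 i j)
  · exact fun i _ => integrable_mul_convOn ig iP (hK i i)
  · exact fun i _ => integrable_finsetSum _ fun j _ =>
      (integrable_mul_convOn ig (iC i j) (hK i j)).sub
          (integrable_mul_convOn (iN j) (iN i) (hK i j))
  · exact integrable_finsetSum _ fun i _ => integrable_finsetSum _ fun j _ =>
      (integrable_mul_convOn ig (iC i j) (hK i j)).sub
          (integrable_mul_convOn (iN j) (iN i) (hK i j))
  · exact integrable_finsetSum _ fun i _ => integrable_mul_convOn ig iP (hK i i)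

end Identity

end

end CompressibleNS

/-! ### The concrete test kernel and the potential inequality -/

open MeasureTheory Set
open scoped ENNReal ContDiff

namespace CompressibleNS

noncomputable section

open scoped Topology

/-- A cut-off in space which equals one on the ball of radius `R`. -/
def spaceBump {R : ℝ} (hR : 0 < R) : ContDiffBump (0 : R3) :=
  { rIn := R, rOut := R + 1, rIn_pos := hR, rIn_lt_rOut := by linarith }

/-- The space-time kernel of the test field. -/
def testKernel {R : ℝ} (hR : 0 < R) (η : ℝ → ℝ) (δ : ℝ) (z : R4) : R3 :=
  (spaceBump hR z.1 * η z.2) • hker δ z.1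

theorem contDiff_testKernel {R : ℝ} (hR : 0 < R) {η : ℝ → ℝ} (hη : IsMollifier η) {δ : ℝ}
    (hδ : 0 < δ) : ContDiff ℝ ∞ (testKernel hR η δ) :=
  (((spaceBump hR).contDiff.comp contDiff_fst).mul (hη.contDiff.comp contDiff_snd)).smul
    ((contDiff_hker hδ).comp contDiff_fst)

theorem hasCompactSupport_testKernel {R : ℝ} (hR : 0 < R) {η : ℝ → ℝ} (hη : IsMollifier η)
    (δ : ℝ) : HasCompactSupport (testKernel hR η δ) := by
  refine HasCompactSupport.intro
    ((spaceBump hR).hasCompactSupport.isCompact.prod hη.compact.isCompact) ?_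
  intro z hz
  unfold testKernel
  by_cases h1 : z.1 ∈ tsupport (spaceBump hR)
  · have h2 : z.2 ∉ tsupport η := fun h2 => hz ⟨h1, h2⟩
    simp [image_eq_zero_of_notMem_tsupport h2]
  · simp [image_eq_zero_of_notMem_tsupport h1]

theorem testKernel_neg {R : ℝ} (hR : 0 < R) {η : ℝ → ℝ} (hη : IsMollifier η) (δ : ℝ) (z : R4) :
    testKernel hR η δ (-z) = -testKernel hR η δ z := by
  simp [testKernel, hker, hη.even, (spaceBump hR).neg]

/-- The derivative of an odd field is even, which is the hypothesis of the symmetrisation. -/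
theorem dx_testKernel_neg {R : ℝ} (hR : 0 < R) {η : ℝ → ℝ} (hη : IsMollifier η) {δ : ℝ}
    (hδ : 0 < δ) (j : Fin 3) (z : R4) :
    dx j (testKernel hR η δ) (-z) = dx j (testKernel hR η δ) z := by
  have hd := (contDiff_testKernel hR hη hδ).differentiable (by simp)
  have h1 : HasFDerivAt (fun y => testKernel hR η δ (-y)) _ z :=
    (hd (-z)).hasFDerivAt.comp z (hasFDerivAt_id z).neg
  have h2 : HasFDerivAt (fun y => testKernel hR η δ (-y)) (-fderiv ℝ (testKernel hR η δ) z) z := by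
    have := (hd z).hasFDerivAt.neg
    simpa only [testKernel_neg hR hη] using! this
  have h3 := h1.unique h2
  have h4 := congrArg (fun A => A (EuclideanSpace.single j 1, 0)) h3
  simp only [ContinuousLinearMap.comp_apply, neg_apply,
    ContinuousLinearMap.id_apply, map_neg, neg_inj] at h4
  exact h4

/-- The spatial bump exists only to give the kernel compact support: it equals one on all
differences of points of `Ω`, so it disappears from every estimate. -/
theorem testKernel_of_lt {R : ℝ} (hR : 0 < R) (η : ℝ → ℝ) (δ : ℝ) {z : R4} (hz : ‖z.1‖ < R) :
    testKernel hR η δ z = η z.2 • hker δ z.1 := by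
  have : spaceBump hR z.1 = 1 := (spaceBump hR).one_of_mem_closedBall
    (by simpa [spaceBump] using hz.le)
  simp [testKernel, this]

theorem dx_testKernel_of_lt {R : ℝ} (hR : 0 < R) {η : ℝ → ℝ} (hη : IsMollifier η) {δ : ℝ}
    (hδ : 0 < δ) {z : R4} (hz : ‖z.1‖ < R) (i j : Fin 3) :
    dx j (testKernel hR η δ) z i = hJac δ z.1 i j * η z.2 := by
  have he : testKernel hR η δ =ᶠ[𝓝 z] fun z => η z.2 • hker δ z.1 := by
    have : {z : R4 | ‖z.1‖ < R} ∈ 𝓝 z :=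
      (isOpen_lt (by fun_prop) continuous_const).mem_nhds hz
    filter_upwards [this] with y hy using testKernel_of_lt hR η δ hy
  have h1 : HasFDerivAt (fun z : R4 => η z.2) _ z :=
    (hη.contDiff.differentiable (by simp) z.2).hasFDerivAt.comp z hasFDerivAt_snd
  have h2 : HasFDerivAt (fun z : R4 => hker δ z.1) _ z :=
    ((contDiff_hker hδ).differentiable (by simp) z.1).hasFDerivAt.comp z hasFDerivAt_fst
  have h3 := (h1.smul h2).fderiv
  have h4 : fderiv ℝ (fun z : R4 => η z.2 • hker δ z.1) z = _ := h3
  unfold dx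
  rw [he.fderiv_eq, h4]
  simp [← fderiv_hker hδ, mul_comm]

theorem continuous_kbKer {δ : ℝ} (hδ : 0 < δ) : Continuous (kbKer δ) :=
  contDiffOn_kb.continuousOn.comp_continuous (by fun_prop) fun x => sq_add_sq_pos hδ x

theorem continuous_kcKer {δ : ℝ} (hδ : 0 < δ) : Continuous (kcKer δ) := by
  have h1 : ContinuousOn kc (Ioi 0) := by
    have h2 : ContinuousOn ell (Ioi 0) := fun s hs => (hasDerivAt_ell hs).continuousAt.continuousWithinAt
    have h3 : ContinuousOn (fun s => kb s / ell s) (Ioi 0) :=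
      contDiffOn_kb.continuousOn.div h2 fun s hs => (ell_pos hs).ne'
    refine h3.congr fun s hs => ?_
    change kc s = kb s / ell s
    rw [kb_eq_ell_mul_kc hs, mul_div_cancel_left₀ _ (ell_pos hs).ne']
  exact h1.comp_continuous (by fun_prop) fun x => sq_add_sq_pos hδ x

theorem isBddCont_kernel {η : ℝ → ℝ} (hη : IsMollifier η) {k : R3 → ℝ} (hk : Continuous k)
    (hk0 : ∀ x, 0 < k x) {B : ℝ} (hB : ∀ x, k x ≤ B) :
    IsBddCont fun v : R4 => k v.1 * η v.2 := by
  have hc := hη.contDiff.continuous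
  refine ⟨by fun_prop, ?_⟩
  obtain ⟨C, hC⟩ := hη.compact.exists_bound_of_continuous hc
  refine ⟨B * C, fun z => ?_⟩
  rw [abs_mul, abs_of_pos (hk0 _)]
  exact mul_le_mul (hB _) (hC _) (abs_nonneg _) ((hk0 z.1).le.trans (hB _))

/-- Passage from extended nonnegative integrals to a finite real double integral, where the signed
identity for the principal part can be used. -/
theorem lintegral_mul_pot_eq {Ω : Set R3} {T : ℝ} {η : ℝ → ℝ} (hη : IsMollifier η)
    {k : R3 → ℝ} (hk : Continuous k) (hk0 : ∀ x, 0 < k x) {B : ℝ} (hB : ∀ x, k x ≤ B)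
    {b g : R4 → ℝ} (hb : Measurable b) (hb0 : ∀ z, 0 ≤ b z) (hg : Measurable g)
    (hg0 : ∀ z, 0 ≤ g z) (ib : IntegrableOn b (cylinder Ω T)) (ig : IntegrableOn g (cylinder Ω T)) :
    ∫⁻ z in cylinder Ω T, ENNReal.ofReal (b z) * pot Ω T η k g z
      = ENNReal.ofReal (∫ q : R4 × R4, b q.1 * g q.2 * (k (q.1 - q.2).1 * η (q.1 - q.2).2)
        ∂((volume.restrict (cylinder Ω T)).prod (volume.restrict (cylinder Ω T)))) := by
  have hηm := hη.measurable
  have hkm := hk.measurable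
  rw [ofReal_integral_eq_lintegral_ofReal
    (integrable_prod_kernel ig ib (isBddCont_kernel hη hk hk0 hB))
    (ae_of_all _ fun q => mul_nonneg (mul_nonneg (hb0 _) (hg0 _))
      (mul_nonneg (hk0 _).le (hη.nonneg _))), lintegral_prod _ (by fun_prop)]
  congr 1; ext z
  unfold pot
  rw [← lintegral_const_mul _ (by fun_prop)]
  congr 1; ext w
  rw [← ENNReal.ofReal_mul (mul_nonneg (hg0 w) (hk0 _).le), ← ENNReal.ofReal_mul (hb0 z)]
  congr 1
  simp only [Prod.fst_sub, Prod.snd_sub]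
  ring

/-- The pointwise lower bound of the symmetrised density. -/
theorem symDensity_ge {Ω : Set R3} {T R : ℝ} (hR0 : 0 < R)
    (hR : ∀ x ∈ Ω, ∀ y ∈ Ω, ‖x - y‖ < R)
    {η : ℝ → ℝ} (hη : IsMollifier η) {δ : ℝ} (hδ : 0 < δ) {θ ϱ p : R4 → ℝ} (u : R4 → R3)
    (hθ : ∀ z, 0 ≤ θ z) (hϱ : ∀ z, 0 ≤ ϱ z) (hp : ∀ z, 0 ≤ p z) {q : R4 × R4}
    (h1 : q.1 ∈ cylinder Ω T) (h2 : q.2 ∈ cylinder Ω T) :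
    θ q.1 * p q.1 * (θ q.2 * ϱ q.2) * (kbKer δ (q.1 - q.2).1 * η (q.1 - q.2).2)
      ≤ symDensity θ ϱ p u (fun i j v => dx j (testKernel hR0 η δ) v i) q
        + 8 / 3 * (θ q.1 * ϱ q.1 * ‖u q.1‖ ^ 2 * (θ q.2 * ϱ q.2)
            * (kcKer δ (q.1 - q.2).1 * η (q.1 - q.2).2)
          + θ q.2 * ϱ q.2 * ‖u q.2‖ ^ 2 * (θ q.1 * ϱ q.1)
            * (kcKer δ (q.1 - q.2).1 * η (q.1 - q.2).2)) := by
  have hlt : ‖(q.1 - q.2).1‖ < R := hR _ h1.1 _ h2.1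
  unfold symDensity
  simp only [dx_testKernel_of_lt hR0 hη hδ hlt]
  set v := (q.1 - q.2).1
  set e := η (q.1 - q.2).2
  have he : 0 ≤ e := hη.nonneg _
  have a1 := hθ q.1
  have a2 := hϱ q.1
  have a3 := hp q.1
  have a4 := hθ q.2
  have a5 := hϱ q.2
  have k1 := hJac_quadratic hδ v (u q.1 - u q.2)
  have k2 := sum_hJac_diag hδ v
  have k3 := kcKer_pos hδ v
  have s1 : ∑ i, ∑ j, hJac δ v i j * e * ((u q.1 i - u q.2 i) * (u q.1 j - u q.2 j))
      = e * ∑ i, ∑ j, hJac δ v i j * ((u q.1 - u q.2) i * (u q.1 - u q.2) j) := by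
    simp only [Fin.sum_univ_three, PiLp.sub_apply]; ring
  have s2 : ∑ i, hJac δ v i i * e = e * ∑ i, hJac δ v i i := by
    simp only [Fin.sum_univ_three]; ring
  rw [s1, s2]
  -- The velocity difference is not exploited in the bad term; the lost logarithm is enough to treat
  -- both velocities separately.
  have n1 : ‖u q.1 - u q.2‖ ^ 2 ≤ 2 * (‖u q.1‖ ^ 2 + ‖u q.2‖ ^ 2) := by
    have := norm_sub_le (u q.1) (u q.2)
    nlinarith [norm_nonneg (u q.1 - u q.2), sq_nonneg (‖u q.1‖ - ‖u q.2‖)]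
  have k1' : -(16 / 3) * kcKer δ v * (‖u q.1‖ ^ 2 + ‖u q.2‖ ^ 2)
      ≤ ∑ i, ∑ j, hJac δ v i j * ((u q.1 - u q.2) i * (u q.1 - u q.2) j) := by
    have := mul_le_mul_of_nonneg_left n1 k3.le
    unfold kcKer at *
    linarith
  have m1 := mul_le_mul_of_nonneg_left k1'
    (by positivity : 0 ≤ 1 / 2 * (θ q.1 * ϱ q.1 * (θ q.2 * ϱ q.2)) * e)
  have m2 := mul_le_mul_of_nonneg_left k2
    (by positivity : 0 ≤ θ q.1 * p q.1 * (θ q.2 * ϱ q.2) * e)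
  unfold kbKer
  linarith

/-- The potential estimate in terms of the remainder and of the lower order potential. -/
theorem lintegral_pressure_mul_pot_le {Ω : Set R3} (hΩ : MeasurableSet Ω) {T E R : ℝ}
    (hR0 : 0 < R) (hR : ∀ x ∈ Ω, ∀ y ∈ Ω, ‖x - y‖ < R)
    {ϱ p : R4 → ℝ} {u f : R4 → R3} {S : R4 → Matrix (Fin 3) (Fin 3) ℝ}
    (hE : EnergyBounds Ω T E ϱ p u) (hw : WeakData Ω T ϱ p u f S)
    {θ : R4 → ℝ} (hθ : IsTestFunction (cylinder Ω T) θ) (hθ0 : ∀ z, 0 ≤ θ z)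
    {η : ℝ → ℝ} (hη : IsMollifier η) {δ : ℝ} (hδ : 0 < δ) {C : ℝ≥0∞} (hC : C ≠ ⊤)
    (herr : ∫⁻ z in cylinder Ω T, ‖errTerm Ω T θ ϱ p u f S (testKernel hR0 η δ) z‖ₑ ≤ C) :
    ∫⁻ z in cylinder Ω T, ENNReal.ofReal (θ z * p z) * pot Ω T η (kbKer δ) (fun z => θ z * ϱ z) z
      ≤ C + ENNReal.ofReal (16 / 3) *
        ∫⁻ z in cylinder Ω T, ENNReal.ofReal (θ z * ϱ z * ‖u z‖ ^ 2)
          * pot Ω T η (kcKer δ) (fun z => θ z * ϱ z) z := by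
  have hm1 := hE.meas_density
  have hm2 := hE.meas_pressure
  have hm3 := hE.meas_velocity
  have hθm := hθ.1.continuous.measurable
  have bθ := isBddCont_of_test hθ
  have ig := bθ.integrable_mul hw.int_density
  have ip := bθ.integrable_mul hw.int_pressure
  have iu : IntegrableOn (fun z => θ z * ϱ z * ‖u z‖ ^ 2) (cylinder Ω T) := by
    have h1 : IntegrableOn (fun z => θ z * ∑ i, ϱ z * (u z i * u z i)) (cylinder Ω T) :=
      bθ.integrable_mul (integrable_finsetSum _ fun i _ => hw.int_convection i i)
    refine h1.congr (ae_of_all _ fun z => ?_)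
    simp only [EuclideanSpace.real_norm_sq_eq, Fin.sum_univ_three]; ring
  have hg0 : ∀ z, 0 ≤ θ z * ϱ z := fun z => mul_nonneg (hθ0 z) (hE.density_nonneg z)
  have hp0 : ∀ z, 0 ≤ θ z * p z := fun z => mul_nonneg (hθ0 z) (hE.pressure_nonneg z)
  have hu0 : ∀ z, 0 ≤ θ z * ϱ z * ‖u z‖ ^ 2 := fun z => mul_nonneg (hg0 z) (sq_nonneg _)
  rw [lintegral_mul_pot_eq hη (continuous_kbKer hδ) (kbKer_pos hδ) (kbKer_le hδ) (by fun_prop) hp0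
      (by fun_prop) hg0 ip ig,
    lintegral_mul_pot_eq hη (continuous_kcKer hδ) (kcKer_pos hδ) (kcKer_le hδ) (by fun_prop) hu0
      (by fun_prop) hg0 iu ig, ← ENNReal.ofReal_mul (by norm_num)]
  have hH := contDiff_testKernel hR0 hη hδ
  have hHc := hasCompactSupport_testKernel hR0 hη δ
  have bK := fun i j => isBddCont_dx hH hHc i j
  obtain ⟨isym, hsym⟩ := hw.integral_mainTerm hθ bK
    (fun i j z => by rw [dx_testKernel_neg hR0 hη hδ])
  have imain := hw.integrable_mainTerm hθ bK
  have hid := hw.tested_momentum hΩ hθ hH hHc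
  set m := volume.restrict (cylinder Ω T) with hm
  have hmain : ∫ z, mainTerm Ω T θ ϱ p u (fun i j v => dx j (testKernel hR0 η δ) v i) z ∂m
      ≤ C.toReal := by
    -- The principal part is minus the remainder, so a bound on the absolute remainder is all that
    -- is needed.
    rw [integral_add imain (hw.integrable_errTerm hθ hH hHc)] at hid
    have h1 : ‖∫ z, errTerm Ω T θ ϱ p u f S (testKernel hR0 η δ) z ∂m‖ₑ ≤ C :=
      (enorm_integral_le_lintegral_enorm _).trans herr
    have h2 := ENNReal.toReal_mono hC h1
    rw [toReal_enorm, Real.norm_eq_abs] at h2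
    linarith [neg_abs_le (∫ z, errTerm Ω T θ ϱ p u f S (testKernel hR0 η δ) z ∂m)]
  set F1 : R4 × R4 → ℝ := fun q => θ q.1 * ϱ q.1 * ‖u q.1‖ ^ 2 * (θ q.2 * ϱ q.2)
            * (kcKer δ (q.1 - q.2).1 * η (q.1 - q.2).2) with hF1
  have iF1 : Integrable F1 (m.prod m) := integrable_prod_kernel ig iu
    (isBddCont_kernel hη (continuous_kcKer hδ) (kcKer_pos hδ) (kcKer_le hδ))
  have iF2 : Integrable (fun q => F1 q.swap) (m.prod m) := iF1.swap
  have hF2 : ∀ q : R4 × R4, F1 q.swap = θ q.2 * ϱ q.2 * ‖u q.2‖ ^ 2 * (θ q.1 * ϱ q.1)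
            * (kcKer δ (q.1 - q.2).1 * η (q.1 - q.2).2) := by
    intro q
    have h1 : kcKer δ (q.2 - q.1).1 = kcKer δ (q.1 - q.2).1 := by
      simp only [kcKer, Prod.fst_sub, norm_sub_rev]
    have h2 : η (q.2 - q.1).2 = η (q.1 - q.2).2 := by
      rw [← hη.even, Prod.snd_sub, Prod.snd_sub, neg_sub]
    simp only [hF1, Prod.fst_swap, Prod.snd_swap, h1, h2]
  have hmem : ∀ᵐ q ∂(m.prod m), q ∈ cylinder Ω T ×ˢ cylinder Ω T := by
    have hQ : MeasurableSet (cylinder Ω T) := hΩ.prod measurableSet_Ioo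
    rw [hm, Measure.prod_restrict]
    exact ae_restrict_mem (hQ.prod hQ)
  -- The two kinetic terms have equal integrals by exchange symmetry, which doubles `8/3` to `16/3`.
  have hle : ∫ q : R4 × R4, θ q.1 * p q.1 * (θ q.2 * ϱ q.2)
        * (kbKer δ (q.1 - q.2).1 * η (q.1 - q.2).2) ∂(m.prod m)
      ≤ (∫ q, symDensity θ ϱ p u (fun i j v => dx j (testKernel hR0 η δ) v i) q ∂(m.prod m))
        + 8 / 3 * ((∫ q, F1 q ∂(m.prod m)) + ∫ q, F1 q ∂(m.prod m)) := by
    calc _ ≤ ∫ q, (symDensity θ ϱ p u (fun i j v => dx j (testKernel hR0 η δ) v i) q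
          + 8 / 3 * (F1 q + F1 q.swap)) ∂(m.prod m) := by
          refine integral_mono_ae (integrable_prod_kernel ig ip
            (isBddCont_kernel hη (continuous_kbKer hδ) (kbKer_pos hδ) (kbKer_le hδ)))
            (isym.add ((iF1.add iF2).const_mul _)) ?_
          filter_upwards [hmem] with q hq
          rw [hF2]
          exact symDensity_ge hR0 hR hη hδ u hθ0 hE.density_nonneg hE.pressure_nonneg hq.1 hq.2
      _ = _ := by
          rw [integral_add (g := fun q => 8 / 3 * (F1 q + F1 q.swap)) isym
            ((iF1.add iF2).const_mul _), integral_const_mul,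
            integral_add iF1 iF2, integral_prod_swap F1]
  have hfin : ∫ q : R4 × R4, θ q.1 * p q.1 * (θ q.2 * ϱ q.2)
        * (kbKer δ (q.1 - q.2).1 * η (q.1 - q.2).2) ∂(m.prod m)
      ≤ C.toReal + 16 / 3 * ∫ q, F1 q ∂(m.prod m) := by
    rw [hsym] at hmain
    linarith
  refine (ENNReal.ofReal_le_ofReal hfin).trans (ENNReal.ofReal_add_le.trans ?_)
  rw [ENNReal.ofReal_toReal hC]

/-! ### Bounds for the lower order terms -/

theorem fieldConst_nonneg {V E R : ℝ} (hV : 0 ≤ V) (hE : 0 ≤ E) : 0 ≤ fieldConst V E R := by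
  have := polarConst_nonneg
  unfold fieldConst; positivity

theorem abs_convOn_testKernel_le {Ω : Set R3} (hΩ : MeasurableSet Ω) {T E R : ℝ}
    (hR0 : 0 < R) (hR : ∀ x ∈ Ω, ∀ y ∈ Ω, ‖x - y‖ < R) (hV : volume Ω ≠ ⊤)
    {ϱ p : R4 → ℝ} {u : R4 → R3} (hE : EnergyBounds Ω T E ϱ p u)
    {η : ℝ → ℝ} (hη : IsMollifier η) {δ : ℝ} (hδ : 0 < δ) {a : R4 → ℝ} {A : ℝ} (hA : 0 ≤ A)
    (ha : ∀ w, |a w| ≤ A * (ϱ w * (1 + ‖u w‖))) (i : Fin 3) {z : R4} (hz : z ∈ cylinder Ω T) :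
    |convOn Ω T a (fun v => testKernel hR0 η δ v i) z|
      ≤ A * fieldConst (volume Ω).toReal E R := by
  have hm1 := hE.meas_density
  have hm3 := hE.meas_velocity
  have hηm := hη.measurable
  have hkm := (contDiff_hker hδ).continuous
  have hf := fieldConst_nonneg (R := R) (ENNReal.toReal_nonneg (a := volume Ω)) hE.nonneg
  have h1 : ‖convOn Ω T a (fun v => testKernel hR0 η δ v i) z‖ₑ
      ≤ ENNReal.ofReal (A * fieldConst (volume Ω).toReal E R) := by
    unfold convOn
    refine (enorm_integral_le_lintegral_enorm _).trans ?_
    calc _ ≤ ∫⁻ w in cylinder Ω T, ENNReal.ofReal A *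
          (ENNReal.ofReal (ϱ w * (1 + ‖u w‖) * ‖hker δ (z.1 - w.1)‖)
            * ENNReal.ofReal (η (z.2 - w.2))) := by
          refine lintegral_mono_ae ?_
          have hmem : ∀ᵐ w ∂(volume.restrict (cylinder Ω T)), w ∈ cylinder Ω T :=
            ae_restrict_mem (hΩ.prod measurableSet_Ioo)
          filter_upwards [hmem] with w hw
          have h0 := hE.density_nonneg w
          have h2 := hη.nonneg (z.2 - w.2)
          rw [testKernel_of_lt hR0 η δ (z := z - w) (hR _ hz.1 _ hw.1),
            ← ENNReal.ofReal_mul (by positivity), ← ENNReal.ofReal_mul (by positivity),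
            ← ofReal_norm]
          apply ENNReal.ofReal_le_ofReal
          rw [Real.norm_eq_abs, abs_mul, PiLp.smul_apply, smul_eq_mul, abs_mul, Prod.fst_sub,
            Prod.snd_sub, abs_of_nonneg h2]
          have h3 : |hker δ (z.1 - w.1) i| ≤ ‖hker δ (z.1 - w.1)‖ := PiLp.norm_apply_le (hker δ (z.1 - w.1)) i
          calc _ ≤ A * (ϱ w * (1 + ‖u w‖)) * (η (z.2 - w.2) * ‖hker δ (z.1 - w.1)‖) :=
                mul_le_mul (ha w) (mul_le_mul_of_nonneg_left h3 h2) (by positivity) (by positivity)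
            _ = _ := by ring
      _ ≤ _ := by
          rw [lintegral_const_mul _ (by fun_prop), ENNReal.ofReal_mul hA]
          gcongr
          exact lintegral_hker_le hΩ hR0 hV hE hη hδ (fun y hy => hR _ hz.1 _ hy)
  rw [← ofReal_norm, Real.norm_eq_abs] at h1
  exact (ENNReal.ofReal_le_ofReal_iff (by positivity)).1 h1

/-- Differentiated fields are not bounded, but they are controlled by the scalar potential; this
occurs only in the stress term. -/
theorem enorm_convOn_dx_testKernel_le {Ω : Set R3} (hΩ : MeasurableSet Ω) {T R : ℝ}
    (hR0 : 0 < R) (hR : ∀ x ∈ Ω, ∀ y ∈ Ω, ‖x - y‖ < R)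
    {η : ℝ → ℝ} (hη : IsMollifier η) {δ : ℝ} (hδ : 0 < δ) {g : R4 → ℝ} (hg : Measurable g)
    (hg0 : ∀ w, 0 ≤ g w) (i j : Fin 3) {z : R4} (hz : z ∈ cylinder Ω T) :
    ‖convOn Ω T g (fun v => dx j (testKernel hR0 η δ) v i) z‖ₑ
      ≤ ENNReal.ofReal 3 * pot Ω T η (kbKer δ) g z := by
  have hηm := hη.measurable
  have hkm := measurable_kbKer δ
  unfold convOn pot
  refine (enorm_integral_le_lintegral_enorm _).trans ?_
  rw [← lintegral_const_mul _ (by fun_prop)]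
  refine lintegral_mono_ae ?_
  have hmem : ∀ᵐ w ∂(volume.restrict (cylinder Ω T)), w ∈ cylinder Ω T :=
    ae_restrict_mem (hΩ.prod measurableSet_Ioo)
  filter_upwards [hmem] with w hw
  have h0 := hg0 w
  have h2 := hη.nonneg (z.2 - w.2)
  have h4 := (kbKer_pos hδ (z.1 - w.1)).le
  rw [dx_testKernel_of_lt hR0 hη hδ (z := z - w) (hR _ hz.1 _ hw.1),
    ← ENNReal.ofReal_mul (by positivity), ← ENNReal.ofReal_mul (by positivity), ← ofReal_norm]
  apply ENNReal.ofReal_le_ofReal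
  rw [Real.norm_eq_abs, abs_mul, abs_mul, Prod.fst_sub, Prod.snd_sub, abs_of_nonneg h2,
    abs_of_nonneg h0]
  have h3 := abs_hJac_le hδ (z.1 - w.1) i j
  calc _ ≤ g w * (3 * kb (‖z.1 - w.1‖ ^ 2 + δ ^ 2) * η (z.2 - w.2)) := by gcongr
    _ = _ := by unfold kbKer; ring

/-- The Frobenius bound of a stress component. -/
theorem sq_entry_le_contract (A : Matrix (Fin 3) (Fin 3) ℝ) (i j : Fin 3) :
    A i j ^ 2 ≤ contract A A := by
  unfold contract
  simp only [← sq]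
  calc A i j ^ 2 ≤ ∑ j, A i j ^ 2 :=
        Finset.single_le_sum (f := fun j => A i j ^ 2) (fun _ _ => sq_nonneg _) (Finset.mem_univ j)
    _ ≤ _ := Finset.single_le_sum (f := fun i => ∑ j, A i j ^ 2)
        (fun _ _ => Finset.sum_nonneg fun _ _ => sq_nonneg _) (Finset.mem_univ i)

theorem EnergyBounds.lintegral_weighted_density_le {Ω : Set R3} {T E : ℝ} (hV : volume Ω ≠ ⊤)
    {ϱ p : R4 → ℝ} {u : R4 → R3} (hE : EnergyBounds Ω T E ϱ p u) {θ : R4 → ℝ}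
    {M : ℝ} (hM : 0 ≤ M) (hM1 : ∀ z, θ z ≤ M) :
    ∀ᵐ s ∂(volume.restrict (Ioo 0 T)), ∫⁻ y in Ω, ENNReal.ofReal (θ (y, s) * ϱ (y, s))
      ≤ ENNReal.ofReal (M * ((volume Ω).toReal + E)) := by
  have hm2 := hE.meas_pressure
  have hE0 := hE.nonneg
  have hV0 : 0 ≤ (volume Ω).toReal := ENNReal.toReal_nonneg
  filter_upwards [hE.pressure_le] with s hs
  calc _ ≤ ∫⁻ y in Ω, ENNReal.ofReal M * (1 + ENNReal.ofReal (p (y, s))) := by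
        apply lintegral_mono
        intro y
        have h1 := hE.density_nonneg (y, s)
        have h2 := hE.pressure_nonneg (y, s)
        dsimp only
        rw [show (1 : ℝ≥0∞) = ENNReal.ofReal 1 by simp,
          ← ENNReal.ofReal_add (by norm_num) h2, ← ENNReal.ofReal_mul hM]
        apply ENNReal.ofReal_le_ofReal
        exact mul_le_mul (hM1 _) ((density_le h1).trans
          (add_le_add_right (hE.rpow_le_pressure _) 1)) h1 hM
    _ ≤ _ := by
        rw [lintegral_const_mul _ (by fun_prop), lintegral_add_left measurable_const,
          ENNReal.ofReal_mul hM, ENNReal.ofReal_add hV0 hE0]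
        simp only [lintegral_const, one_mul, Measure.restrict_apply MeasurableSet.univ,
          univ_inter, ENNReal.ofReal_toReal hV]
        gcongr

/-- The constant bounding the lower order terms. -/
def errConst (V T E R M Cf S₂ : ℝ) : ℝ :=
  3 * M ^ 2 * fieldConst V E R * ((20 + Cf) * ((V + E + E) * T) + 3 * S₂)
    + 27 * M * (M * (V + E) * S₂ + M * (V + E) * T * kbSqConst R)

theorem kbSqConst_nonneg {R : ℝ} (hR : 0 ≤ R) : 0 ≤ kbSqConst R := by
  have := polarConst_nonneg
  unfold kbSqConst; positivity

/-- Every term but one is an integrable energy density times a bounded convolution. The exception is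
the stress against `∇W`, handled by the `L²` pairing of `lintegral_mul_pot_le`. Neither `η` nor `δ`
enters the constant. -/
theorem lintegral_errTerm_le {Ω : Set R3} (hΩ : MeasurableSet Ω) {T E R : ℝ} (hT : 0 ≤ T)
    (hR0 : 0 < R) (hR : ∀ x ∈ Ω, ∀ y ∈ Ω, ‖x - y‖ < R) (hV : volume Ω ≠ ⊤)
    {ϱ p : R4 → ℝ} {u f : R4 → R3} {S : R4 → Matrix (Fin 3) (Fin 3) ℝ}
    (hE : EnergyBounds Ω T E ϱ p u) (hSm : ∀ i j, Measurable fun z => S z i j)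
    {Cf : ℝ} (hCf : 0 ≤ Cf) (hf : ∀ᵐ z ∂(volume.restrict (cylinder Ω T)), ‖f z‖ ≤ Cf)
    {S₂ : ℝ} (hS₂ : 0 ≤ S₂)
    (hS : ∫⁻ z in cylinder Ω T, ENNReal.ofReal (contract (S z) (S z)) ≤ ENNReal.ofReal S₂)
    {θ : R4 → ℝ} (hθm : Measurable θ) (hθ0 : ∀ z, 0 ≤ θ z) {M : ℝ} (hM : 0 ≤ M)
    (hM1 : ∀ z, θ z ≤ M) (hM2 : ∀ z, |dt θ z| ≤ M) (hM3 : ∀ j z, |dx j θ z| ≤ M)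
    {η : ℝ → ℝ} (hη : IsMollifier η) {δ : ℝ} (hδ : 0 < δ) :
    ∫⁻ z in cylinder Ω T, ‖errTerm Ω T θ ϱ p u f S (testKernel hR0 η δ) z‖ₑ
      ≤ ENNReal.ofReal (errConst (volume Ω).toReal T E R M Cf S₂) := by
  have hm1 := hE.meas_density
  have hm2 := hE.meas_pressure
  have hm3 := hE.meas_velocity
  have hE0 := hE.nonneg
  set V := (volume Ω).toReal with hVdef
  have hV0 : 0 ≤ V := ENNReal.toReal_nonneg
  set Wm := fieldConst V E R with hWm
  have hWm0 : 0 ≤ Wm := fieldConst_nonneg hV0 hE0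
  set g : R4 → ℝ := fun w => θ w * ϱ w with hg
  have mg : Measurable g := by fun_prop
  have hg0 : ∀ w, 0 ≤ g w := fun w => mul_nonneg (hθ0 w) (hE.density_nonneg w)
  set P := pot Ω T η (kbKer δ) g with hP
  have mP : Measurable P := measurable_pot Ω T hη (measurable_kbKer δ) mg
  set c2 : R4 → ℝ := fun z => contract (S z) (S z) with hc2
  have mc2 : Measurable c2 := by
    simp only [hc2, contract]
    exact Finset.measurable_sum _ fun i _ => Finset.measurable_sum _ fun j _ =>
      (hSm i j).mul (hSm i j)
  have hc20 : ∀ z, 0 ≤ c2 z := fun z => Finset.sum_nonneg fun _ _ =>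
    Finset.sum_nonneg fun _ _ => mul_self_nonneg _
  set B1 : R4 → ℝ := fun z => 3 * M ^ 2 * Wm * ((20 + Cf) * (1 + p z + ϱ z * ‖u z‖ ^ 2) + 3 * c2 z)
    with hB1
  have mB1 : Measurable B1 := by fun_prop
  have hB10 : ∀ z, 0 ≤ B1 z := fun z => by
    have := hE.density_nonneg z
    have := hE.pressure_nonneg z
    have := hc20 z
    positivity
  have hmem : ∀ᵐ w ∂(volume.restrict (cylinder Ω T)), w ∈ cylinder Ω T :=
    ae_restrict_mem (hΩ.prod measurableSet_Ioo)
  have hpt : ∀ᵐ z ∂(volume.restrict (cylinder Ω T)),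
      ‖errTerm Ω T θ ϱ p u f S (testKernel hR0 η δ) z‖ₑ ≤ ENNReal.ofReal (B1 z)
        + ∑ i, ∑ j, ENNReal.ofReal (3 * M) * (ENNReal.ofReal |S z i j| * P z) := by
    filter_upwards [hmem, hf] with z hz hfz
    have hr := hE.density_nonneg z
    have hp := hE.pressure_nonneg z
    have hθz := hθ0 z
    have hrp := (density_le hr).trans (add_le_add_right (hE.rpow_le_pressure z) 1)
    have hui : ∀ i, |u z i| ≤ ‖u z‖ := fun i => PiLp.norm_apply_le (u z) i
    have hfi : ∀ i, |f z i| ≤ Cf := fun i => (PiLp.norm_apply_le (f z) i).trans hfz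
    have hgW : ∀ i, |convOn Ω T g (fun v => testKernel hR0 η δ v i) z| ≤ M * Wm := fun i => by
      refine abs_convOn_testKernel_le hΩ hR0 hR hV hE hη hδ hM (fun w => ?_) i hz
      have h1 := hE.density_nonneg w
      rw [abs_of_nonneg (hg0 w)]
      calc θ w * ϱ w ≤ M * ϱ w := by gcongr; exact hM1 w
        _ ≤ M * (ϱ w * (1 + ‖u w‖)) := by
          gcongr
          exact le_mul_of_one_le_right h1 (by linarith [norm_nonneg (u w)])
    have hrW : ∀ i, |convOn Ω T (massSource θ ϱ u) (fun v => testKernel hR0 η δ v i) z|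
        ≤ 3 * M * Wm := fun i => by
      refine abs_convOn_testKernel_le hΩ hR0 hR hV hE hη hδ (by positivity) (fun w => ?_) i hz
      have h1 := hE.density_nonneg w
      have h2 : ∀ j, |dx j θ w * (ϱ w * u w j)| ≤ M * (ϱ w * ‖u w‖) := fun j => by
        rw [abs_mul, abs_mul, abs_of_nonneg h1]
        have := PiLp.norm_apply_le (u w) j
        gcongr
        · exact hM3 j w
        · exact this
      have h3 : |dt θ w * ϱ w| ≤ M * ϱ w := by
        rw [abs_mul, abs_of_nonneg h1]; gcongr; exact hM2 w
      have h4 : |∑ j, dx j θ w * (ϱ w * u w j)| ≤ ∑ j : Fin 3, M * (ϱ w * ‖u w‖) :=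
        (Finset.abs_sum_le_sum_abs _ _).trans (Finset.sum_le_sum fun j _ => h2 j)
      simp only [Finset.sum_const, Finset.card_univ, Fintype.card_fin, nsmul_eq_mul] at h4
      push_cast at h4
      unfold massSource
      refine (abs_add_le _ _).trans ?_
      nlinarith [mul_nonneg hM h1]
    have k0 : ϱ z * ‖u z‖ ≤ ϱ z + ϱ z * ‖u z‖ ^ 2 := by
      nlinarith [mul_nonneg hr (sq_nonneg (‖u z‖ - 1)), mul_nonneg hr (sq_nonneg ‖u z‖)]
    have hru : ∀ i, |ϱ z * u z i| ≤ ϱ z * ‖u z‖ := fun i => by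
      rw [abs_mul, abs_of_nonneg hr]; gcongr; exact hui i
    have t1 : ∀ i, |(dt θ z * (ϱ z * u z i) + θ z * (ϱ z * f z i)) *
        convOn Ω T g (fun v => testKernel hR0 η δ v i) z|
        ≤ M ^ 2 * Wm * (ϱ z * ‖u z‖ + Cf * ϱ z) := fun i => by
      rw [abs_mul]
      have a1 : |dt θ z * (ϱ z * u z i)| ≤ M * (ϱ z * ‖u z‖) := by
        rw [abs_mul]; exact mul_le_mul (hM2 z) (hru i) (abs_nonneg _) hM
      have a2 : |θ z * (ϱ z * f z i)| ≤ M * (ϱ z * Cf) := by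
        rw [abs_mul, abs_mul, abs_of_nonneg hθz, abs_of_nonneg hr]
        gcongr
        · exact hM1 z
        · exact hfi i
      calc _ ≤ (M * (ϱ z * ‖u z‖) + M * (ϱ z * Cf)) * (M * Wm) :=
            mul_le_mul ((abs_add_le _ _).trans (add_le_add a1 a2)) (hgW i) (abs_nonneg _)
              (by positivity)
        _ = _ := by ring
    have t2 : ∀ i, |θ z * (ϱ z * u z i) *
        convOn Ω T (massSource θ ϱ u) (fun v => testKernel hR0 η δ v i) z|
        ≤ M ^ 2 * Wm * (3 * (ϱ z * ‖u z‖)) := fun i => by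
      rw [abs_mul]
      have a1 : |θ z * (ϱ z * u z i)| ≤ M * (ϱ z * ‖u z‖) := by
        rw [abs_mul, abs_of_nonneg hθz]; exact mul_le_mul (hM1 z) (hru i) (abs_nonneg _) hM
      calc _ ≤ (M * (ϱ z * ‖u z‖)) * (3 * M * Wm) :=
            mul_le_mul a1 (hrW i) (abs_nonneg _) (by positivity)
        _ = _ := by ring
    have t3 : ∀ i j, |dx j θ z * flux ϱ p u S i j z *
        convOn Ω T g (fun v => testKernel hR0 η δ v i) z|
        ≤ M ^ 2 * Wm * (ϱ z * ‖u z‖ ^ 2 + p z + (1 + c2 z)) := fun i j => by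
      rw [abs_mul]
      have a0 : |S z i j| ≤ 1 + c2 z := by
        have := sq_entry_le_contract (S z) i j
        rw [← sq_abs] at this
        simp only [hc2]
        nlinarith [sq_nonneg (|S z i j| - 1)]
      have a1 : |ϱ z * (u z i * u z j)| ≤ ϱ z * ‖u z‖ ^ 2 := by
        rw [abs_mul, abs_mul, abs_of_nonneg hr, sq]
        have := hui i
        have := hui j
        gcongr
      have a2 : |if i = j then p z else 0| ≤ p z := by
        split_ifs
        · rw [abs_of_nonneg hp]
        · simpa using hp
      have a3 : |flux ϱ p u S i j z| ≤ ϱ z * ‖u z‖ ^ 2 + p z + (1 + c2 z) := by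
        unfold flux
        refine (abs_sub _ _).trans (add_le_add ((abs_add_le _ _).trans (add_le_add a1 a2)) a0)
      have := hc20 z
      calc _ ≤ (M * (ϱ z * ‖u z‖ ^ 2 + p z + (1 + c2 z))) * (M * Wm) := by
            rw [abs_mul]
            exact mul_le_mul (mul_le_mul (hM3 j z) a3 (abs_nonneg _) hM) (hgW i) (abs_nonneg _)
              (by positivity)
        _ = _ := by ring
    have t4 : ∀ i j, ‖θ z * S z i j *
        convOn Ω T g (fun v => dx j (testKernel hR0 η δ) v i) z‖ₑ
        ≤ ENNReal.ofReal (3 * M) * (ENNReal.ofReal |S z i j| * P z) := fun i j => by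
      rw [enorm_mul, enorm_mul]
      have a1 := enorm_convOn_dx_testKernel_le hΩ hR0 hR hη hδ mg hg0 i j hz
      calc _ ≤ ENNReal.ofReal M * ENNReal.ofReal |S z i j| * (ENNReal.ofReal 3 * P z) := by
            gcongr
            · rw [Real.enorm_of_nonneg hθz]; exact ENNReal.ofReal_le_ofReal (hM1 z)
            · rw [← ofReal_norm, Real.norm_eq_abs]
        _ = _ := by rw [ENNReal.ofReal_mul (by norm_num)]; ring
    unfold errTerm
    rw [sub_eq_add_neg]
    refine (enorm_add_le _ _).trans (add_le_add ?_ ?_)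
    · rw [← ofReal_norm, Real.norm_eq_abs]
      apply ENNReal.ofReal_le_ofReal
      refine (abs_add_le _ _).trans ((add_le_add ((abs_add_le _ _).trans (add_le_add
        ((Finset.abs_sum_le_sum_abs _ _).trans (Finset.sum_le_sum fun i _ => t1 i))
        ((Finset.abs_sum_le_sum_abs _ _).trans (Finset.sum_le_sum fun i _ => t2 i))))
        ((Finset.abs_sum_le_sum_abs _ _).trans (Finset.sum_le_sum fun i _ =>
          (Finset.abs_sum_le_sum_abs _ _).trans (Finset.sum_le_sum fun j _ => t3 i j)))).trans ?_)
      simp only [Finset.sum_const, Finset.card_univ, Fintype.card_fin, nsmul_eq_mul, hB1]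
      push_cast
      have k2 := hc20 z
      have k3 : 0 ≤ ϱ z * ‖u z‖ ^ 2 := by positivity
      -- The coefficient `4` is one from the time derivative of the cut-off plus three from the
      -- continuity source; `20` leaves ample room.
      have k4 : 4 * (ϱ z * ‖u z‖) + Cf * ϱ z + 3 * (ϱ z * ‖u z‖ ^ 2 + p z + (1 + c2 z))
          ≤ (20 + Cf) * (1 + p z + ϱ z * ‖u z‖ ^ 2) + 3 * c2 z := by
        have := mul_le_mul_of_nonneg_left hrp hCf
        have := mul_nonneg hCf k3
        nlinarith
      have := mul_le_mul_of_nonneg_left k4 (by positivity : 0 ≤ 3 * M ^ 2 * Wm)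
      linarith
    · rw [enorm_neg]
      refine (enorm_sum_le _ _).trans (Finset.sum_le_sum fun i _ => ?_)
      exact (enorm_sum_le _ _).trans (Finset.sum_le_sum fun j _ => t4 i j)
  have hgs := hE.lintegral_weighted_density_le hV hM hM1
  have i1 : ∫⁻ z in cylinder Ω T, ENNReal.ofReal (B1 z)
      ≤ ENNReal.ofReal (3 * M ^ 2 * Wm * ((20 + Cf) * ((V + E + E) * T) + 3 * S₂)) := by
    obtain ⟨a, ha⟩ : ∃ a, a = 3 * M ^ 2 * Wm := ⟨_, rfl⟩
    obtain ⟨b, hb⟩ : ∃ b, b = 20 + Cf := ⟨_, rfl⟩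
    have ha0 : 0 ≤ a := by rw [ha]; positivity
    have hb0 : 0 ≤ b := by rw [hb]; positivity
    rw [← ha, ← hb]
    have e : ∀ z, ENNReal.ofReal (B1 z) = ENNReal.ofReal a *
        (ENNReal.ofReal b * (1 + ENNReal.ofReal (p z) + ENNReal.ofReal (ϱ z * ‖u z‖ ^ 2))
          + ENNReal.ofReal 3 * ENNReal.ofReal (c2 z)) := by
      intro z
      have h1 := hE.density_nonneg z
      have h2 := hE.pressure_nonneg z
      have h3 := hc20 z
      simp only [hB1, ← ha, ← hb]
      rw [ENNReal.ofReal_mul (by positivity), ENNReal.ofReal_add (by positivity) (by positivity),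
        ENNReal.ofReal_mul (by positivity), ENNReal.ofReal_add (by positivity) (by positivity),
        ENNReal.ofReal_add (by positivity) (by positivity),
        ENNReal.ofReal_mul (by norm_num : (0 : ℝ) ≤ 3) (q := c2 z), ENNReal.ofReal_one]
    simp only [e]
    rw [lintegral_const_mul _ (by fun_prop), lintegral_add_left (by fun_prop),
      lintegral_const_mul _ (by fun_prop), lintegral_const_mul _ (by fun_prop)]
    have h1 : ∫⁻ z in cylinder Ω T, (1 + ENNReal.ofReal (p z) + ENNReal.ofReal (ϱ z * ‖u z‖ ^ 2))
        ≤ ENNReal.ofReal (V + E + E) * ENNReal.ofReal T := by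
      refine lintegral_cylinder_le_const (by fun_prop) ?_
      filter_upwards [hE.pressure_le, hE.kinetic_le] with s h1 h2
      rw [lintegral_add_left (by fun_prop), lintegral_add_left (by fun_prop),
        ENNReal.ofReal_add (by positivity) hE0, ENNReal.ofReal_add hV0 hE0]
      simp only [lintegral_const, one_mul, Measure.restrict_apply MeasurableSet.univ,
            univ_inter, hVdef, ENNReal.ofReal_toReal hV]
      gcongr
    rw [ENNReal.ofReal_mul (by positivity), ENNReal.ofReal_add (by positivity) (by positivity),
      ENNReal.ofReal_mul (by positivity), ENNReal.ofReal_mul (by positivity),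
      ENNReal.ofReal_mul (by norm_num) (q := S₂)]
    gcongr
  have i2 : ∀ i j, ∫⁻ z in cylinder Ω T, ENNReal.ofReal (3 * M) * (ENNReal.ofReal |S z i j| * P z)
      ≤ ENNReal.ofReal (3 * M * (M * (V + E) * S₂ + M * (V + E) * T * kbSqConst R)) := by
    intro i j
    have hk := kbSqConst_nonneg hR0.le
    have mS := hSm i j
    rw [lintegral_const_mul _ (by fun_prop), ENNReal.ofReal_mul (by positivity : 0 ≤ 3 * M)]
    gcongr
    rw [ENNReal.ofReal_add (by positivity) (by positivity),
      ENNReal.ofReal_mul (by positivity : 0 ≤ M * (V + E)),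
      ENNReal.ofReal_mul (by positivity) (q := kbSqConst R),
      ENNReal.ofReal_mul (by positivity : 0 ≤ M * (V + E)) (q := T)]
    refine (lintegral_mul_pot_le hΩ hR0 hR hη mg hg0 hgs hδ (σ := fun z => |S z i j|)
      (by fun_prop) (fun z => abs_nonneg _)).trans ?_
    gcongr
    refine (lintegral_mono fun z => ?_).trans hS
    rw [sq_abs]
    exact ENNReal.ofReal_le_ofReal (sq_entry_le_contract _ i j)
  refine (lintegral_mono_ae hpt).trans ?_
  have mS : ∀ i j, Measurable fun z =>
      ENNReal.ofReal (3 * M) * (ENNReal.ofReal |S z i j| * P z) := fun i j => by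
    have := hSm i j
    fun_prop
  rw [lintegral_add_left (by fun_prop), lintegral_finsetSum _ fun i _ =>
    Finset.measurable_sum _ fun j _ => mS i j]
  have hk := kbSqConst_nonneg hR0.le
  refine (add_le_add i1 (Finset.sum_le_sum fun i _ => ?_)).trans (b := _ + ∑ i : Fin 3,
    ∑ j : Fin 3, ENNReal.ofReal (3 * M * (M * (V + E) * S₂ + M * (V + E) * T * kbSqConst R))) ?_
  · rw [lintegral_finsetSum _ fun j _ => mS i j]
    exact Finset.sum_le_sum fun j _ => i2 i j
  · simp only [Finset.sum_const, Finset.card_univ, Fintype.card_fin, nsmul_eq_mul]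
    rw [errConst, ENNReal.ofReal_add (by positivity) (by positivity)]
    gcongr
    rw [show ((3 : ℕ) : ℝ≥0∞) = ENNReal.ofReal 3 by simp, ← ENNReal.ofReal_mul (by norm_num),
      ← ENNReal.ofReal_mul (by norm_num)]
    apply ENNReal.ofReal_le_ofReal
    apply le_of_eq; ring

end

end CompressibleNS

/-! ### Absorption -/

open MeasureTheory Set
open scoped ENNReal ContDiff

namespace CompressibleNS

noncomputable section

/-- The constant of the absorption step. -/
def absorbConst (E R M : ℝ) : ℝ :=
  1 + (M ^ (3 / 2 : ℝ) * E + Real.exp (1 / 2) * polarConst * R)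

/-- The constant bounding the mollified potential. -/
def potentialConst (V T E R M Cf S₂ F : ℝ) : ℝ :=
  2 * (errConst V T E R M Cf S₂ + 16 / 3 * (absorbConst E R M *
    (M * (E * T) + (F * E / (3 / (32 * absorbConst E R M)) + F))))

/-- The potential inequality and the absorption estimate combine to `X ≤ A + X/2`, whence `X ≤ 2A`,
with `A` independent of `η` and `δ`. -/
theorem lintegral_mollified_potential_le {Ω : Set R3} (hΩ : MeasurableSet Ω) {T E R : ℝ}
    (hT : 0 < T) (hR1 : 1 ≤ R) (hR : ∀ x ∈ Ω, ∀ y ∈ Ω, ‖x - y‖ < R) (hV : volume Ω ≠ ⊤)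
    {ϱ p : R4 → ℝ} {u f : R4 → R3} {S : R4 → Matrix (Fin 3) (Fin 3) ℝ}
    (hE : EnergyBounds Ω T E ϱ p u) (hw : WeakData Ω T ϱ p u f S)
    (hSm : ∀ i j, Measurable fun z => S z i j)
    {Cf : ℝ} (hCf : 0 ≤ Cf) (hf : ∀ᵐ z ∂(volume.restrict (cylinder Ω T)), ‖f z‖ ≤ Cf)
    {S₂ : ℝ} (hS₂ : 0 ≤ S₂)
    (hS : ∫⁻ z in cylinder Ω T, ENNReal.ofReal (contract (S z) (S z)) ≤ ENNReal.ofReal S₂)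
    {θ : R4 → ℝ} (hθ : IsTestFunction (cylinder Ω T) θ) (hθ0 : ∀ z, 0 ≤ θ z) {M : ℝ}
    (hM : 0 ≤ M) (hM1 : ∀ z, θ z ≤ M) (hM2 : ∀ z, |dt θ z| ≤ M) (hM3 : ∀ j z, |dx j θ z| ≤ M)
    {D : ℝ → ℝ} (hD : Measurable D) (hD1 : ∀ t, 1 ≤ D t)
    {F : ℝ} (hF : 0 ≤ F) (hDF : ∫⁻ t in Ioo 0 T, ENNReal.ofReal (D t) ≤ ENNReal.ofReal F)
    (hsob : ∀ᵐ t ∂(volume.restrict (Ioo 0 T)),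
      ∫⁻ x in Ω, ENNReal.ofReal ((θ (x, t) * ‖u (x, t)‖ ^ 2) ^ 3) ≤ ENNReal.ofReal (D t ^ 3))
    {η : ℝ → ℝ} (hη : IsMollifier η) {δ : ℝ} (hδ : 0 < δ) :
    ∫⁻ z in cylinder Ω T, ENNReal.ofReal (θ z * ϱ z ^ (3 / 2 : ℝ))
        * pot Ω T η (kbKer δ) (fun z => θ z * ϱ z) z
      ≤ ENNReal.ofReal (potentialConst (volume Ω).toReal T E R M Cf S₂ F) := by
  have hR0 : 0 < R := one_pos.trans_le hR1
  have hE0 := hE.nonneg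
  have hp0 := polarConst_nonneg
  have hm1 := hE.meas_density
  have hm2 := hE.meas_pressure
  have hθm := hθ.1.continuous.measurable
  have hg0 : ∀ z, 0 ≤ θ z * ϱ z := fun z => mul_nonneg (hθ0 z) (hE.density_nonneg z)
  set V := (volume Ω).toReal with hVdef
  have hV0 : 0 ≤ V := ENNReal.toReal_nonneg
  have hgs := hE.lintegral_weighted_density_le hV hM hM1
  have hfin : ∀ z, pot Ω T η (kbKer δ) (fun z => θ z * ϱ z) z
      ≤ ENNReal.ofReal (M * (V + E)) * ENNReal.ofReal (kb (δ ^ 2)) := fun z =>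
    pot_le_of_bounded hη (kbKer_le hδ) (by fun_prop) hg0 hgs z
  have h32 : ∀ᵐ s ∂(volume.restrict (Ioo 0 T)), ∫⁻ y in Ω,
      ENNReal.ofReal ((θ (y, s) * ϱ (y, s)) ^ (3 / 2 : ℝ))
        ≤ ENNReal.ofReal (M ^ (3 / 2 : ℝ) * E) := by
    filter_upwards [hE.pressure_le] with s hs
    calc _ ≤ ∫⁻ y in Ω, ENNReal.ofReal (M ^ (3 / 2 : ℝ)) * ENNReal.ofReal (p (y, s)) := by
          apply lintegral_mono
          intro y
          have h1 := hE.density_nonneg (y, s)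
          dsimp only
          rw [← ENNReal.ofReal_mul (by positivity), Real.mul_rpow (hθ0 _) h1]
          apply ENNReal.ofReal_le_ofReal
          exact mul_le_mul (Real.rpow_le_rpow (hθ0 _) (hM1 _) (by norm_num))
            (hE.rpow_le_pressure _) (by positivity) (by positivity)
      _ ≤ _ := by
          rw [lintegral_const_mul _ (by fun_prop), ENNReal.ofReal_mul (by positivity)]
          gcongr
  set C1 := absorbConst E R M with hC1
  have hC1p : 0 < C1 := by rw [hC1, absorbConst]; positivity
  have hA0 : 0 ≤ C1 * (M * (E * T) + (F * E / (3 / (32 * C1)) + F)) := by positivity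
  have hB0 : 0 ≤ errConst V T E R M Cf S₂ := by
    have := fieldConst_nonneg (R := R) hV0 hE0
    have := kbSqConst_nonneg hR0.le
    unfold errConst; positivity
  -- The parameter is chosen so that `(16/3) · C1 · e = 1/2`.
  have hkin := lintegral_kinetic_mul_pot_kc_le hΩ hT hR1 hR hE hη hδ hθm hθ0 hM hM1 hD hD1 hF
    hDF hsob (by positivity) h32 (fun z => ne_top_of_le_ne_top (by finiteness) (hfin z))
    (e := 3 / (32 * C1)) (by positivity)
  have herr := lintegral_errTerm_le hΩ hT.le hR0 hR hV hE hSm hCf hf hS₂ hS hθm hθ0 hM hM1 hM2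
    hM3 hη hδ
  have hpre := lintegral_pressure_mul_pot_le hΩ hR0 hR hE hw hθ hθ0 hη hδ
    ENNReal.ofReal_ne_top herr
  set X := ∫⁻ z in cylinder Ω T, ENNReal.ofReal (θ z * ϱ z ^ (3 / 2 : ℝ))
    * pot Ω T η (kbKer δ) (fun z => θ z * ϱ z) z with hX
  -- Absorption is legitimate only for a finite quantity; this is where `δ > 0` is needed.
  have hXfin : X ≠ ⊤ := by
    refine ne_top_of_le_ne_top (b := (∫⁻ z in cylinder Ω T, ENNReal.ofReal (θ z * p z)) *
      (ENNReal.ofReal (M * (V + E)) * ENNReal.ofReal (kb (δ ^ 2)))) ?_ ?_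
    · have h1 := (isBddCont_of_test hθ).integrable_mul hw.int_pressure
      have h2 := h1.lintegral_lt_top
      finiteness
    · rw [← lintegral_mul_const _ (by fun_prop)]
      refine lintegral_mono fun z => mul_le_mul' (ENNReal.ofReal_le_ofReal ?_) (hfin z)
      exact mul_le_mul_of_nonneg_left (hE.rpow_le_pressure z) (hθ0 z)
  have hXle : X ≤ ∫⁻ z in cylinder Ω T, ENNReal.ofReal (θ z * p z)
      * pot Ω T η (kbKer δ) (fun z => θ z * ϱ z) z := lintegral_mono fun z =>
    mul_le_mul' (ENNReal.ofReal_le_ofReal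
      (mul_le_mul_of_nonneg_left (hE.rpow_le_pressure z) (hθ0 z))) le_rfl
  have key := hXle.trans (hpre.trans (add_le_add_right (mul_le_mul_right hkin _) _))
  have hce : (1 + (M ^ (3 / 2 : ℝ) * E + Real.exp (1 / 2) * polarConst * R)) * (3 / (32 * C1))
      = 3 / 32 := by
    rw [← absorbConst, ← hC1]; field_simp
  rw [hce, ← absorbConst, ← hC1] at key
  lift X to NNReal using hXfin with x
  have e : ∀ y : NNReal, (y : ℝ≥0∞) = ENNReal.ofReal (y : ℝ) := fun y =>
    (ENNReal.ofReal_coe_nnreal).symm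
  rw [e x, ← ENNReal.ofReal_mul (by norm_num), ← ENNReal.ofReal_add hA0 (by positivity),
    ← ENNReal.ofReal_mul (by norm_num), ← ENNReal.ofReal_add hB0 (by positivity),
    ENNReal.ofReal_le_ofReal_iff (by positivity)] at key
  rw [e x]
  apply ENNReal.ofReal_le_ofReal
  rw [potentialConst, ← hC1]
  linarith

/-! ### Removal of the time mollification and of the regularisation -/

/-- The bump functions used to localise in time. -/
def timeBump (n : ℕ) : ContDiffBump (0 : ℝ) :=
  { rIn := 1 / (n + 1), rOut := 2 / (n + 1), rIn_pos := by positivity,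
    rIn_lt_rOut := by gcongr; norm_num }

theorem isMollifier_timeBump (n : ℕ) : IsMollifier ((timeBump n).normed volume) where
  contDiff := (timeBump n).contDiff_normed
  compact := (timeBump n).hasCompactSupport_normed
  nonneg := (timeBump n).nonneg_normed
  even := (timeBump n).normed_neg
  mass := by
    rw [← ofReal_integral_eq_lintegral_ofReal (timeBump n).integrable_normed
      (ae_of_all _ (timeBump n).nonneg_normed), (timeBump n).integral_normed]
    simp

open scoped Topology Convolution
open Filter

/-- The potential of a time slice. -/
def slicePot (Ω : Set R3) (K : R3 → ℝ) (g : R4 → ℝ) (z : R4) : ℝ≥0∞ :=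
  ∫⁻ y in Ω, ENNReal.ofReal (g (y, z.2) * K (z.1 - y))

theorem measurable_slicePot (Ω : Set R3) {K : R3 → ℝ} (hK : Measurable K) {g : R4 → ℝ}
    (hg : Measurable g) : Measurable (slicePot Ω K g) := by
  refine Measurable.lintegral_prod_right'
    (f := fun q : R4 × R3 => ENNReal.ofReal (g (q.2, q.1.2) * K (q.1.1 - q.2))) ?_
  fun_prop

/-- For fixed `x` the mollified potential is the one-dimensional convolution in time of the slice
potential, so Lebesgue's differentiation theorem applies. -/
theorem tendsto_pot_timeBump {Ω : Set R3} {T : ℝ} {K : R3 → ℝ} (hK : Measurable K)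
    {B : ℝ} (hB : ∀ x, K x ≤ B) {g : R4 → ℝ} (hg : Measurable g) (hg0 : ∀ w, 0 ≤ g w)
    {C : ℝ≥0∞} (hC : C ≠ ⊤)
    (h : ∀ᵐ s ∂(volume.restrict (Ioo 0 T)), ∫⁻ y in Ω, ENNReal.ofReal (g (y, s)) ≤ C) (x : R3) :
    ∀ᵐ t ∂(volume.restrict (Ioo 0 T)),
      Tendsto (fun n => pot Ω T ((timeBump n).normed volume) K g (x, t)) atTop
        (𝓝 (slicePot Ω K g (x, t))) := by
  have hmS := measurable_slicePot Ω hK hg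
  have hle : ∀ᵐ s ∂(volume.restrict (Ioo 0 T)),
      slicePot Ω K g (x, s) ≤ C * ENNReal.ofReal B := by
    filter_upwards [h] with s hs
    unfold slicePot
    calc _ ≤ ∫⁻ y in Ω, ENNReal.ofReal (g (y, s)) * ENNReal.ofReal B := by
          refine lintegral_mono fun y => ?_
          rw [← ENNReal.ofReal_mul (hg0 _)]
          exact ENNReal.ofReal_le_ofReal (mul_le_mul_of_nonneg_left (hB _) (hg0 _))
      _ ≤ _ := by
          rw [lintegral_mul_const _ (by fun_prop)]
          gcongr
  have hCB : C * ENNReal.ofReal B ≠ ⊤ := by finiteness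
  have hfin : ∀ᵐ s ∂(volume.restrict (Ioo 0 T)), slicePot Ω K g (x, s) ≠ ⊤ :=
    hle.mono fun s hs => ne_top_of_le_ne_top hCB hs
  -- Extension by zero to the whole line; it is integrable because the kernel is bounded and the
  -- mass of `g` is bounded in time.
  set γ : ℝ → ℝ := (Ioo 0 T).indicator fun s => (slicePot Ω K g (x, s)).toReal with hγ
  have hmx : Measurable fun s => slicePot Ω K g (x, s) := by fun_prop
  have iγ : Integrable γ := by
    rw [hγ, integrable_indicator_iff measurableSet_Ioo]
    refine integrable_toReal_of_lintegral_ne_top hmx.aemeasurable ?_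
    refine ne_top_of_le_ne_top ?_ (lintegral_mono_ae hle)
    simp; finiteness
  have hconv := ContDiffBump.ae_convolution_tendsto_right_of_locallyIntegrable (μ := volume)
    (φ := timeBump) (l := atTop) (K := 2) (g := γ) (by
      have : Tendsto (fun n : ℕ => 2 * (1 / ((n : ℝ) + 1))) atTop (𝓝 (2 * 0)) :=
        tendsto_one_div_add_atTop_nhds_zero_nat.const_mul 2
      simpa [timeBump, div_eq_mul_inv] using this)
    (Eventually.of_forall fun n => by simp only [timeBump]; apply le_of_eq; ring)
    iγ.locallyIntegrable
  have hpot : ∀ n t, pot Ω T ((timeBump n).normed volume) K g (x, t)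
      = ENNReal.ofReal (((timeBump n).normed volume ⋆[ContinuousLinearMap.lsmul ℝ ℝ, volume] γ) t) := by
    intro n t
    have hη := isMollifier_timeBump n
    have hηm := hη.measurable
    obtain ⟨A, hA⟩ := hη.compact.exists_bound_of_continuous hη.contDiff.continuous
    have hγ0 : ∀ s, 0 ≤ γ s := fun s => indicator_nonneg (fun _ _ => ENNReal.toReal_nonneg) s
    have hint : Integrable fun s => (timeBump n).normed volume (t - s) * γ s :=
      iγ.bdd_mul (c := A) (hη.contDiff.continuous.comp
        (continuous_const.sub continuous_id)).aestronglyMeasurable (ae_of_all _ fun s => hA _)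
    rw [convolution_eq_swap]
    simp only [ContinuousLinearMap.lsmul_apply, smul_eq_mul]
    rw [ofReal_integral_eq_lintegral_ofReal hint
      (ae_of_all _ fun s => mul_nonneg (hη.nonneg _) (hγ0 s))]
    have h1 : (fun s => ENNReal.ofReal ((timeBump n).normed volume (t - s) * γ s))
        = (Ioo 0 T).indicator fun s => ENNReal.ofReal ((timeBump n).normed volume (t - s) *
          (slicePot Ω K g (x, s)).toReal) := by
      ext s
      by_cases hs : s ∈ Ioo 0 T
      · simp [hγ, hs]
      · simp [hγ, hs]
    rw [h1, lintegral_indicator measurableSet_Ioo]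
    unfold pot
    rw [restrict_cylinder, lintegral_prod_symm _ (by fun_prop)]
    refine lintegral_congr_ae ?_
    filter_upwards [hfin] with s hs
    rw [lintegral_mul_const _ (by fun_prop), ENNReal.ofReal_mul (hη.nonneg _),
      ENNReal.ofReal_toReal hs, mul_comm]
    rfl
  filter_upwards [ae_restrict_of_ae hconv, hfin, ae_restrict_mem measurableSet_Ioo] with t h1 h2 h3
  have h4 : ENNReal.ofReal (γ t) = slicePot Ω K g (x, t) := by
    rw [hγ, indicator_of_mem h3, ENNReal.ofReal_toReal h2]
  rw [← h4]
  simp only [hpot]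
  exact (ENNReal.continuous_ofReal.tendsto _).comp h1

/-- Fatou is applied first in time for each `x`, where the pointwise limit is available, and then in
space. -/
theorem lintegral_slicePot_le_of_pot {Ω : Set R3} {T : ℝ} {K : R3 → ℝ} (hK : Measurable K)
    {B : ℝ} (hB : ∀ x, K x ≤ B) {b g : R4 → ℝ} (hb : Measurable b) (hg : Measurable g)
    (hg0 : ∀ w, 0 ≤ g w) {C : ℝ≥0∞} (hC : C ≠ ⊤)
    (h : ∀ᵐ s ∂(volume.restrict (Ioo 0 T)), ∫⁻ y in Ω, ENNReal.ofReal (g (y, s)) ≤ C)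
    {A : ℝ≥0∞}
    (hA : ∀ n, ∫⁻ z in cylinder Ω T, ENNReal.ofReal (b z) *
      pot Ω T ((timeBump n).normed volume) K g z ≤ A) :
    ∫⁻ z in cylinder Ω T, ENNReal.ofReal (b z) * slicePot Ω K g z ≤ A := by
  have hmS := measurable_slicePot Ω hK hg
  have hmP : ∀ n, Measurable (pot Ω T ((timeBump n).normed volume) K g) := fun n =>
    measurable_pot Ω T (isMollifier_timeBump n) hK hg
  rw [restrict_cylinder, lintegral_prod _ (by fun_prop)]
  calc _ ≤ ∫⁻ x in Ω, liminf (fun n => ∫⁻ t in Ioo 0 T, ENNReal.ofReal (b (x, t)) *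
        pot Ω T ((timeBump n).normed volume) K g (x, t)) atTop := by
        refine lintegral_mono fun x => ?_
        refine le_trans (lintegral_mono_ae ?_) (lintegral_liminf_le fun n => by
          have := hmP n; fun_prop)
        filter_upwards [tendsto_pot_timeBump hK hB hg hg0 hC h x] with t ht
        rw [← ht.liminf_eq]
        exact (ENNReal.liminf_const_mul_of_ne_top ENNReal.ofReal_ne_top).ge
    _ ≤ liminf (fun n => ∫⁻ x in Ω, ∫⁻ t in Ioo 0 T, ENNReal.ofReal (b (x, t)) *
        pot Ω T ((timeBump n).normed volume) K g (x, t)) atTop :=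
        lintegral_liminf_le fun n => Measurable.lintegral_prod_right' (f := fun z : R4 =>
          ENNReal.ofReal (b z) * pot Ω T ((timeBump n).normed volume) K g z)
          (by have := hmP n; fun_prop)
    _ ≤ A := by
        refine liminf_le_of_frequently_le' (Frequently.of_forall fun n => ?_)
        have := hmP n
        rw [← lintegral_prod (μ := volume.restrict Ω) (ν := volume.restrict (Ioo 0 T))
          (fun z : R4 => ENNReal.ofReal (b z) * pot Ω T ((timeBump n).normed volume) K g z)
          (by fun_prop), ← restrict_cylinder]
        exact hA n

/-- The kernels converge away from the diagonal, which is null in each slice; Fatou is used inside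
the potential and again outside. -/
theorem lintegral_slicePot_kb_le {Ω : Set R3} {T : ℝ} {b g : R4 → ℝ} (hb : Measurable b)
    (hg : Measurable g) {A : ℝ≥0∞}
    (hA : ∀ δ > 0, ∫⁻ z in cylinder Ω T, ENNReal.ofReal (b z) * slicePot Ω (kbKer δ) g z ≤ A) :
    ∫⁻ z in cylinder Ω T, ENNReal.ofReal (b z) * slicePot Ω (fun v => kb (‖v‖ ^ 2)) g z ≤ A := by
  set d : ℕ → ℝ := fun n => 1 / (n + 1) with hd
  have hd0 : ∀ n, 0 < d n := fun n => by positivity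
  have hdl : Tendsto d atTop (𝓝 0) := tendsto_one_div_add_atTop_nhds_zero_nat
  have hmP : ∀ n, Measurable (slicePot Ω (kbKer (d n)) g) := fun n =>
    measurable_slicePot Ω (measurable_kbKer _) hg
  have hker : ∀ v : R3, v ≠ 0 → Tendsto (fun n => kbKer (d n) v) atTop (𝓝 (kb (‖v‖ ^ 2))) := by
    intro v hv
    have h0 : 0 < ‖v‖ ^ 2 := by positivity
    have h1 := (contDiffOn_kb.continuousOn.continuousAt (Ioi_mem_nhds h0)).tendsto
    refine h1.comp ?_
    simpa using (tendsto_const_nhds (x := ‖v‖ ^ 2)).add (hdl.pow 2)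
  have hpt : ∀ z, slicePot Ω (fun v => kb (‖v‖ ^ 2)) g z
      ≤ liminf (fun n => slicePot Ω (kbKer (d n)) g z) atTop := by
    intro z
    refine le_trans (lintegral_mono_ae ?_) (lintegral_liminf_le fun n => by
      have := measurable_kbKer (d n); fun_prop)
    have hne : ∀ᵐ y ∂(volume.restrict Ω), y ≠ z.1 :=
      ae_restrict_of_ae (Measure.ae_ne volume z.1)
    filter_upwards [hne] with y hy
    have h1 := (hker (z.1 - y) (sub_ne_zero.2 hy.symm)).const_mul (g (y, z.2))
    exact ((ENNReal.continuous_ofReal.tendsto _).comp h1).liminf_eq.ge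
  calc _ ≤ ∫⁻ z in cylinder Ω T, liminf (fun n =>
        ENNReal.ofReal (b z) * slicePot Ω (kbKer (d n)) g z) atTop := by
        refine lintegral_mono fun z => ?_
        refine (mul_le_mul_right (hpt z) _).trans ?_
        exact (ENNReal.liminf_const_mul_of_ne_top ENNReal.ofReal_ne_top).ge
    _ ≤ liminf (fun n => ∫⁻ z in cylinder Ω T,
        ENNReal.ofReal (b z) * slicePot Ω (kbKer (d n)) g z) atTop :=
        lintegral_liminf_le fun n => by have := hmP n; fun_prop
    _ ≤ A := liminf_le_of_frequently_le' (Frequently.of_forall fun n => hA _ (hd0 n))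

end

end CompressibleNS

/-! ### Comparison of kernels, slicing, and passage from weak solutions to the abstract data -/

open MeasureTheory Set
open scoped ENNReal ContDiff

namespace CompressibleNS

noncomputable section

/-- The constant comparing the logarithmic kernel with `kb`. -/
def logConst (R : ℝ) : ℝ := 3 + Real.log R ^ (4 / 3 : ℝ)

/-- For `r < 1` the logarithm is below `ell (r²)`; for `1 ≤ r < R` it is at most `log R`, while
`ell` is at least `3`. Powers below `4/3` cost only an additive one. -/
theorem log_kernel_le {μ R : ℝ} (hμ0 : 0 ≤ μ) (hμ : μ ≤ 4 / 3) {r : ℝ} (hr : 0 ≤ r)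
    (hrR : r < R) (hR : 1 ≤ R) :
    (|Real.log r| ^ μ + 1) / r ≤ logConst R * kb (r ^ 2) := by
  have hL : 0 ≤ Real.log R := Real.log_nonneg hR
  have hK : 0 ≤ logConst R := by unfold logConst; positivity
  rcases hr.eq_or_lt with rfl | hr0
  -- At `r = 0` both sides vanish by convention, division by zero and a negative power of zero being
  -- zero.
  · rw [div_zero]
    unfold kb ell
    norm_num
  have h2 : 0 < r ^ 2 := by positivity
  have h3 := three_le_ell h2
  have hkb : kb (r ^ 2) = ell (r ^ 2) ^ (4 / 3 : ℝ) / r := by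
    unfold kb
    rw [Real.rpow_neg h2.le, ← Real.sqrt_eq_rpow, Real.sqrt_sq hr]
    field_simp
  rw [hkb, ← mul_div_assoc]
  refine div_le_div_of_nonneg_right ?_ hr
  have hone : 1 ≤ ell (r ^ 2) ^ (4 / 3 : ℝ) := Real.one_le_rpow (by linarith) (by norm_num)
  have hmu : |Real.log r| ^ μ ≤ 1 + |Real.log r| ^ (4 / 3 : ℝ) := by
    rcases le_total |Real.log r| 1 with h | h
    · have := Real.rpow_le_one (abs_nonneg _) h hμ0
      have : 0 ≤ |Real.log r| ^ (4 / 3 : ℝ) := by positivity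
      linarith
    · have := Real.rpow_le_rpow_of_exponent_le h hμ
      linarith
  have hmain : |Real.log r| ^ (4 / 3 : ℝ)
      ≤ (1 + Real.log R ^ (4 / 3 : ℝ)) * ell (r ^ 2) ^ (4 / 3 : ℝ) := by
    have hLp : 0 ≤ Real.log R ^ (4 / 3 : ℝ) := by positivity
    rcases lt_or_ge r 1 with h | h
    · have h4 : |Real.log r| ≤ ell (r ^ 2) := by
        rw [abs_of_neg (Real.log_neg hr0 h)]
        have h5 : Real.log (1 / r ^ 2) ≤ Real.log (1 + 1 / r ^ 2) :=
          Real.log_le_log (by positivity) (by linarith)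
        rw [one_div, Real.log_inv, Real.log_pow] at h5
        have h6 := Real.log_neg hr0 h
        unfold ell
        push_cast at h5
        rw [one_div]
        linarith
      have h5 := Real.rpow_le_rpow (abs_nonneg _) h4 (by norm_num : (0 : ℝ) ≤ 4 / 3)
      nlinarith
    · have h4 : |Real.log r| ≤ Real.log R := by
        rw [abs_of_nonneg (Real.log_nonneg h)]
        exact Real.log_le_log hr0 hrR.le
      have h5 := Real.rpow_le_rpow (abs_nonneg _) h4 (by norm_num : (0 : ℝ) ≤ 4 / 3)
      nlinarith
  unfold logConst
  linarith

theorem IsTestFunction.pow {V : Type*} [NormedAddCommGroup V] [NormedSpace ℝ V] {U : Set V}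
    {φ : V → ℝ} (h : IsTestFunction U φ) {n : ℕ} (hn : n ≠ 0) :
    IsTestFunction U fun z => φ z ^ n := by
  have hsub : Function.support (fun z => φ z ^ n) ⊆ Function.support φ := by
    intro z hz hz'
    simp [hz', hn] at hz
  exact ⟨h.1.pow n, h.2.1.mono hsub, (closure_mono hsub).trans h.2.2⟩

theorem IsTestFunction.exists_bound {U : Set R4} {φ : R4 → ℝ} (h : IsTestFunction U φ) :
    ∃ M, 0 ≤ M ∧ (∀ z, |φ z| ≤ M) ∧ (∀ z, |dt φ z| ≤ M) ∧ ∀ j z, |dx j φ z| ≤ M := by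
  obtain ⟨A, hA⟩ := h.2.1.exists_bound_of_continuous h.1.continuous
  obtain ⟨B, hB⟩ := (h.2.1.fderiv (𝕜 := ℝ)).exists_bound_of_continuous
    (h.1.continuous_fderiv (by simp))
  have hv : ∀ (v : R4), ‖v‖ ≤ 1 → ∀ z, |fderiv ℝ φ z v| ≤ max (max A B) 0 := fun v hv z => by
    have h1 := (fderiv ℝ φ z).le_opNorm v
    have h2 := hB z
    rw [← Real.norm_eq_abs]
    refine (h1.trans ?_).trans ((le_max_right A B).trans (le_max_left _ _))
    nlinarith [norm_nonneg (fderiv ℝ φ z), norm_nonneg v]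
  refine ⟨max (max A B) 0, le_max_right _ _, fun z => ?_, hv _ ?_, fun j => hv _ ?_⟩
  · exact (hA z).trans ((le_max_left A B).trans (le_max_left _ _))
  · simp [Prod.norm_def]
  · simp [Prod.norm_def]

theorem IsTestFunction.slice {Ω : Set R3} {T : ℝ} {φ : R4 → ℝ}
    (h : IsTestFunction (cylinder Ω T) φ) (t : ℝ) : IsTestFunction Ω fun x => φ (x, t) := by
  have hc : Continuous fun x : R3 => ((x, t) : R4) := by fun_prop
  have hsub : tsupport (fun x => φ (x, t)) ⊆ (fun x : R3 => ((x, t) : R4)) ⁻¹' tsupport φ :=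
    tsupport_comp_subset_preimage φ hc
  refine ⟨h.1.comp (contDiff_id.prodMk contDiff_const), ?_, fun x hx => (h.2.2 (hsub hx)).1⟩
  refine HasCompactSupport.of_support_subset_isCompact (h.2.1.isCompact.image continuous_fst) ?_
  intro x hx
  exact ⟨(x, t), hsub (subset_closure hx), rfl⟩

theorem fderiv_slice {φ : R4 → ℝ} (h : ContDiff ℝ ∞ φ) (x : R3) (t : ℝ) (j : Fin 3) :
    fderiv ℝ (fun x => φ (x, t)) x (EuclideanSpace.single j 1) = dx j φ (x, t) := by
  have h1 : HasFDerivAt (fun x : R3 => ((x, t) : R4))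
      ((ContinuousLinearMap.id ℝ R3).prod (0 : R3 →L[ℝ] ℝ)) x :=
    (hasFDerivAt_id x).prodMk (hasFDerivAt_const t x)
  have h2 := (h.differentiable (by simp) (x, t)).hasFDerivAt.comp x h1
  have h3 : fderiv ℝ (fun x => φ (x, t)) x = _ := h2.fderiv
  rw [h3]
  simp [dx]

theorem ae_slice {Ω : Set R3} {T : ℝ} {P : R4 → Prop}
    (h : ∀ᵐ z ∂(volume.restrict (cylinder Ω T)), P z) :
    ∀ᵐ t ∂(volume.restrict (Ioo 0 T)), ∀ᵐ x ∂(volume.restrict Ω), P (x, t) := by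
  rw [restrict_cylinder] at h
  exact Measure.ae_ae_of_ae_prod (Measure.measurePreserving_swap.quasiMeasurePreserving.ae h)

theorem ae_cylinder_of_ae {Ω : Set R3} {T : ℝ} {P : ℝ → Prop}
    (h : ∀ᵐ t ∂(volume.restrict (Ioo 0 T)), P t) :
    ∀ᵐ z ∂(volume.restrict (cylinder Ω T)), P z.2 := by
  rw [restrict_cylinder]
  exact Measure.quasiMeasurePreserving_snd.ae h

theorem ae_le_of_normLinftyL1_le {Ω : Set R3} {T E : ℝ} {g g' : R4 → ℝ}
    (hg : g =ᵐ[volume.restrict (cylinder Ω T)] g') (hg0 : ∀ z, 0 ≤ g' z)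
    (h : normLinftyL1 Ω T g ≤ ENNReal.ofReal E) :
    ∀ᵐ t ∂(volume.restrict (Ioo 0 T)),
      ∫⁻ x in Ω, ENNReal.ofReal (g' (x, t)) ≤ ENNReal.ofReal E := by
  filter_upwards [ae_le_essSup (μ := volume.restrict (Ioo 0 T))
    (f := fun t => ∫⁻ x in Ω, ENNReal.ofReal |g (x, t)|), ae_slice hg] with t h1 h2
  refine le_trans (le_of_eq (lintegral_congr_ae ?_)) (h1.trans h)
  filter_upwards [h2] with x hx
  rw [hx, abs_of_nonneg (hg0 _)]

theorem le_sq_of_sqrt_le {X : ℝ≥0∞} {E : ℝ} (hE : 0 ≤ E)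
    (h : X ^ (1 / 2 : ℝ) ≤ ENNReal.ofReal E) : X ≤ ENNReal.ofReal (E ^ 2) := by
  have h1 := ENNReal.rpow_le_rpow h (by norm_num : (0 : ℝ) ≤ 2)
  rw [← ENNReal.rpow_mul] at h1
  norm_num at h1
  rwa [ENNReal.ofReal_pow hE]

theorem contract_self_nonneg (A : Matrix (Fin 3) (Fin 3) ℝ) : 0 ≤ contract A A :=
  Finset.sum_nonneg fun _ _ => Finset.sum_nonneg fun _ _ => mul_self_nonneg _

theorem measurable_contract {S : R4 → Matrix (Fin 3) (Fin 3) ℝ}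
    (h : ∀ i j, Measurable fun z => S z i j) : Measurable fun z => contract (S z) (S z) :=
  Finset.measurable_sum _ fun i _ => Finset.measurable_sum _ fun j _ => (h i j).mul (h i j)

theorem contract_newtonianStress_le (ν₁ ν₂ : ℝ) (G : Matrix (Fin 3) (Fin 3) ℝ) :
    contract (newtonianStress ν₁ ν₂ G) (newtonianStress ν₁ ν₂ G)
      ≤ (8 * ν₁ ^ 2 + 18 * ν₂ ^ 2) * contract G G := by
  have hS : ∀ i j, newtonianStress ν₁ ν₂ G i j ^ 2
      ≤ 4 * ν₁ ^ 2 * (G i j ^ 2 + G j i ^ 2)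
        + (if i = j then 6 * ν₂ ^ 2 * (G 0 0 ^ 2 + G 1 1 ^ 2 + G 2 2 ^ 2) else 0) := by
    intro i j
    have h1 : newtonianStress ν₁ ν₂ G i j = ν₁ * (G i j + G j i)
        + (if i = j then ν₂ * (G 0 0 + G 1 1 + G 2 2) else 0) := by
      simp [newtonianStress, Matrix.trace, Fin.sum_univ_three, Matrix.one_apply, mul_add]
    rw [h1]
    have h2 : (ν₁ * (G i j + G j i)) ^ 2 ≤ 2 * ν₁ ^ 2 * (G i j ^ 2 + G j i ^ 2) := by
      nlinarith [mul_nonneg (sq_nonneg ν₁) (sq_nonneg (G i j - G j i))]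
    split_ifs
    · have h3 : (ν₂ * (G 0 0 + G 1 1 + G 2 2)) ^ 2
          ≤ 3 * ν₂ ^ 2 * (G 0 0 ^ 2 + G 1 1 ^ 2 + G 2 2 ^ 2) := by
        nlinarith [mul_nonneg (sq_nonneg ν₂) (sq_nonneg (G 0 0 - G 1 1)),
          mul_nonneg (sq_nonneg ν₂) (sq_nonneg (G 0 0 - G 2 2)),
          mul_nonneg (sq_nonneg ν₂) (sq_nonneg (G 1 1 - G 2 2))]
      nlinarith [sq_nonneg (ν₁ * (G i j + G j i) - ν₂ * (G 0 0 + G 1 1 + G 2 2))]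
    · nlinarith [mul_nonneg (sq_nonneg ν₁) (add_nonneg (sq_nonneg (G i j)) (sq_nonneg (G j i)))]
  have hle : contract (newtonianStress ν₁ ν₂ G) (newtonianStress ν₁ ν₂ G)
      ≤ ∑ i, ∑ j, (4 * ν₁ ^ 2 * (G i j ^ 2 + G j i ^ 2)
        + (if i = j then 6 * ν₂ ^ 2 * (G 0 0 ^ 2 + G 1 1 ^ 2 + G 2 2 ^ 2) else 0)) := by
    unfold contract
    refine Finset.sum_le_sum fun i _ => Finset.sum_le_sum fun j _ => ?_
    rw [← sq]
    exact hS i j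
  refine hle.trans ?_
  simp only [contract, Fin.sum_univ_three, ← sq]
  norm_num [Fin.ext_iff]
  have hn : ∀ i j, 0 ≤ ν₂ ^ 2 * G i j ^ 2 := fun i j => by positivity
  linarith [hn 0 1, hn 0 2, hn 1 0, hn 1 2, hn 2 0, hn 2 1]

/-- Measurability, integrability and the weak equations for data with bounded energy. -/
theorem EnergyBounds.weakData {Ω : Set R3} {T E : ℝ} (hV : volume Ω ≠ ⊤)
    {ϱ p : R4 → ℝ} {u f : R4 → R3} {S : R4 → Matrix (Fin 3) (Fin 3) ℝ}
    (hE : EnergyBounds Ω T E ϱ p u) (hSm : ∀ i j, Measurable fun z => S z i j)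
    (hfm : AEStronglyMeasurable f (volume.restrict (cylinder Ω T)))
    {Cf : ℝ} (hf : ∀ᵐ z ∂(volume.restrict (cylinder Ω T)), ‖f z‖ ≤ Cf)
    {S₂ : ℝ}
    (hS : ∫⁻ z in cylinder Ω T, ENNReal.ofReal (contract (S z) (S z)) ≤ ENNReal.ofReal S₂)
    (hmom : ∀ ξ : R4 → R3, IsTestFunction (cylinder Ω T) ξ →
      (∫ z in cylinder Ω T, ϱ z * inner ℝ (u z) (dt ξ z))
        + (∫ z in cylinder Ω T,
            contract (ϱ z • tensor (u z) (u z)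
              + p z • (1 : Matrix (Fin 3) (Fin 3) ℝ) - S z) (grad ξ z))
        + (∫ z in cylinder Ω T, ϱ z * inner ℝ (f z) (ξ z)) = 0)
    (hmass : ∀ ψ : R4 → ℝ, IsTestFunction (cylinder Ω T) ψ →
      ∫ z in cylinder Ω T, (ϱ z * dt ψ z + ∑ j, ϱ z * u z j * dx j ψ z) = 0) :
    WeakData Ω T ϱ p u f S := by
  have hm1 := hE.meas_density
  have hm2 := hE.meas_pressure
  have hm3 := hE.meas_velocity
  have hϱ := hE.density_nonneg
  have hp := hE.pressure_nonneg
  have hvol : volume (cylinder Ω T) ≠ ⊤ := by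
    have : (volume : Measure R4) (cylinder Ω T) = volume Ω * volume (Ioo 0 T) :=
      Measure.prod_prod _ _
    rw [this]
    simp only [Real.volume_Ioo]
    finiteness
  have i1 : IntegrableOn (fun _ : R4 => (1 : ℝ)) (cylinder Ω T) := integrableOn_const hvol
  have of_le : ∀ {a : R4 → ℝ} {C : ℝ≥0∞}, Measurable a → (∀ z, 0 ≤ a z) → C ≠ ⊤ →
      ∫⁻ z in cylinder Ω T, ENNReal.ofReal (a z) ≤ C → IntegrableOn a (cylinder Ω T) := by
    intro a C ha ha0 hC h
    refine ⟨ha.aestronglyMeasurable, ?_⟩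
    rw [hasFiniteIntegral_iff_ofReal (ae_of_all _ ha0)]
    exact h.trans_lt hC.lt_top
  have ip : IntegrableOn p (cylinder Ω T) :=
    of_le hm2 hp (by finiteness) (lintegral_cylinder_le_const (by fun_prop) hE.pressure_le)
  have ik : IntegrableOn (fun z => ϱ z * ‖u z‖ ^ 2) (cylinder Ω T) :=
    of_le (by fun_prop) (fun z => mul_nonneg (hϱ z) (sq_nonneg _)) (by finiteness)
      (lintegral_cylinder_le_const (by fun_prop) hE.kinetic_le)
  have ic : IntegrableOn (fun z => contract (S z) (S z)) (cylinder Ω T) :=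
    of_le (measurable_contract hSm) (fun z => contract_self_nonneg _) ENNReal.ofReal_ne_top hS
  have ir : IntegrableOn ϱ (cylinder Ω T) := by
    refine (i1.add ip).mono' hm1.aestronglyMeasurable (ae_of_all _ fun z => ?_)
    rw [Real.norm_eq_abs, abs_of_nonneg (hϱ z)]
    exact (density_le (hϱ z)).trans (add_le_add_right (hE.rpow_le_pressure z) 1)
  have hui : ∀ z i, |u z i| ≤ ‖u z‖ := fun z i => PiLp.norm_apply_le (u z) i
  have mui : ∀ i, Measurable fun z => u z i := fun i => by fun_prop
  refine ⟨ir, fun i => ?_, fun i j => ?_, ip, fun i j => ?_, fun i => ?_, hmom, hmass⟩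
  · refine (ir.add ik).mono' (hm1.mul (mui i)).aestronglyMeasurable (ae_of_all _ fun z => ?_)
    rw [Real.norm_eq_abs, abs_mul, abs_of_nonneg (hϱ z)]
    have h1 := mul_le_mul_of_nonneg_left (hui z i) (hϱ z)
    simp only [Pi.add_apply]
    nlinarith [mul_nonneg (hϱ z) (sq_nonneg (‖u z‖ - 1)), mul_nonneg (hϱ z) (sq_nonneg ‖u z‖), hϱ z]
  · refine ik.mono' (hm1.mul ((mui i).mul (mui j))).aestronglyMeasurable (ae_of_all _ fun z => ?_)
    rw [Real.norm_eq_abs, abs_mul, abs_mul, abs_of_nonneg (hϱ z), sq]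
    exact mul_le_mul_of_nonneg_left (mul_le_mul (hui z i) (hui z j) (abs_nonneg _) (norm_nonneg _))
      (hϱ z)
  · refine (i1.add ic).mono' (hSm i j).aestronglyMeasurable (ae_of_all _ fun z => ?_)
    have h1 := sq_entry_le_contract (S z) i j
    rw [← sq_abs] at h1
    rw [Real.norm_eq_abs]
    simp only [Pi.add_apply]
    nlinarith [sq_nonneg (|S z i j| - 1)]
  · refine (ir.const_mul Cf).mono' (hm1.aestronglyMeasurable.mul
      ((EuclideanSpace.proj (𝕜 := ℝ) i).continuous.comp_aestronglyMeasurable hfm)) ?_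
    filter_upwards [hf] with z hz
    rw [Real.norm_eq_abs, abs_mul, abs_of_nonneg (hϱ z), mul_comm]
    exact mul_le_mul_of_nonneg_right ((PiLp.norm_apply_le (f z) i).trans hz) (hϱ z)

/-- The factor in the time dependent Sobolev majorant. -/
def sobolevFactor (M : ℝ) : ℝ := (1 + (27 * sobolevConst).toReal) * (6 * M ^ 2)

/-- The majorant is one plus a multiple of the squared `W^{1,2}` norm of the slice. The energy makes
it integrable in time, and the local Sobolev inequality bounds the sixth power of `φ u` by its cube.
The added one keeps negative powers of it harmless. -/
theorem exists_sobolev_majorant {Ω : Set R3} {T E M : ℝ}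
    {φ : R4 → ℝ} (hφ : IsTestFunction (cylinder Ω T) φ) (hM1 : ∀ z, |φ z| ≤ M)
    (hM2 : ∀ j z, |dx j φ z| ≤ M) {u u' : R4 → R3} {G G' : R4 → Matrix (Fin 3) (Fin 3) ℝ}
    (hu' : Measurable u') (hG' : ∀ i j, Measurable fun z => G' z i j)
    (huu : u =ᵐ[volume.restrict (cylinder Ω T)] u')
    (hGG : G =ᵐ[volume.restrict (cylinder Ω T)] G')
    (hw : ∀ᵐ t ∂(volume.restrict (Ioo 0 T)),
      IsWeakGradient Ω (fun x => u (x, t)) (fun x => G (x, t)))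
    (hT : 0 ≤ T) (hE : 0 ≤ E) (h : normL2W12 Ω T u G ≤ ENNReal.ofReal E) :
    ∃ D : ℝ → ℝ, Measurable D ∧ (∀ t, 1 ≤ D t) ∧
      ∫⁻ t in Ioo 0 T, ENNReal.ofReal (D t) ≤ ENNReal.ofReal (T + sobolevFactor M * E ^ 2) ∧
      ∀ᵐ t ∂(volume.restrict (Ioo 0 T)),
        ∫⁻ x in Ω, ENNReal.ofReal ((φ (x, t) ^ 2 * ‖u' (x, t)‖ ^ 2) ^ 3)
          ≤ ENNReal.ofReal (D t ^ 3) := by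
  have mc := measurable_contract hG'
  set N : ℝ → ℝ≥0∞ := fun t =>
    ∫⁻ x in Ω, ENNReal.ofReal (‖u' (x, t)‖ ^ 2 + contract (G' (x, t)) (G' (x, t))) with hN
  have mN : Measurable N := Measurable.lintegral_prod_left' (f := fun z : R4 =>
    ENNReal.ofReal (‖u' z‖ ^ 2 + contract (G' z) (G' z))) (by fun_prop)
  have hNeq : ∀ᵐ t ∂(volume.restrict (Ioo 0 T)),
      ∫⁻ x in Ω, ENNReal.ofReal (‖u (x, t)‖ ^ 2 + contract (G (x, t)) (G (x, t))) = N t := by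
    filter_upwards [ae_slice huu, ae_slice hGG] with t h1 h2
    refine lintegral_congr_ae ?_
    filter_upwards [h1, h2] with x h3 h4
    rw [h3, h4]
  have hNle : ∫⁻ t in Ioo 0 T, N t ≤ ENNReal.ofReal (E ^ 2) := by
    rw [← lintegral_congr_ae hNeq]
    exact le_sq_of_sqrt_le hE h
  have hNfin : ∀ᵐ t ∂(volume.restrict (Ioo 0 T)), N t < ⊤ :=
    ae_lt_top mN (ne_top_of_le_ne_top ENNReal.ofReal_ne_top hNle)
  set c := sobolevFactor M with hc
  have hk0 : 0 ≤ (27 * sobolevConst).toReal := ENNReal.toReal_nonneg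
  have hc0 : 0 ≤ c := by rw [hc, sobolevFactor]; positivity
  refine ⟨fun t => 1 + c * (N t).toReal, by fun_prop, fun t => ?_, ?_, ?_⟩
  · have := mul_nonneg hc0 (ENNReal.toReal_nonneg (a := N t))
    linarith
  · calc ∫⁻ t in Ioo 0 T, ENNReal.ofReal (1 + c * (N t).toReal)
        ≤ ∫⁻ t in Ioo 0 T, (1 + ENNReal.ofReal c * N t) := by
          refine lintegral_mono fun t => ?_
          refine ENNReal.ofReal_add_le.trans ?_
          rw [ENNReal.ofReal_one, ENNReal.ofReal_mul hc0]
          gcongr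
          exact ENNReal.ofReal_toReal_le
      _ = ENNReal.ofReal T + ENNReal.ofReal c * ∫⁻ t in Ioo 0 T, N t := by
          rw [lintegral_add_left measurable_const, lintegral_const_mul _ mN]
          simp
      _ ≤ _ := by
          rw [ENNReal.ofReal_add hT (by positivity), ENNReal.ofReal_mul hc0]
          gcongr
  · filter_upwards [hw, hNeq, hNfin, ae_slice huu] with t h1 h2 h3 h4
    have h5 := sobolev_cutoff (hφ.slice t) h1 (M := M) (fun x => hM1 _)
      (fun x j => by rw [fderiv_slice hφ.1]; exact hM2 _ _)
    rw [h2] at h5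
    have h6 : ∫⁻ x in Ω, ENNReal.ofReal ((φ (x, t) ^ 2 * ‖u' (x, t)‖ ^ 2) ^ 3)
        = ∫⁻ x in Ω, ENNReal.ofReal ((φ (x, t) ^ 2 * ‖u (x, t)‖ ^ 2) ^ 3) := by
      refine lintegral_congr_ae ?_
      filter_upwards [h4] with x hx
      rw [hx]
    rw [h6]
    refine h5.trans ?_
    have hS : (27 * sobolevConst : ℝ≥0∞) ≠ ⊤ := by
      have := sobolevConst_ne_top; finiteness
    rw [← ENNReal.ofReal_toReal hS, ← ENNReal.ofReal_toReal h3.ne,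
      ← ENNReal.ofReal_mul (by positivity), ← ENNReal.ofReal_pow (by positivity),
      ← ENNReal.ofReal_mul hk0]
    apply ENNReal.ofReal_le_ofReal
    set k := (27 * sobolevConst).toReal
    set n := (N t).toReal
    have hn : 0 ≤ n := ENNReal.toReal_nonneg
    rw [ENNReal.toReal_ofReal hn]
    -- The Sobolev constant is put inside the cube without taking a cube root.
    have hk1 : k ≤ (1 + k) ^ 3 := by nlinarith [sq_nonneg k, mul_nonneg hk0 (sq_nonneg k)]
    calc k * (6 * M ^ 2 * n) ^ 3 ≤ (1 + k) ^ 3 * (6 * M ^ 2 * n) ^ 3 := by gcongr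
      _ = (c * n) ^ 3 := by rw [hc, sobolevFactor]; ring
      _ ≤ (1 + c * n) ^ 3 := by gcongr; linarith

/-- Reduction of the logarithmic potential to the potential with kernel `kb`. -/
theorem logPotentialIntegral_localized_le {Ω : Set R3} (hΩ : MeasurableSet Ω) {T R : ℝ}
    (hR1 : 1 ≤ R) (hR : ∀ x ∈ Ω, ∀ y ∈ Ω, ‖x - y‖ < R) {μ : ℝ} (hμ0 : 0 ≤ μ) (hμ : μ ≤ 4 / 3)
    {cutoff : R4 → ℝ} (hc : tsupport cutoff ⊆ cylinder Ω T) {M : ℝ}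
    (hM : ∀ z, cutoff z ^ 4 ≤ M) (hcm : Measurable cutoff)
    {ϱ ϱ' : R4 → ℝ} (hϱ : ϱ =ᵐ[volume.restrict (cylinder Ω T)] ϱ') (hϱm : Measurable ϱ')
    (hϱ0 : ∀ z, 0 ≤ ϱ' z) :
    logPotentialIntegral μ (localized cutoff ϱ)
      ≤ ENNReal.ofReal (M ^ (1 / 2 : ℝ) * logConst R) *
        ∫⁻ z in cylinder Ω T, ENNReal.ofReal (cutoff z ^ 4 * ϱ' z ^ (3 / 2 : ℝ)) *
          slicePot Ω (fun v => kb (‖v‖ ^ 2)) (fun z => cutoff z ^ 4 * ϱ' z) z := by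
  have hQ : MeasurableSet (cylinder Ω T) := hΩ.prod measurableSet_Ioo
  have hzero : ∀ z ∉ cylinder Ω T, localized cutoff ϱ z = 0 := fun z hz => by
    have : cutoff z = 0 := image_eq_zero_of_notMem_tsupport fun h => hz (hc h)
    simp [localized, this]
  have hθ0 : ∀ z, 0 ≤ cutoff z ^ 4 := fun z => by positivity
  have hM0 : 0 ≤ M := (hθ0 0).trans (hM 0)
  have hK : 0 ≤ logConst R := by
    have := Real.log_nonneg hR1
    unfold logConst; positivity
  have mslice := measurable_slicePot Ω (K := fun v => kb (‖v‖ ^ 2))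
    (measurable_kb.comp (by fun_prop)) (g := fun z => cutoff z ^ 4 * ϱ' z) (by fun_prop)
  unfold logPotentialIntegral
  set J : R4 → ℝ≥0∞ := fun z => ∫⁻ y : R3, ENNReal.ofReal
      ((|Real.log ‖z.1 - y‖| ^ μ + 1) / ‖z.1 - y‖ * localized cutoff ϱ (y, z.2)) with hJ
  have hout : (fun z => ENNReal.ofReal (localized cutoff ϱ z ^ (3 / 2 : ℝ)) * J z)
      = (cylinder Ω T).indicator
        fun z => ENNReal.ofReal (localized cutoff ϱ z ^ (3 / 2 : ℝ)) * J z := by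
    ext z
    by_cases hz : z ∈ cylinder Ω T
    · rw [indicator_of_mem hz]
    · rw [indicator_of_notMem hz, hzero z hz, Real.zero_rpow (by norm_num), ENNReal.ofReal_zero,
        zero_mul]
  rw [hout, lintegral_indicator hQ, ← lintegral_const_mul _ (by fun_prop)]
  have hmem : ∀ᵐ z ∂(volume.restrict (cylinder Ω T)), z ∈ cylinder Ω T := ae_restrict_mem hQ
  refine lintegral_mono_ae ?_
  filter_upwards [hmem, hϱ, ae_cylinder_of_ae (ae_slice hϱ)] with z hz hz1 hz2
  have h1 : J z ≤ ENNReal.ofReal (logConst R) *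
      slicePot Ω (fun v => kb (‖v‖ ^ 2)) (fun z => cutoff z ^ 4 * ϱ' z) z := by
    have hin : (fun y => ENNReal.ofReal ((|Real.log ‖z.1 - y‖| ^ μ + 1) / ‖z.1 - y‖ *
          localized cutoff ϱ (y, z.2)))
        = Ω.indicator fun y => ENNReal.ofReal ((|Real.log ‖z.1 - y‖| ^ μ + 1) / ‖z.1 - y‖ *
          localized cutoff ϱ (y, z.2)) := by
      ext y
      by_cases hy : y ∈ Ω
      · rw [indicator_of_mem hy]
      · rw [indicator_of_notMem hy, hzero (y, z.2) fun h => hy h.1, mul_zero, ENNReal.ofReal_zero]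
    have mkb := measurable_kb
    simp only [hJ]
    rw [hin, lintegral_indicator hΩ, slicePot, ← lintegral_const_mul _ (by fun_prop)]
    refine lintegral_mono_ae ?_
    filter_upwards [hz2, ae_restrict_mem hΩ] with y hy hyΩ
    rw [← ENNReal.ofReal_mul hK]
    apply ENNReal.ofReal_le_ofReal
    have h2 := log_kernel_le hμ0 hμ (norm_nonneg (z.1 - y)) (hR _ hz.1 _ hyΩ) hR1
    have h3 : 0 ≤ cutoff (y, z.2) ^ 4 * ϱ' (y, z.2) := mul_nonneg (hθ0 _) (hϱ0 _)
    rw [localized, hy]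
    calc _ ≤ logConst R * kb (‖z.1 - y‖ ^ 2) * (cutoff (y, z.2) ^ 4 * ϱ' (y, z.2)) :=
          mul_le_mul_of_nonneg_right h2 h3
      _ = _ := by ring
  -- The localised power carries `λ⁶`, whereas the estimate carries `λ⁴`; the spare `λ² =
  -- (λ⁴)^{1/2}` is bounded by `M^{1/2}`.
  have h2 : localized cutoff ϱ z ^ (3 / 2 : ℝ)
      ≤ M ^ (1 / 2 : ℝ) * (cutoff z ^ 4 * ϱ' z ^ (3 / 2 : ℝ)) := by
    rw [localized, hz1, Real.mul_rpow (hθ0 z) (hϱ0 z), ← mul_assoc]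
    have h3 : (cutoff z ^ 4) ^ (3 / 2 : ℝ) = (cutoff z ^ 4) ^ (1 / 2 : ℝ) * cutoff z ^ 4 := by
      rw [← Real.rpow_add_one' (hθ0 z) (by norm_num)]
      norm_num
    rw [h3]
    have h4 := Real.rpow_le_rpow (hθ0 z) (hM z) (by norm_num : (0 : ℝ) ≤ 1 / 2)
    have h5 := hθ0 z
    have h6 : 0 ≤ ϱ' z ^ (3 / 2 : ℝ) := Real.rpow_nonneg (hϱ0 z) _
    gcongr
  calc _ ≤ ENNReal.ofReal (M ^ (1 / 2 : ℝ) * (cutoff z ^ 4 * ϱ' z ^ (3 / 2 : ℝ))) *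
        (ENNReal.ofReal (logConst R) *
          slicePot Ω (fun v => kb (‖v‖ ^ 2)) (fun z => cutoff z ^ 4 * ϱ' z) z) :=
        mul_le_mul' (ENNReal.ofReal_le_ofReal h2) h1
    _ = _ := by
        rw [ENNReal.ofReal_mul (by positivity : 0 ≤ M ^ (1 / 2 : ℝ)),
          ENNReal.ofReal_mul (by positivity : 0 ≤ M ^ (1 / 2 : ℝ))]
        ring

/-- The bound for the square of the `L²` norm of the stress. -/
def stressConst (ν₁ ν₂ E CS : ℝ) : ℝ := (8 * ν₁ ^ 2 + 18 * ν₂ ^ 2) * E ^ 2 + CS ^ 2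

/-- Both alternatives for the stress reduce to one square integrability bound: the Newtonian stress
is linear in the gradient, which the energy controls in `L²`. -/
theorem lintegral_stress_le {Ω : Set R3} {T ν₁ ν₂ E CS : ℝ} (hE : 0 ≤ E) (hCS : 0 ≤ CS)
    {u : R4 → R3} {G S : R4 → Matrix (Fin 3) (Fin 3) ℝ}
    (hum : AEStronglyMeasurable u (volume.restrict (cylinder Ω T)))
    (hGm : ∀ i j, AEStronglyMeasurable (fun z => G z i j) (volume.restrict (cylinder Ω T)))
    (hu : normL2W12 Ω T u G ≤ ENNReal.ofReal E)
    (hS : (∀ᵐ z ∂(volume.restrict (cylinder Ω T)), S z = newtonianStress ν₁ ν₂ (G z)) ∨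
      normL2 Ω T S ≤ ENNReal.ofReal CS) :
    ∫⁻ z in cylinder Ω T, ENNReal.ofReal (contract (S z) (S z))
      ≤ ENNReal.ofReal (stressConst ν₁ ν₂ E CS) := by
  have hk : 0 ≤ 8 * ν₁ ^ 2 + 18 * ν₂ ^ 2 := by positivity
  rcases hS with hS | hS
  · have h1 := le_sq_of_sqrt_le hE hu
    have hm : AEMeasurable (fun z => ENNReal.ofReal (‖u z‖ ^ 2 + contract (G z) (G z)))
        (volume.restrict (cylinder Ω T)) := by
      have h2 : AEMeasurable (fun z => contract (G z) (G z)) (volume.restrict (cylinder Ω T)) :=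
        Finset.aemeasurable_fun_sum _ fun i _ => Finset.aemeasurable_fun_sum _ fun j _ =>
          (hGm i j).aemeasurable.mul (hGm i j).aemeasurable
      exact ((hum.aemeasurable.norm.pow_const 2).add h2).ennreal_ofReal
    have h3 : ∫⁻ z in cylinder Ω T, ENNReal.ofReal (‖u z‖ ^ 2 + contract (G z) (G z))
        ≤ ENNReal.ofReal (E ^ 2) := by
      rw [restrict_cylinder] at hm ⊢
      rwa [lintegral_prod_symm _ hm]
    calc _ ≤ ∫⁻ z in cylinder Ω T, ENNReal.ofReal (8 * ν₁ ^ 2 + 18 * ν₂ ^ 2) *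
          ENNReal.ofReal (‖u z‖ ^ 2 + contract (G z) (G z)) := by
          refine lintegral_mono_ae ?_
          filter_upwards [hS] with z hz
          rw [hz, ← ENNReal.ofReal_mul hk]
          apply ENNReal.ofReal_le_ofReal
          refine (contract_newtonianStress_le ν₁ ν₂ (G z)).trans ?_
          exact mul_le_mul_of_nonneg_left (by linarith [sq_nonneg ‖u z‖]) hk
      _ = ENNReal.ofReal (8 * ν₁ ^ 2 + 18 * ν₂ ^ 2) *
          ∫⁻ z in cylinder Ω T, ENNReal.ofReal (‖u z‖ ^ 2 + contract (G z) (G z)) :=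
          lintegral_const_mul' _ _ ENNReal.ofReal_ne_top
      _ ≤ ENNReal.ofReal ((8 * ν₁ ^ 2 + 18 * ν₂ ^ 2) * E ^ 2) := by
          rw [ENNReal.ofReal_mul hk]; gcongr
      _ ≤ _ := ENNReal.ofReal_le_ofReal (by unfold stressConst; nlinarith [sq_nonneg CS])
  · refine (le_sq_of_sqrt_le hCS hS).trans (ENNReal.ofReal_le_ofReal ?_)
    unfold stressConst
    nlinarith [mul_nonneg hk (sq_nonneg E)]

/-- The explicit constant contains neither `ε` nor `m`. The fields are first replaced by measurable
representatives with an everywhere nonnegative density, which changes none of the integrals. -/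
theorem logPotentialIntegral_le_of_weakSolution {Ω : Set R3} (hΩ : MeasurableSet Ω) {T R : ℝ}
    (hT : 0 < T) (hR1 : 1 ≤ R) (hR : ∀ x ∈ Ω, ∀ y ∈ Ω, ‖x - y‖ < R) (hV : volume Ω ≠ ⊤)
    {ν₁ ν₂ E Cf CS : ℝ} (hE : 0 ≤ E) (hCf : 0 ≤ Cf) (hCS : 0 ≤ CS) {cutoff : R4 → ℝ}
    (hcutoff : IsTestFunction (cylinder Ω T) cutoff) {M : ℝ} (hM : 0 ≤ M)
    (hM1 : ∀ z, |cutoff z ^ 4| ≤ M) (hM2 : ∀ z, |dt (fun z => cutoff z ^ 4) z| ≤ M)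
    (hM3 : ∀ j z, |dx j (fun z => cutoff z ^ 4) z| ≤ M)
    (hM4 : ∀ z, |cutoff z ^ 2| ≤ M) (hM5 : ∀ j z, |dx j (fun z => cutoff z ^ 2) z| ≤ M)
    {μ : ℝ} (hμ0 : 0 ≤ μ) (hμ : μ ≤ 4 / 3) {ε m : ℝ} (hε : 0 ≤ ε) {f : R4 → R3}
    {S : R4 → Matrix (Fin 3) (Fin 3) ℝ} {ϱ : R4 → ℝ} {u : R4 → R3}
    {G : R4 → Matrix (Fin 3) (Fin 3) ℝ} (hsol : IsWeakSolution Ω T ε m f S ϱ u G)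
    (hf : ∀ᵐ z ∂(volume.restrict (cylinder Ω T)), ‖f z‖ ≤ Cf)
    (hS : (∀ᵐ z ∂(volume.restrict (cylinder Ω T)), S z = newtonianStress ν₁ ν₂ (G z)) ∨
      normL2 Ω T S ≤ ENNReal.ofReal CS)
    (hen : energy Ω T ε m ϱ u G ≤ ENNReal.ofReal E) :
    logPotentialIntegral μ (localized cutoff ϱ)
      ≤ ENNReal.ofReal (M ^ (1 / 2 : ℝ) * logConst R *
        potentialConst (volume Ω).toReal T E R M Cf (stressConst ν₁ ν₂ E CS)
          (T + sobolevFactor M * E ^ 2)) := by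
  have hS₂ := lintegral_stress_le hE hCS hsol.meas_velocity hsol.meas_grad
    (le_add_self.trans hen) hS
  have hpE : normLinftyL1 Ω T (fun z => pressure ε m (ϱ z)) ≤ ENNReal.ofReal E :=
    (le_self_add.trans le_self_add).trans hen
  have hkE : normLinftyL1 Ω T (fun z => ϱ z * ‖u z‖ ^ 2) ≤ ENNReal.ofReal E :=
    (le_add_self.trans le_self_add).trans hen
  have huE : normL2W12 Ω T u G ≤ ENNReal.ofReal E := le_add_self.trans hen
  -- measurable representatives
  set ϱ' : R4 → ℝ := fun z => max 0 (hsol.meas_density.mk ϱ z) with hϱ'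
  set u' : R4 → R3 := hsol.meas_velocity.mk u with hu'
  set G' : R4 → Matrix (Fin 3) (Fin 3) ℝ := fun z => Matrix.of fun i j =>
    (hsol.meas_grad i j).mk _ z with hG'
  set S' : R4 → Matrix (Fin 3) (Fin 3) ℝ := fun z => Matrix.of fun i j =>
    (hsol.meas_S i j).mk _ z with hS'
  have eϱ : ϱ =ᵐ[volume.restrict (cylinder Ω T)] ϱ' := by
    filter_upwards [hsol.meas_density.ae_eq_mk, hsol.density_nonneg] with z h1 h2
    rw [hϱ']; dsimp only; rw [← h1, max_eq_right h2]
  have eu : u =ᵐ[volume.restrict (cylinder Ω T)] u' := hsol.meas_velocity.ae_eq_mk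
  have eG : G =ᵐ[volume.restrict (cylinder Ω T)] G' := by
    have h : ∀ᵐ z ∂(volume.restrict (cylinder Ω T)), ∀ i j,
        G z i j = (hsol.meas_grad i j).mk _ z :=
      ae_all_iff.2 fun i => ae_all_iff.2 fun j => (hsol.meas_grad i j).ae_eq_mk
    filter_upwards [h] with z hz
    ext i j; exact hz i j
  have eS : S =ᵐ[volume.restrict (cylinder Ω T)] S' := by
    have h : ∀ᵐ z ∂(volume.restrict (cylinder Ω T)), ∀ i j,
        S z i j = (hsol.meas_S i j).mk _ z :=
      ae_all_iff.2 fun i => ae_all_iff.2 fun j => (hsol.meas_S i j).ae_eq_mk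
    filter_upwards [h] with z hz
    ext i j; exact hz i j
  have mϱ : Measurable ϱ' := measurable_const.max hsol.meas_density.measurable_mk
  have mu : Measurable u' := hsol.meas_velocity.measurable_mk
  have mG : ∀ i j, Measurable fun z => G' z i j := fun i j => (hsol.meas_grad i j).measurable_mk
  have mS : ∀ i j, Measurable fun z => S' z i j := fun i j => (hsol.meas_S i j).measurable_mk
  have hϱ0 : ∀ z, 0 ≤ ϱ' z := fun z => le_max_left _ _
  have hple : ∀ z, ϱ' z ^ (3 / 2 : ℝ) ≤ pressure ε m (ϱ' z) := fun z => by
    have h1 : 0 ≤ ϱ' z ^ (3 / 2 : ℝ) := Real.rpow_nonneg (hϱ0 z) _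
    have h2 : 0 ≤ ε * ϱ' z ^ m := mul_nonneg hε (Real.rpow_nonneg (hϱ0 z) _)
    unfold pressure
    exact le_mul_of_one_le_right h1 (by linarith)
  have hbounds : EnergyBounds Ω T E ϱ' (fun z => pressure ε m (ϱ' z)) u' :=
    { nonneg := hE
      meas_density := mϱ
      meas_pressure := by unfold pressure; fun_prop
      meas_velocity := mu
      density_nonneg := hϱ0
      rpow_le_pressure := hple
      pressure_le := by
        refine ae_le_of_normLinftyL1_le ?_
          (fun z => (Real.rpow_nonneg (hϱ0 z) _).trans (hple z)) hpE
        filter_upwards [eϱ] with z hz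
        rw [hz]
      kinetic_le := by
        refine ae_le_of_normLinftyL1_le ?_
          (g' := fun z => ϱ' z * ‖u' z‖ ^ 2) (fun z => mul_nonneg (hϱ0 z) (sq_nonneg _)) hkE
        filter_upwards [eϱ, eu] with z h1 h2
        rw [h1, h2] }
  have hS₂' : ∫⁻ z in cylinder Ω T, ENNReal.ofReal (contract (S' z) (S' z))
      ≤ ENNReal.ofReal (stressConst ν₁ ν₂ E CS) := by
    refine le_trans (le_of_eq (lintegral_congr_ae ?_)) hS₂
    filter_upwards [eS] with z hz
    rw [hz]
  have hweak : WeakData Ω T ϱ' (fun z => pressure ε m (ϱ' z)) u' f S' := by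
    refine hbounds.weakData hV mS hsol.meas_f hf hS₂' (fun ξ hξ => ?_) (fun ψ hψ => ?_)
    · rw [← hsol.momentum ξ hξ]
      congr 1
      · congr 1
        · refine integral_congr_ae ?_
          filter_upwards [eϱ, eu] with z h1 h2
          rw [h1, h2]
        · refine integral_congr_ae ?_
          filter_upwards [eϱ, eu, eS] with z h1 h2 h3
          rw [h1, h2, h3]
      · refine integral_congr_ae ?_
        filter_upwards [eϱ] with z h1
        rw [h1]
    · rw [← hsol.mass ψ hψ]
      refine integral_congr_ae ?_
      filter_upwards [eϱ, eu] with z h1 h2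
      rw [h1, h2]
  -- The Sobolev cut-off is `λ²`, whose square is the weight `θ = λ⁴`: the weight needs a smooth
  -- square root.
  obtain ⟨D, mD, hD1, hDF, hsob⟩ := exists_sobolev_majorant (hcutoff.pow two_ne_zero) hM4 hM5
    mu mG eu eG hsol.weak_grad hT.le hE huE
  have hF0 : 0 ≤ T + sobolevFactor M * E ^ 2 := by
    have : 0 ≤ sobolevFactor M := by
      have := ENNReal.toReal_nonneg (a := 27 * sobolevConst)
      unfold sobolevFactor; positivity
    positivity
  have hθ0 : ∀ z, 0 ≤ cutoff z ^ 4 := fun z => by positivity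
  have hcm : Measurable cutoff := hcutoff.1.continuous.measurable
  have hθM : ∀ z, cutoff z ^ 4 ≤ M := fun z => (le_abs_self _).trans (hM1 z)
  have hmain : ∫⁻ z in cylinder Ω T, ENNReal.ofReal (cutoff z ^ 4 * ϱ' z ^ (3 / 2 : ℝ)) *
        slicePot Ω (fun v => kb (‖v‖ ^ 2)) (fun z => cutoff z ^ 4 * ϱ' z) z
      ≤ ENNReal.ofReal (potentialConst (volume Ω).toReal T E R M Cf
          (stressConst ν₁ ν₂ E CS) (T + sobolevFactor M * E ^ 2)) := by
    refine lintegral_slicePot_kb_le (by fun_prop) (by fun_prop) fun δ hδ => ?_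
    refine lintegral_slicePot_le_of_pot (measurable_kbKer δ) (kbKer_le hδ) (by fun_prop)
      (by fun_prop) (fun w => mul_nonneg (hθ0 w) (hϱ0 w)) ENNReal.ofReal_ne_top
      (hbounds.lintegral_weighted_density_le hV hM hθM) fun n => ?_
    refine lintegral_mollified_potential_le hΩ hT hR1 hR hV hbounds hweak mS hCf hf
      (by unfold stressConst; positivity) hS₂' (hcutoff.pow four_ne_zero) hθ0 hM hθM hM2 hM3
      mD hD1 hF0 hDF ?_ (isMollifier_timeBump n) hδ
    filter_upwards [hsob] with t ht
    refine le_trans (le_of_eq ?_) ht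
    congr 1; ext x; congr 2; ring
  refine (logPotentialIntegral_localized_le hΩ hR1 hR hμ0 hμ hcutoff.2.2 hθM hcm eϱ mϱ hϱ0).trans ?_
  have hK : 0 ≤ logConst R := by
    have := Real.log_nonneg hR1
    unfold logConst; positivity
  rw [ENNReal.ofReal_mul (by positivity : 0 ≤ M ^ (1 / 2 : ℝ) * logConst R)]
  gcongr

end

end CompressibleNS

/-! ### The proposition -/

theorem proposition4p2 (Ω : Set CompressibleNS.R3) (hΩ : IsOpen Ω) (hΩb : Bornology.IsBounded Ω)
    (T : ℝ) (hT : 0 < T) (ν₁ ν₂ : ℝ) (hν₁ : 0 < ν₁) (hν₂ : 0 ≤ ν₁ + ν₂)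
    (E Cf CS : ℝ)
    (cutoff : CompressibleNS.R4 → ℝ)
    (hcutoff : CompressibleNS.IsTestFunction (CompressibleNS.cylinder Ω T) cutoff)
    (hcutoff_nonneg : ∀ z, 0 ≤ cutoff z)
    (μ : ℝ) (hμ : μ ∈ Set.Ioo (0 : ℝ) (4 / 3)) :
    ∃ c : ℝ, 0 < c ∧
      ∀ (ε m : ℝ), 0 < ε → 1 < m →
      ∀ (f : CompressibleNS.R4 → CompressibleNS.R3)
        (S : CompressibleNS.R4 → Matrix (Fin 3) (Fin 3) ℝ)
        (ϱ : CompressibleNS.R4 → ℝ) (u : CompressibleNS.R4 → CompressibleNS.R3)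
        (G : CompressibleNS.R4 → Matrix (Fin 3) (Fin 3) ℝ),
        CompressibleNS.IsWeakSolution Ω T ε m f S ϱ u G →
        (∀ᵐ z ∂(MeasureTheory.volume.restrict (CompressibleNS.cylinder Ω T)), ‖f z‖ ≤ Cf) →
        ((∀ᵐ z ∂(MeasureTheory.volume.restrict (CompressibleNS.cylinder Ω T)),
            S z = CompressibleNS.newtonianStress ν₁ ν₂ (G z)) ∨
          CompressibleNS.normL2 Ω T S ≤ ENNReal.ofReal CS) →
        CompressibleNS.energy Ω T ε m ϱ u G ≤ ENNReal.ofReal E →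
        CompressibleNS.logPotentialIntegral μ (CompressibleNS.localized cutoff ϱ)
          ≤ ENNReal.ofReal c := by
  obtain ⟨M₁, hM₁, a1, a2, a3⟩ := (hcutoff.pow four_ne_zero).exists_bound
  obtain ⟨M₂, -, b1, -, b3⟩ := (hcutoff.pow two_ne_zero).exists_bound
  have l1 := le_max_left M₁ M₂
  have l2 := le_max_right M₁ M₂
  -- The extra one makes the inequality strict and at the same time gives a radius at least one.
  have hR : ∀ x ∈ Ω, ∀ y ∈ Ω, ‖x - y‖ < Metric.diam Ω + 1 := fun x hx y hy => by
    have := Metric.dist_le_diam_of_mem hΩb hx hy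
    rw [dist_eq_norm] at this
    linarith
  have hR1 : 1 ≤ Metric.diam Ω + 1 := by linarith [Metric.diam_nonneg (s := Ω)]
  obtain ⟨c, hc⟩ : ∃ c : ℝ, ∀ (ε m : ℝ), 0 < ε → 1 < m →
      ∀ (f : CompressibleNS.R4 → CompressibleNS.R3)
        (S : CompressibleNS.R4 → Matrix (Fin 3) (Fin 3) ℝ)
        (ϱ : CompressibleNS.R4 → ℝ) (u : CompressibleNS.R4 → CompressibleNS.R3)
        (G : CompressibleNS.R4 → Matrix (Fin 3) (Fin 3) ℝ),
        CompressibleNS.IsWeakSolution Ω T ε m f S ϱ u G →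
        (∀ᵐ z ∂(MeasureTheory.volume.restrict (CompressibleNS.cylinder Ω T)), ‖f z‖ ≤ Cf) →
        ((∀ᵐ z ∂(MeasureTheory.volume.restrict (CompressibleNS.cylinder Ω T)),
            S z = CompressibleNS.newtonianStress ν₁ ν₂ (G z)) ∨
          CompressibleNS.normL2 Ω T S ≤ ENNReal.ofReal CS) →
        CompressibleNS.energy Ω T ε m ϱ u G ≤ ENNReal.ofReal E →
        CompressibleNS.logPotentialIntegral μ (CompressibleNS.localized cutoff ϱ)
          ≤ ENNReal.ofReal c := by
    -- The bounds `E`, `Cf`, `CS` carry no sign assumption and are replaced by their positive parts.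
    refine ⟨_, fun ε m hε _ f S ϱ u G hsol hf hS hen =>
      CompressibleNS.logPotentialIntegral_le_of_weakSolution (E := max E 0) (Cf := max Cf 0)
        (CS := max CS 0) (ν₁ := ν₁) (ν₂ := ν₂) hΩ.measurableSet hT hR1 hR
        hΩb.measure_lt_top.ne (le_max_right _ _) (le_max_right _ _) (le_max_right _ _) hcutoff
        (hM₁.trans l1) (fun z => (a1 z).trans l1) (fun z => (a2 z).trans l1)
        (fun j z => (a3 j z).trans l1) (fun z => (b1 z).trans l2) (fun j z => (b3 j z).trans l2)
        hμ.1.le hμ.2.le hε.le hsol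
        (hf.mono fun z hz => hz.trans (le_max_left _ _)) (hS.imp_right fun h => h.trans ?_)
        (hen.trans ?_)⟩
    · exact ENNReal.ofReal_le_ofReal (le_max_left _ _)
    · exact ENNReal.ofReal_le_ofReal (le_max_left _ _)
  -- The maximum with one supplies strict positivity.
  exact ⟨max c 1, lt_max_of_lt_right one_pos, fun ε m hε hm f S ϱ u G h1 h2 h3 h4 =>
    (hc ε m hε hm f S ϱ u G h1 h2 h3 h4).trans (ENNReal.ofReal_le_ofReal (le_max_left _ _))⟩
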